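/- **Theorem (propagation of chaos for the quantum Kac model).** *Setting.* Let $\mathcal H$ be a separable complex Hilbert space and let $h$ be a self-adjoint operator on $\mathcal H$ with compact resolvent. Write $\mathcal H_N=\mathcal H^{\otimes N}$ (Hilbert space tensor product), $\mathscr B(\mathcal H_N)$ for the bounded operators on $\mathcal H_N$, $H_N=\sum_{j=1}^N h_j$ where $h_j$ is $h$ acting on the $j$-th factor, and $P_E$ for the orthogonal projection onto the eigenspace of $H_2$ with eigenvalue $E$. A *collision specification* $(\mathcal C,U,\nu)$ consists of a compact metric space $\mathcal C$, an injective map $U$ from $\mathcal C$ to the unitary operators on $\mathcal H_2$ that is continuous in operator norm, and a Borel probability measure $\nu$ on $\mathcal C$ that charges every nonempty open set, such that 1. each $U(\sigma)$ commutes with $H_2$; 2. $U(\sigma_0)=1$ for some $\sigma_0\in\mathcal C$; 3. for every $\sigma$ there is $\sigma'$ with $U(\sigma)^*=U(\sigma')$, and the map $\sigma\mapsto\sigma'$ is measurable and leaves $\nu$ invariant; 4. for every $\sigma$ there is $\sigma'$ with $VU(\sigma)V^*=U(\sigma')$, where $V(\phi\otimes\psi)=\psi\otimes\phi$, and the map $\sigma\mapsto\sigma'$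 is measurable and leaves $\nu$ invariant. It is *ergodic* if the commutant of $\{U(\sigma):\sigma\in\mathcal C\}$ in $\mathscr B(\mathcal H_2)$ is the set of all bounded operators of the form $\sum_E\lambda_E P_E$ with $\lambda_E\in\mathbb C$ (the sum converging strongly). For $N\ge 2$ and $i<j$ let $U_{i,j}(\sigma)$ be $U(\sigma)$ acting on the $i$-th and $j$-th factors of $\mathcal H_N$, and on $\mathscr B(\mathcal H_N)$ put $$\mathscr Q_{i,j}A=\int_{\mathcal C}U_{i,j}(\sigma)\,A\,U_{i,j}(\sigma)^*\,d\nu(\sigma),\qquad \mathscr Q_N=\binom N2^{-1}\sum_{i<j}\mathscr Q_{i,j},\qquad \mathscr L_N=N(\mathscr Q_N-1),\qquad \mathscr P_{N,t}=e^{t\mathscr L_N}.$$ A density matrix is a positive operator of trace $1$. A density matrix on $\mathcal H_N$ is *symmetric* if it is invariant under conjugation by all permutations of the $N$ factors, and $\varrho^{(k)}$ denotes its partial trace over the last $N-k$ factors. Given a density matrix $\rho$ on $\mathcal H$, a sequence $\{\varrho_N\}_{N\ge2}$ of symmetric density matrices on $\mathcal H_N$ is *$\rho$-chaotic* if $\lim_{N\to\infty}\varrho_N^{(k)}=\rho^{\otimes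 k}$ in trace norm for every $k\ge1$. *Statement.* Let $(\mathcal C,U,\nu)$ be an ergodic collision specification, let $\rho$ be a density matrix on $\mathcal H$, and let $\{\varrho_N\}_{N\ge2}$ be $\rho$-chaotic. Then for every $t\ge0$ the limit $$\rho(t)=\lim_{N\to\infty}(\mathscr P_{N,t}\varrho_N)^{(1)}$$ exists in trace norm and is a density matrix on $\mathcal H$, and the sequence $\{\mathscr P_{N,t}\varrho_N\}_{N\ge2}$ is $\rho(t)$-chaotic. -/

import Mathlib

open MeasureTheory Filter Topology
open scoped InnerProductSpace

noncomputable section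

namespace QKac

/-! ### Square-summable families and the tensor powers of a Hilbert space

Relative to an orthonormal basis `b : HilbertBasis ι ℂ H`, the Hilbert tensor power `H ⊗ ⋯ ⊗ H`
(`N` factors) is realised as `ℓ²(ι ^ N)`: the elementary tensor `φ₁ ⊗ ⋯ ⊗ φ_N` is the family
`α ↦ ∏ i, ⟪b (α i), φ i⟫`. -/

/-- The Hilbert space `ℓ²(X)`. -/
def L2 (X : Type*) : Type _ := lp (fun _ : X => ℂ) 2

namespace L2

variable {X : Type*}

instance : NormedAddCommGroup (L2 X) :=
  inferInstanceAs (NormedAddCommGroup (lp (fun _ : X => ℂ) 2))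

instance : InnerProductSpace ℂ (L2 X) :=
  inferInstanceAs (InnerProductSpace ℂ (lp (fun _ : X => ℂ) 2))

instance : CompleteSpace (L2 X) := inferInstanceAs (CompleteSpace (lp (fun _ : X => ℂ) 2))

/-- The family underlying an element of `ℓ²(X)`. -/
def val (x : L2 X) : X → ℂ := x.1

instance : CoeFun (L2 X) fun _ => X → ℂ := ⟨val⟩

/-- The element of `ℓ²(X)` given by a square-summable family. -/
def mk (f : X → ℂ) (hf : Summable fun i => ‖f i‖ ^ 2) : L2 X :=
  ⟨f, by
    have : Memℓp f 2 := by
      rw [memℓp_gen_iff (by simp)]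
      simpa using hf
    exact this⟩

@[simp] theorem mk_apply (f : X → ℂ) (hf : Summable fun i => ‖f i‖ ^ 2) (i : X) :
    mk f hf i = f i := rfl

@[simp] theorem add_apply (x y : L2 X) (i : X) : (x + y) i = x i + y i := rfl

@[simp] theorem smul_apply (c : ℂ) (x : L2 X) (i : X) : (c • x) i = c * x i := rfl

@[ext] theorem ext {x y : L2 X} (h : ∀ i, x i = y i) : x = y := Subtype.ext (funext h)

theorem summable_sq (x : L2 X) : Summable fun i => ‖x i‖ ^ 2 := by
  have h : Memℓp x.val 2 := x.2
  rw [memℓp_gen_iff (by simp)] at h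
  simpa using h

theorem norm_sq_eq (x : L2 X) : ‖x‖ ^ 2 = ∑' i, ‖x i‖ ^ 2 := by
  have h : ‖x‖ ^ (2 : ENNReal).toReal = ∑' i, ‖x i‖ ^ (2 : ENNReal).toReal :=
    lp.norm_rpow_eq_tsum (p := 2) (by simp) (show lp (fun _ : X => ℂ) 2 from x)
  simpa using h

end L2

open L2

/-- The bounded operators on `ℓ²(X)`. -/
abbrev Op (X : Type*) := L2 X →L[ℂ] L2 X

/-- The bounded operators on the `N`-particle space `ℓ²(ι ^ N)`. -/
abbrev NOp (ι : Type*) (N : ℕ) := Op (Fin N → ι)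

/-- The canonical orthonormal basis of `ℓ²(X)`. -/
def stdBasis (X : Type*) : HilbertBasis X ℂ (L2 X) := HilbertBasis.ofRepr (.refl ℂ _)

/-- The coordinates `φ ↦ (⟪b i, φ⟫)_i` with respect to an orthonormal basis. -/
def coords {H : Type*} [NormedAddCommGroup H] [InnerProductSpace ℂ H] {ι : Type*}
    (b : HilbertBasis ι ℂ H) : H ≃ₗᵢ[ℂ] L2 ι := b.repr

theorem coords_apply {H : Type*} [NormedAddCommGroup H] [InnerProductSpace ℂ H] {ι : Type*}
    (b : HilbertBasis ι ℂ H) (φ : H) (i : ι) : coords b φ i = ⟪b i, φ⟫_ℂ :=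
  b.repr_apply_apply φ i

theorem summable_pi_prod {ι : Type*} {n : ℕ} (g : Fin n → ι → ℝ) (hg : ∀ i a, 0 ≤ g i a)
    (hs : ∀ i, Summable (g i)) : Summable fun α : Fin n → ι => ∏ i, g i (α i) := by
  induction n with
  | zero => exact Summable.of_finite
  | succ n ih =>
    rw [← (Fin.consEquiv fun _ => ι).summable_iff]
    have := (hs 0).mul_of_nonneg (ih (fun i => g i.succ) (fun i => hg _) (fun i => hs _))
      (hg 0) (fun α => Finset.prod_nonneg fun i _ => hg _ _)
    refine this.congr fun p => ?_
    simp [Fin.consEquiv, Fin.prod_univ_succ]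

/-- The elementary tensor `φ₁ ⊗ ⋯ ⊗ φ_N`. -/
def tprod {H : Type*} [NormedAddCommGroup H] [InnerProductSpace ℂ H] {ι : Type*}
    (b : HilbertBasis ι ℂ H) {N : ℕ} (φ : Fin N → H) : L2 (Fin N → ι) :=
  L2.mk (fun α => ∏ i, ⟪b (α i), φ i⟫_ℂ) <| by
    have := summable_pi_prod (fun i a => ‖coords b (φ i) a‖ ^ 2) (fun _ _ => by positivity)
      (fun i => summable_sq _)
    refine this.congr fun α => ?_
    simp [← Finset.prod_pow, coords_apply]

theorem hasSum_mul {X Y : Type*} {f : X → ℂ} {g : Y → ℂ} {s t : ℂ} (hf : HasSum f s)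
    (hg : HasSum g t) : HasSum (fun p : X × Y => f p.1 * g p.2) (s * t) := by
  have hs : Summable fun p : X × Y => f p.1 * g p.2 := by
    apply summable_mul_of_summable_norm hf.summable.norm hg.summable.norm
  exact hf.mul hg hs

/-- The elementary tensors have the inner products of the Hilbert tensor product. -/
theorem inner_tprod {H : Type*} [NormedAddCommGroup H] [InnerProductSpace ℂ H] {ι : Type*}
    (b : HilbertBasis ι ℂ H) {N : ℕ} (φ ψ : Fin N → H) :
    ⟪tprod b φ, tprod b ψ⟫_ℂ = ∏ i, ⟪φ i, ψ i⟫_ℂ := by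
  have key : ∀ (n : ℕ) (φ ψ : Fin n → H),
      HasSum (fun α : Fin n → ι => ∏ i, ⟪φ i, b (α i)⟫_ℂ * ⟪b (α i), ψ i⟫_ℂ)
        (∏ i, ⟪φ i, ψ i⟫_ℂ) := by
    intro n
    induction n with
    | zero =>
      intro φ ψ
      simp
    | succ n ih =>
      intro φ ψ
      rw [← (Fin.consEquiv fun _ => ι).hasSum_iff, Fin.prod_univ_succ]
      have h2 := hasSum_mul (b.hasSum_inner_mul_inner (φ 0) (ψ 0))
        (ih (fun i => φ i.succ) (fun i => ψ i.succ))
      have h3 : (fun α : Fin (n + 1) → ι => ∏ i, ⟪φ i, b (α i)⟫_ℂ * ⟪b (α i), ψ i⟫_ℂ) ∘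
          (Fin.consEquiv fun _ => ι) = fun p : ι × (Fin n → ι) =>
          (⟪φ 0, b p.1⟫_ℂ * ⟪b p.1, ψ 0⟫_ℂ) *
          ∏ i, ⟪φ (Fin.succ i), b (p.2 i)⟫_ℂ * ⟪b (p.2 i), ψ (Fin.succ i)⟫_ℂ := by
        funext p
        simp [Fin.consEquiv, Fin.prod_univ_succ]
      rw [h3]
      exact h2
  have hs : HasSum (fun α => ⟪(tprod b φ) α, (tprod b ψ) α⟫_ℂ) ⟪tprod b φ, tprod b ψ⟫_ℂ :=
    lp.hasSum_inner (𝕜 := ℂ) (G := fun _ : Fin N → ι => ℂ) (tprod b φ) (tprod b ψ)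
  refine hs.unique ?_
  convert key N φ ψ using 2 with α
  simp [tprod, ← Finset.prod_mul_distrib, mul_comm]

/-- The canonical basis vectors are the elementary tensors of basis vectors. -/
theorem stdBasis_eq {H : Type*} [NormedAddCommGroup H] [InnerProductSpace ℂ H] {ι : Type*}
    (b : HilbertBasis ι ℂ H) {N : ℕ} (α : Fin N → ι) :
    stdBasis (Fin N → ι) α = tprod b fun i => b (α i) := by
  classical
  ext β
  have h1 : (stdBasis (Fin N → ι) α).val β = if β = α then 1 else 0 := by
    have : stdBasis (Fin N → ι) α = lp.single 2 α (1 : ℂ) :=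
      ((stdBasis (Fin N → ι)).repr_symm_single α).symm
    rw [this]
    change (lp.single (E := fun _ : Fin N → ι => ℂ) 2 α (1 : ℂ) : _) β = _
    simp [Pi.single_apply]
  rw [h1]
  simp only [tprod, mk_apply, orthonormal_iff_ite.1 b.orthonormal]
  split_ifs with h
  · simp [h]
  · obtain ⟨i, hi⟩ := Function.ne_iff.1 h
    exact (Finset.prod_eq_zero (Finset.mem_univ i) (by simp [hi])).symm

/-- Re-indexing of families along a bijection, `x ↦ x ∘ e`. -/
def reindex {X Y : Type*} (e : X ≃ Y) : L2 Y ≃ₗᵢ[ℂ] L2 X where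
  toFun x := L2.mk (fun a => x (e a)) ((e.summable_iff (f := fun i => ‖x i‖ ^ 2)).2
    (summable_sq x))
  invFun x := L2.mk (fun a => x (e.symm a))
    ((e.symm.summable_iff (f := fun i => ‖x i‖ ^ 2)).2 (summable_sq x))
  map_add' _ _ := rfl
  map_smul' _ _ := rfl
  left_inv x := by ext a; simp
  right_inv x := by ext a; simp
  norm_map' x := by
    refine (sq_eq_sq₀ (norm_nonneg _) (norm_nonneg _)).1 ?_
    rw [norm_sq_eq, norm_sq_eq]
    exact e.tsum_eq (fun i => ‖x i‖ ^ 2)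

@[simp] theorem reindex_apply {X Y : Type*} (e : X ≃ Y) (x : L2 Y) (a : X) :
    reindex e x a = x (e a) := rfl

@[simp] theorem reindex_symm_apply {X Y : Type*} (e : X ≃ Y) (x : L2 X) (a : Y) :
    (reindex e).symm x a = x (e.symm a) := rfl

/-- Transport of an operator along a bijection of index sets. -/
def transport {X Y : Type*} (e : X ≃ Y) (A : Op Y) : Op X :=
  (reindex e : L2 Y →L[ℂ] L2 X) ∘L A ∘L ((reindex e).symm : L2 X →L[ℂ] L2 Y)

theorem summable_slice {X Y : Type*} (x : L2 (X × Y)) (y : Y) :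
    Summable fun a => ‖x (a, y)‖ ^ 2 :=
  (summable_sq x).comp_injective (i := fun a : X => (a, y)) fun _ _ h => (Prod.ext_iff.1 h).1

/-- The slice `x ↦ x (·, y)`, that is, the contraction `1 ⊗ ⟨e_y|` from `ℓ²(X) ⊗ ℓ²(Y)`
to `ℓ²(X)`. Its adjoint is `φ ↦ φ ⊗ e_y`. -/
def slice (X : Type*) {Y : Type*} (y : Y) : L2 (X × Y) →L[ℂ] L2 X :=
  LinearMap.mkContinuous
    { toFun := fun x => L2.mk (fun a => x (a, y)) (summable_slice x y)
      map_add' := fun _ _ => rfl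
      map_smul' := fun _ _ => rfl } 1 fun x => by
    rw [one_mul]
    refine (sq_le_sq₀ (norm_nonneg _) (norm_nonneg _)).1 ?_
    rw [norm_sq_eq, norm_sq_eq]
    exact tsum_comp_le_tsum_of_inj (summable_sq x) (fun _ => by positivity)
      (i := fun a : X => (a, y)) fun _ _ h => (Prod.ext_iff.1 h).1

@[simp] theorem slice_apply {X Y : Type*} (y : Y) (x : L2 (X × Y)) (a : X) :
    slice X y x a = x (a, y) := rfl

theorem hasSum_norm_slice {X Y : Type*} (x : L2 (X × Y)) :
    HasSum (fun y => ‖slice X y x‖ ^ 2) (‖x‖ ^ 2) := by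
  have hs : Summable fun p : Y × X => ‖x p.swap‖ ^ 2 :=
    ((Equiv.prodComm Y X).summable_iff (f := fun i => ‖x i‖ ^ 2)).2 (summable_sq x)
  have h1 := hs.hasSum.prod_fiberwise (fun y => (hs.prod_factor y).hasSum)
  have h2 : ∑' p : Y × X, ‖x p.swap‖ ^ 2 = ‖x‖ ^ 2 := by
    rw [norm_sq_eq]; exact (Equiv.prodComm Y X).tsum_eq (fun i => ‖x i‖ ^ 2)
  rw [h2] at h1
  have h3 : (fun y => ‖slice X y x‖ ^ 2) = fun y => ∑' a, ‖x (a, y)‖ ^ 2 := by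
    funext y; rw [norm_sq_eq]; rfl
  rw [h3]
  exact h1

theorem hasSum_tensorOne {X Y : Type*} (A : Op X) (x : L2 (X × Y)) :
    Summable (fun p : X × Y => ‖A (slice X p.2 x) p.1‖ ^ 2) ∧
      ∑' p : X × Y, ‖A (slice X p.2 x) p.1‖ ^ 2 ≤ ‖A‖ ^ 2 * ‖x‖ ^ 2 := by
  have hle : ∀ y, ‖A (slice X y x)‖ ^ 2 ≤ ‖A‖ ^ 2 * ‖slice X y x‖ ^ 2 := fun y => by
    rw [← mul_pow]
    exact pow_le_pow_left₀ (norm_nonneg _) (A.le_opNorm _) 2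
  have hs : HasSum (fun y => ‖A‖ ^ 2 * ‖slice X y x‖ ^ 2) (‖A‖ ^ 2 * ‖x‖ ^ 2) :=
    (hasSum_norm_slice x).mul_left (‖A‖ ^ 2)
  have hs' : Summable fun y => ‖A (slice X y x)‖ ^ 2 :=
    Summable.of_nonneg_of_le (fun _ => by positivity) hle hs.summable
  have h1 : (fun y => ∑' a, ‖A (slice X y x) a‖ ^ 2) = fun y => ‖A (slice X y x)‖ ^ 2 :=
    funext fun y => (norm_sq_eq _).symm
  have hsw : Summable fun p : Y × X => ‖A (slice X p.1 x) p.2‖ ^ 2 := by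
    rw [summable_prod_of_nonneg (fun _ => by positivity)]
    refine ⟨fun y => summable_sq (A (slice X y x)), ?_⟩
    rw [← h1] at hs'
    exact hs'
  refine ⟨((Equiv.prodComm Y X).summable_iff
    (f := fun p : X × Y => ‖A (slice X p.2 x) p.1‖ ^ 2)).1 hsw, ?_⟩
  calc ∑' p : X × Y, ‖A (slice X p.2 x) p.1‖ ^ 2
      = ∑' p : Y × X, ‖A (slice X p.1 x) p.2‖ ^ 2 := by
        exact ((Equiv.prodComm Y X).tsum_eq
          (fun p : X × Y => ‖A (slice X p.2 x) p.1‖ ^ 2)).symm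
    _ = ∑' y, ‖A (slice X y x)‖ ^ 2 := by
        exact hsw.tsum_prod.trans (congrArg tsum h1)
    _ ≤ _ := hasSum_le hle hs'.hasSum hs

/-- The operator `A ⊗ 1` on `ℓ²(X) ⊗ ℓ²(Y) = ℓ²(X × Y)`: `A` acts on every slice. -/
def tensorOne {X : Type*} (Y : Type*) (A : Op X) : Op (X × Y) :=
  LinearMap.mkContinuous
    { toFun := fun x => L2.mk (fun p => A (slice X p.2 x) p.1) (hasSum_tensorOne A x).1
      map_add' := fun x y => by ext p; simp
      map_smul' := fun c x => by ext p; simp } ‖A‖ fun x => by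
    refine (sq_le_sq₀ (norm_nonneg _) (by positivity)).1 ?_
    rw [norm_sq_eq, mul_pow]
    exact (hasSum_tensorOne A x).2

@[simp] theorem tensorOne_apply {X Y : Type*} (A : Op X) (x : L2 (X × Y)) (p : X × Y) :
    tensorOne Y A x p = A (slice X p.2 x) p.1 := rfl

/-- The tensor product `A ⊗ B` of two operators. -/
def tensorOp {X Y : Type*} (A : Op X) (B : Op Y) : Op (X × Y) :=
  tensorOne Y A * transport (Equiv.prodComm X Y) (tensorOne X B)

/-- The tensor power `ρ ⊗ ⋯ ⊗ ρ` (`k` factors) of an operator on `H`. -/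
def tensorPow {H : Type*} [NormedAddCommGroup H] [InnerProductSpace ℂ H] {ι : Type*}
    (b : HilbertBasis ι ℂ H) (ρ : H →L[ℂ] H) : (k : ℕ) → NOp ι k
  | 0 => 1
  | k + 1 => transport (Fin.consEquiv fun _ => ι).symm
      (tensorOp ((coords b : H →L[ℂ] L2 ι) ∘L ρ ∘L ((coords b).symm : L2 ι →L[ℂ] H))
        (tensorPow b ρ k))

/-- The partial trace over the second factor of `ℓ²(X) ⊗ ℓ²(Y)`,
`Tr_Y A = ∑ y, (1 ⊗ ⟨e_y|) A (1 ⊗ |e_y⟩)`. For trace class `A` the series converges absolutely in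
operator norm. -/
def partialTrace {X Y : Type*} (A : Op (X × Y)) : Op X :=
  ∑' y, slice X y ∘L A ∘L (slice X y).adjoint

/-- The `k`-particle reduced operator of an operator on `k + m` particles: the partial trace over
the last `m` factors. -/
def marginal {ι : Type*} (k m : ℕ) (A : NOp ι (k + m)) : NOp ι k :=
  partialTrace (transport (Fin.appendEquiv k m) A)

/-! ### Density matrices -/

/-- Density matrices: positive operators with trace `1`; the trace of a positive operator does not
depend on the orthonormal basis `b` used to compute it. -/
def IsDensityMatrix {K : Type*} [NormedAddCommGroup K] [InnerProductSpace ℂ K] [CompleteSpace K]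
    {X : Type*} (b : HilbertBasis X ℂ K) (A : K →L[ℂ] K) : Prop :=
  A.IsPositive ∧ HasSum (fun i => ⟪b i, A (b i)⟫_ℂ) 1

/-- The trace norm `‖A‖₁ = Tr |A|`, where `|A| = (A* A)^(1/2)`, computed in an orthonormal basis
(the value does not depend on it); it is infinite if `A` is not of trace class. -/
def traceNorm {K : Type*} [NormedAddCommGroup K] [InnerProductSpace ℂ K] [CompleteSpace K]
    {X : Type*} (b : HilbertBasis X ℂ K) (A : K →L[ℂ] K) : ENNReal :=
  ∑' i, ENNReal.ofReal (RCLike.re ⟪b i, CFC.abs A (b i)⟫_ℂ)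

/-- The unitary action of a permutation on `N`-particle space,
`φ₁ ⊗ ⋯ ⊗ φ_N ↦ φ_{π 1} ⊗ ⋯ ⊗ φ_{π N}`. -/
def permOp (ι : Type*) {N : ℕ} (π : Equiv.Perm (Fin N)) : NOp ι N :=
  (reindex (Equiv.arrowCongr π (Equiv.refl ι)) : L2 (Fin N → ι) →L[ℂ] L2 (Fin N → ι))

/-- Symmetric density matrices on `N`-particle space. -/
def IsSymmDensityMatrix {ι : Type*} {N : ℕ} (A : NOp ι N) : Prop :=
  IsDensityMatrix (stdBasis _) A ∧ ∀ π : Equiv.Perm (Fin N), permOp ι π * A * star (permOp ι π) = A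

/-- A sequence `ϱ N`, `N ≥ 2`, of symmetric density matrices on the `N`-particle spaces is
`ρ`-chaotic if `ρ` is a density matrix and, for every `k ≥ 1`, the `k`-particle reduced density
matrices of `ϱ N` converge to `ρ ⊗ ⋯ ⊗ ρ` in trace norm as `N = k + m → ∞`. -/
structure IsChaotic {H : Type*} [NormedAddCommGroup H] [InnerProductSpace ℂ H] [CompleteSpace H]
    {ι : Type*} (b : HilbertBasis ι ℂ H) (ρ : H →L[ℂ] H) (ϱ : (N : ℕ) → NOp ι N) : Prop where
  density : IsDensityMatrix b ρ
  symm_density : ∀ N, 2 ≤ N → IsSymmDensityMatrix (ϱ N)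
  tendsto : ∀ k, 1 ≤ k →
    Tendsto (fun m => traceNorm (stdBasis _) (marginal k m (ϱ (k + m)) - tensorPow b ρ k))
      atTop (𝓝 0)

/-! ### Hamiltonians -/

section Hamiltonian

variable {H : Type*} [NormedAddCommGroup H] [InnerProductSpace ℂ H] {ι : Type*}

/-- The operator `h` has a compact resolvent: for some `z`, the operator `h - z` has a bounded
everywhere defined inverse, which is compact. -/
def HasCompactResolvent (h : H →ₗ.[ℂ] H) : Prop :=
  ∃ (z : ℂ) (R : H →L[ℂ] H), IsCompactOperator R ∧
    (∀ x : h.domain, R (h x - z • (x : H)) = x) ∧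
    ∀ y : H, ∃ x : h.domain, (x : H) = R y ∧ h x - z • (x : H) = y

/-- The graph of the `N`-particle Hamiltonian `H_N = ∑ j, h_j`, where `h_j` is `h` acting on the
`j`-th factor: the closure of its graph on the span of elementary tensors. -/
def hamGraph (b : HilbertBasis ι ℂ H) (h : H →ₗ.[ℂ] H) (N : ℕ) :
    Submodule ℂ (L2 (Fin N → ι) × L2 (Fin N → ι)) :=
  (Submodule.span ℂ (Set.range fun φ : Fin N → h.domain =>
    (tprod b fun i => (φ i : H),
      ∑ j, tprod b (Function.update (fun i => (φ i : H)) j (h (φ j)))))).topologicalClosure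

/-- The energy algebra of the `N`-particle Hamiltonian: the bounded operators `∑ E, f E • P_E`,
where `P_E` is the projection onto the eigenspace of `H_N` with eigenvalue `E`. -/
def energyAlgebra (b : HilbertBasis ι ℂ H) (h : H →ₗ.[ℂ] H) (N : ℕ) : Set (NOp ι N) :=
  {A | ∃ f : ℝ → ℂ, ∀ (E : ℝ) (x : L2 (Fin N → ι)),
    (x, (E : ℂ) • x) ∈ hamGraph b h N → A x = f E • x}

end Hamiltonian

/-! ### Collision specifications -/

/-- A collision specification `(C, U, ν)` for the one-particle Hamiltonian `h`. -/
structure CollisionSpec {H : Type*} [NormedAddCommGroup H] [InnerProductSpace ℂ H] {ι : Type*}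
    (b : HilbertBasis ι ℂ H) (h : H →ₗ.[ℂ] H)
    (C : Type*) [MetricSpace C] [CompactSpace C] [MeasurableSpace C] [BorelSpace C] where
  /-- the unitary operators on two-particle space that describe the collisions -/
  U : C → unitary (NOp ι 2)
  continuous_U : Continuous U
  injective_U : Function.Injective U
  /-- the distribution of the collision parameter -/
  ν : Measure C
  isProbabilityMeasure : IsProbabilityMeasure ν
  isOpenPosMeasure : ν.IsOpenPosMeasure
  /-- `U σ` commutes with the two-particle Hamiltonian: `U σ H₂ (U σ)* = H₂` -/
  energy_conserved : ∀ (σ : C) (x y : L2 (Fin 2 → ι)),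
    (x, y) ∈ hamGraph b h 2 ↔ ((U σ : NOp ι 2) x, (U σ : NOp ι 2) y) ∈ hamGraph b h 2
  exists_eq_one : ∃ σ₀, U σ₀ = 1
  time_reversal : ∃ T : C → C, MeasurePreserving T ν ν ∧ ∀ σ, star (U σ) = U (T σ)
  swap_invariant : ∃ T : C → C, MeasurePreserving T ν ν ∧ ∀ σ,
    permOp ι (Equiv.swap (0 : Fin 2) 1) * (U σ : NOp ι 2) * star (permOp ι (Equiv.swap (0 : Fin 2) 1))
      = (U (T σ) : NOp ι 2)

/-- The splitting of an `N`-tuple into its entries `i`, `j` and the remaining entries. -/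
def pairSplit (ι : Type*) {N : ℕ} {i j : Fin N} (hij : i ≠ j) :
    (Fin N → ι) ≃ (Fin 2 → ι) × ({l : Fin N // l ≠ i ∧ l ≠ j} → ι) where
  toFun α := (![α i, α j], fun l => α l)
  invFun p l := if hi : l = i then p.1 0 else if hj : l = j then p.1 1 else p.2 ⟨l, hi, hj⟩
  left_inv α := by
    funext l
    by_cases hi : l = i
    · simp [hi]
    · by_cases hj : l = j
      · subst hj; simp [hi]
      · simp [hi, hj]
  right_inv p := by
    refine Prod.ext ?_ ?_
    · funext l
      fin_cases l <;> simp [hij.symm]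
    · funext l
      simp [l.2.1, l.2.2]

/-- The action of a two-particle operator on the factors `i` and `j` of `N`-particle space. -/
def pairOp {ι : Type*} {N : ℕ} {i j : Fin N} (hij : i ≠ j) (A : NOp ι 2) : NOp ι N :=
  transport (pairSplit ι hij) (tensorOne _ A)

theorem tensorOne_sub {X Y : Type*} (A B : Op X) :
    tensorOne Y (A - B) = tensorOne Y A - tensorOne Y B := by
  rw [eq_sub_iff_add_eq]
  ext x p
  simp [tensorOne, ← add_apply]

theorem norm_tensorOne_le {X Y : Type*} (A : Op X) : ‖tensorOne Y A‖ ≤ ‖A‖ :=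
  LinearMap.mkContinuous_norm_le _ (norm_nonneg _) _

theorem norm_transport_le {X Y : Type*} (e : X ≃ Y) (A : Op Y) : ‖transport e A‖ ≤ ‖A‖ := by
  refine ContinuousLinearMap.opNorm_le_bound _ (norm_nonneg _) fun x => ?_
  simp only [transport, ContinuousLinearMap.comp_apply]
  calc _ = ‖A ((reindex e).symm x)‖ := (reindex e).norm_map _
    _ ≤ ‖A‖ * ‖(reindex e).symm x‖ := A.le_opNorm _
    _ = _ := by rw [(reindex e).symm.norm_map]

theorem continuous_pairOp {ι : Type*} {N : ℕ} {i j : Fin N} (hij : i ≠ j) :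
    Continuous fun A : NOp ι 2 => (pairOp hij A : NOp ι N) := by
  refine (LipschitzWith.of_dist_le_mul (K := 1) fun A B => ?_).continuous
  rw [dist_eq_norm, dist_eq_norm, NNReal.coe_one, one_mul]
  have : (pairOp hij A - pairOp hij B : NOp ι N) = pairOp hij (A - B) := by
    simp [pairOp, tensorOne_sub, transport, ContinuousLinearMap.comp_sub,
      ContinuousLinearMap.sub_comp]
  rw [this]
  exact (norm_transport_le _ _).trans (norm_tensorOne_le _)

namespace CollisionSpec

variable {H : Type*} [NormedAddCommGroup H] [InnerProductSpace ℂ H] {ι : Type*}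
  {b : HilbertBasis ι ℂ H} {h : H →ₗ.[ℂ] H}
  {C : Type*} [MetricSpace C] [CompactSpace C] [MeasurableSpace C] [BorelSpace C]

/-- Ergodicity: the commutant of the collision operators is the two-particle energy algebra. -/
def IsErgodic (S : CollisionSpec b h C) : Prop :=
  Set.centralizer (Set.range fun σ => (S.U σ : NOp ι 2)) = energyAlgebra b h 2

/-- The operator `U_{i,j}(σ)` on `N`-particle space. -/
def UPair (S : CollisionSpec b h C) {N : ℕ} {i j : Fin N} (hij : i ≠ j) (σ : C) : NOp ι N :=
  pairOp hij (S.U σ)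

/-- The averaged binary collision `Q_{i,j} = ∫ U_{i,j}(σ) (·) U_{i,j}(σ)* dν(σ)`, as a bounded
operator on the bounded operators on `N`-particle space (see `QPair_apply`). -/
def QPair (S : CollisionSpec b h C) {N : ℕ} {i j : Fin N} (hij : i ≠ j) : NOp ι N →L[ℂ] NOp ι N :=
  ∫ σ, ContinuousLinearMap.mulLeftRight ℂ (NOp ι N) (S.UPair hij σ) (star (S.UPair hij σ)) ∂S.ν

theorem QPair_apply (S : CollisionSpec b h C) {N : ℕ} {i j : Fin N} (hij : i ≠ j) (A : NOp ι N) :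
    Integrable (fun σ => S.UPair hij σ * A * star (S.UPair hij σ)) S.ν ∧
    S.QPair hij A = ∫ σ, S.UPair hij σ * A * star (S.UPair hij σ) ∂S.ν := by
  have := S.isProbabilityMeasure
  have hU : Continuous (S.UPair hij) :=
    (continuous_pairOp hij).comp (continuous_subtype_val.comp S.continuous_U)
  have hc : Continuous fun σ => ContinuousLinearMap.mulLeftRight ℂ (NOp ι N)
      (S.UPair hij σ) (star (S.UPair hij σ)) :=
    (((ContinuousLinearMap.mulLeftRight ℂ (NOp ι N)).continuous.comp hU).clm_apply
      (continuous_star.comp hU))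
  have hi : Integrable (fun σ => ContinuousLinearMap.mulLeftRight ℂ (NOp ι N)
      (S.UPair hij σ) (star (S.UPair hij σ))) S.ν :=
    hc.integrable_of_hasCompactSupport (HasCompactSupport.of_compactSpace _)
  refine ⟨hi.apply_continuousLinearMap A, ?_⟩
  rw [QPair, ContinuousLinearMap.integral_apply hi]
  rfl

/-- `Q_N = (N choose 2)⁻¹ ∑_{i < j} Q_{i,j}`. -/
def QN (S : CollisionSpec b h C) (N : ℕ) : NOp ι N →L[ℂ] NOp ι N :=
  ((N.choose 2 : ℂ))⁻¹ • ∑ p : {p : Fin N × Fin N // p.1 < p.2}, S.QPair p.2.ne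

/-- The quantum Kac generator `L_N = N (Q_N - 1)`. -/
def generator (S : CollisionSpec b h C) (N : ℕ) : NOp ι N →L[ℂ] NOp ι N :=
  (N : ℂ) • (S.QN N - 1)

/-- The quantum Kac semigroup `P_{N,t} = exp (t L_N)`. -/
def semigroup (S : CollisionSpec b h C) (N : ℕ) (t : ℝ) : NOp ι N →L[ℂ] NOp ι N :=
  NormedSpace.exp ((t : ℂ) • S.generator N)

end CollisionSpec

end QKac

end

open QKac

set_option maxSynthPendingDepth 3

noncomputable section

namespace QKac

open L2
open InnerProductSpace (rankOne)

/-! The argument is McKean's combinatorial proof of propagation of chaos, carried out in the dual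
picture. A density matrix `ϱ` is replaced by the normal functional `B ↦ Tr (B ϱ)`. Taking marginals
becomes restriction to observables of the form `A ⊗ 1`, and trace norm convergence of self-adjoint
densities becomes norm convergence of functionals (`traceNorm_dens_le`,
`exists_normal_of_traceNorm_ne_top`). Time reversal invariance makes the dynamics self-dual
(`dens_comp_semigroup`).

Since `N / (N choose 2) = 2 / (N - 1)`, the generator is `(N - 1)⁻¹ ∑ (Q_{i,j} - 1)` over ordered
pairs. On an observable of `k` particles, pairs outside these particles contribute nothing, pairs
inside have total weight of order `1/N`, and each mixed pair creates an observable of `k + 1`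
particles. For symmetric states this is a BBGKY hierarchy (`reduced_comp_generator`) whose limit
keeps only the mixed collisions, with coefficient `2`. The `j`-th power of the generator costs at
most `8 ^ j k (k + 1) ⋯ (k + j - 1)`, uniformly in `N`, so for `16 t < 1` the exponential series is
dominated by a geometric one and the marginals converge term by term
(`tendsto_reduced_comp_semigroup`).

Chaos survives because the creation operator `outerGen` of the limiting hierarchy obeys a Leibniz
rule (`outerGen_mul`). Its iterates therefore act on products by binomial convolution, and the
exponential series of a product is the Cauchy product of the series of its factors
(`isProductFamily_limitFun`). The length of the time interval does not depend on the initial data,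
so finitely many short steps reach any `t`. -/

/-! ### Normal functionals on the bounded operators of a Hilbert space -/

section Normal

variable {E E' : Type*} [NormedAddCommGroup E] [InnerProductSpace ℂ E]
  [NormedAddCommGroup E'] [InnerProductSpace ℂ E']

/-- The bounded functionals on the bounded operators. -/
abbrev OpDual (E : Type*) [NormedAddCommGroup E] [InnerProductSpace ℂ E] : Type _ :=
  (E →L[ℂ] E) →L[ℂ] ℂ

/-- The vector functional `B ↦ ⟪x, B y⟫`. -/
def vecFun (x y : E) : OpDual E := (innerSL ℂ x) ∘L (ContinuousLinearMap.apply ℂ E y)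

@[simp] theorem vecFun_apply (x y : E) (B : E →L[ℂ] E) : vecFun x y B = ⟪x, B y⟫_ℂ := rfl

theorem norm_vecFun_le (x y : E) : ‖vecFun x y‖ ≤ ‖x‖ * ‖y‖ := by
  refine ContinuousLinearMap.opNorm_le_bound _ (by positivity) fun B => ?_
  calc ‖⟪x, B y⟫_ℂ‖ ≤ ‖x‖ * (‖B‖ * ‖y‖) :=
        (norm_inner_le_norm _ _).trans (by gcongr; exact B.le_opNorm y)
    _ = _ := by ring

/-- The normal functionals: the norm-closed span of the vector functionals. -/
def normal (E : Type*) [NormedAddCommGroup E] [InnerProductSpace ℂ E] : Submodule ℂ (OpDual E) :=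
  (Submodule.span ℂ (Set.range fun p : E × E => vecFun p.1 p.2)).topologicalClosure

theorem isClosed_normal : IsClosed (normal E : Set (OpDual E)) :=
  Submodule.isClosed_topologicalClosure _

theorem vecFun_mem_normal (x y : E) : vecFun x y ∈ normal E :=
  Submodule.le_topologicalClosure _ (Submodule.subset_span ⟨(x, y), rfl⟩)

theorem normal_le {M : Submodule ℂ (OpDual E)} (hM : IsClosed (M : Set (OpDual E)))
    (h : ∀ x y, vecFun x y ∈ M) : normal E ≤ M :=
  Submodule.topologicalClosure_minimal _
    (Submodule.span_le.2 (by rintro _ ⟨p, rfl⟩; exact h _ _)) hM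

/-- Precomposition with `T` is norm continuous and `normal E` is a closed subspace, so testing on
the generating vector functionals suffices. -/
theorem comp_mem_normal {T : (E →L[ℂ] E) →L[ℂ] (E' →L[ℂ] E')}
    (hT : ∀ x y, vecFun x y ∘L T ∈ normal E) {ω : OpDual E'} (hω : ω ∈ normal E') :
    ω ∘L T ∈ normal E := by
  let P : OpDual E' →L[ℂ] OpDual E := (ContinuousLinearMap.compL ℂ _ _ _).flip T
  have hcl : IsClosed (((normal E).comap P.toLinearMap : Submodule ℂ _) : Set (OpDual E')) :=
    isClosed_normal.preimage P.continuous
  exact normal_le hcl hT hω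

theorem hasSum_mem_normal {X : Type*} {f : X → OpDual E} {ω : OpDual E} (h : HasSum f ω)
    (hf : ∀ i, f i ∈ normal E) : ω ∈ normal E :=
  isClosed_normal.mem_of_tendsto h (Eventually.of_forall fun _ => (normal E).sum_mem fun i _ => hf i)

/-- Uniformly bounded maps converge on the normal functionals if they do so on the vector
functionals. -/
theorem tendsto_of_mem_normal {α F : Type*} [NormedAddCommGroup F] [NormedSpace ℂ F]
    {l : Filter α} (T : α → OpDual E →L[ℂ] F) (S : OpDual E →L[ℂ] F) (c : ℝ)
    (hc : ∀ a, ‖T a‖ ≤ c)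
    (h : ∀ x y, Tendsto (fun a => T a (vecFun x y)) l (𝓝 (S (vecFun x y))))
    {ω : OpDual E} (hω : ω ∈ normal E) : Tendsto (fun a => T a ω) l (𝓝 (S ω)) := by
  let M : Submodule ℂ (OpDual E) :=
    { carrier := {ω | Tendsto (fun a => T a ω) l (𝓝 (S ω))}
      add_mem' := fun {a b} ha hb => by
        simp only [Set.mem_ofPred_eq, map_add] at *
        exact ha.add hb
      zero_mem' := by simp [tendsto_const_nhds]
      smul_mem' := fun z a ha => by
        simp only [Set.mem_ofPred_eq, map_smul] at *
        exact ha.const_smul z }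
  have hcl : IsClosed (M : Set (OpDual E)) := by
    rw [← closure_subset_iff_isClosed]
    intro ω hω
    change Tendsto (fun a => T a ω) l (𝓝 (S ω))
    rw [Metric.tendsto_nhds]
    intro ε hε
    -- `d` dominates the sum of the bounds for `T a` and `S`, so both errors made by replacing `ω`
    -- with `η` together stay below `ε / 2`; the `1` keeps `d` positive.
    set d : ℝ := |c| + ‖S‖ + 1 with hd
    have hd0 : 0 < d := by positivity
    obtain ⟨η, hη, hdist⟩ := Metric.mem_closure_iff.1 hω (ε / (2 * d)) (by positivity)
    have h1 : Tendsto (fun a => T a η) l (𝓝 (S η)) := hη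
    filter_upwards [Metric.tendsto_nhds.1 h1 (ε / 2) (by positivity)] with a ha
    have hn : ‖ω - η‖ < ε / (2 * d) := by rwa [← dist_eq_norm]
    have e1 : ‖T a (ω - η)‖ ≤ |c| * ‖ω - η‖ :=
      ((T a).le_opNorm _).trans (by gcongr; exact (hc a).trans (le_abs_self c))
    have e2 : ‖S (ω - η)‖ ≤ ‖S‖ * ‖ω - η‖ := S.le_opNorm _
    have e3 : T a ω - S ω = T a (ω - η) - S (ω - η) + (T a η - S η) := by
      simp only [map_sub]; abel
    rw [dist_eq_norm] at ha ⊢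
    have e4 : ‖T a ω - S ω‖ ≤ ‖T a (ω - η)‖ + ‖S (ω - η)‖ + ‖T a η - S η‖ := by
      rw [e3]
      exact (norm_add_le _ _).trans (by gcongr; exact norm_sub_le _ _)
    have e5 : d * ‖ω - η‖ < ε / 2 := by
      calc d * ‖ω - η‖ < d * (ε / (2 * d)) := by gcongr
        _ = ε / 2 := by field_simp
    have e6 : |c| * ‖ω - η‖ + ‖S‖ * ‖ω - η‖ ≤ d * ‖ω - η‖ := by
      rw [hd]; nlinarith [norm_nonneg (ω - η)]
    linarith
  exact normal_le hcl h hω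

end Normal

/-! ### Density operators of functionals. -/

section Density


variable {E : Type*} [NormedAddCommGroup E] [InnerProductSpace ℂ E] [CompleteSpace E]

/-- The operator underlying `dens`. -/
def densAux (ω : OpDual E) : E →L[ℂ] E :=
  (InnerProductSpace.continuousLinearMapOfBilin (𝕜 := ℂ)
    ((ContinuousLinearMap.compL ℂ E (E →L[ℂ] E) ℂ ω).comp (rankOne ℂ : E →L[ℂ] E →L⋆[ℂ] E →L[ℂ] E).flip)).adjoint

theorem inner_densAux (ω : OpDual E) (x y : E) :
    ⟪x, densAux ω y⟫_ℂ = ω (rankOne ℂ y x) := by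
  rw [densAux, ContinuousLinearMap.adjoint_inner_right,
    InnerProductSpace.continuousLinearMapOfBilin_apply]
  rfl

omit [CompleteSpace E] in
theorem op_ext {A B : E →L[ℂ] E} (h : ∀ x y, ⟪x, A y⟫_ℂ = ⟪x, B y⟫_ℂ) : A = B :=
  ContinuousLinearMap.ext fun y => ext_inner_left ℂ fun x => h x y

/-- The density operator of a functional, determined by `⟪x, dens ω y⟫ = ω (|y⟩⟨x|)`. -/
def dens : OpDual E →L[ℂ] (E →L[ℂ] E) :=
  LinearMap.mkContinuous
    { toFun := densAux
      map_add' := fun ω η => op_ext fun x y => by simp [inner_densAux]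
      map_smul' := fun c ω => op_ext fun x y => by simp [inner_densAux] } 1
    fun ω => by
      rw [one_mul]
      refine ContinuousLinearMap.opNorm_le_bound _ (norm_nonneg _) fun y => ?_
      -- Testing against the vector `densAux ω y` itself and then dividing by its norm gives the
      -- bound `1`.
      have h := inner_densAux ω (densAux ω y) y
      have h1 : ‖densAux ω y‖ * ‖densAux ω y‖ ≤ ‖ω‖ * (‖y‖ * ‖densAux ω y‖) := by
        have h2 := ω.le_opNorm (rankOne ℂ y (densAux ω y))
        rwa [← h, InnerProductSpace.norm_rankOne, inner_self_eq_norm_sq_to_K, ← RCLike.ofReal_pow,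
          RCLike.norm_ofReal, abs_of_nonneg (by positivity), sq] at h2
      change ‖densAux ω y‖ ≤ _
      rcases eq_or_ne (‖densAux ω y‖) 0 with h0 | h0
      · rw [h0]; positivity
      · have : 0 < ‖densAux ω y‖ := lt_of_le_of_ne (norm_nonneg _) h0.symm
        nlinarith

@[simp] theorem inner_dens (ω : OpDual E) (x y : E) :
    ⟪x, dens ω y⟫_ℂ = ω (rankOne ℂ y x) := inner_densAux ω x y

theorem dens_vecFun (x y : E) : dens (vecFun x y) = rankOne ℂ y x :=
  op_ext fun u v => by simp [mul_comm]

end Density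

/-! ### Normal functionals, traces and the trace norm. -/

section Trace


variable {E : Type*} [NormedAddCommGroup E] [InnerProductSpace ℂ E]

theorem opNorm_le_of_inner {F : Type*} [NormedAddCommGroup F] [InnerProductSpace ℂ F]
    {A : F →L[ℂ] E} {c : ℝ} (hc : 0 ≤ c)
    (h : ∀ x y, ‖⟪x, A y⟫_ℂ‖ ≤ c * (‖x‖ * ‖y‖)) : ‖A‖ ≤ c := by
  refine ContinuousLinearMap.opNorm_le_bound _ hc fun y => ?_
  have h2 := h (A y) y
  rw [inner_self_eq_norm_sq_to_K, ← RCLike.ofReal_pow, RCLike.norm_ofReal,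
    abs_of_nonneg (by positivity), sq] at h2
  rcases eq_or_ne (‖A y‖) 0 with h0 | h0
  · rw [h0]; positivity
  · have : 0 < ‖A y‖ := lt_of_le_of_ne (norm_nonneg _) h0.symm
    nlinarith

theorem sum_mul_le_of_sum_sq_le {X : Type*} {s : Finset X} {f g : X → ℝ} {a c : ℝ} (ha : 0 ≤ a)
    (hc : 0 ≤ c) (hf : ∑ i ∈ s, f i ^ 2 ≤ a ^ 2) (hg : ∑ i ∈ s, g i ^ 2 ≤ c ^ 2) :
    ∑ i ∈ s, f i * g i ≤ a * c := by
  refine (Real.sum_mul_le_sqrt_mul_sqrt s f g).trans ?_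
  gcongr
  · exact Real.sqrt_le_iff.2 ⟨ha, hf⟩
  · exact Real.sqrt_le_iff.2 ⟨hc, hg⟩

variable {X : Type*} (b : HilbertBasis X ℂ E)

/-- The projection onto the span of finitely many basis vectors. -/
def basisProj (s : Finset X) : E →L[ℂ] E := ∑ i ∈ s, rankOne ℂ (b i) (b i)

theorem inner_basisProj (s : Finset X) (x y : E) :
    ⟪x, basisProj b s y⟫_ℂ = ∑ i ∈ s, ⟪x, b i⟫_ℂ * ⟪b i, y⟫_ℂ := by
  simp [basisProj, mul_comm]

theorem norm_basisProj_le (s : Finset X) : ‖basisProj b s‖ ≤ 1 := by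
  refine opNorm_le_of_inner zero_le_one fun x y => ?_
  rw [inner_basisProj, one_mul]
  refine (norm_sum_le _ _).trans ?_
  simp_rw [norm_mul]
  refine sum_mul_le_of_sum_sq_le (norm_nonneg _) (norm_nonneg _) ?_ ?_
  · simp_rw [norm_inner_symm x]
    exact b.orthonormal.sum_inner_products_le x
  · exact b.orthonormal.sum_inner_products_le y

variable [CompleteSpace E]

/-- Because `|b i⟩⟨b i| B = |b i⟩⟨B* b i|`, the defining property of `dens` yields the truncated
trace formula. -/
theorem apply_basisProj_mul (ω : OpDual E) (B : E →L[ℂ] E) (s : Finset X) :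
    ω (basisProj b s * B) = ∑ i ∈ s, ⟪b i, B (dens ω (b i))⟫_ℂ := by
  rw [basisProj, Finset.sum_mul, map_sum]
  refine Finset.sum_congr rfl fun i _ => ?_
  rw [← ContinuousLinearMap.adjoint_inner_left, inner_dens]
  exact congrArg ω (InnerProductSpace.rankOne_comp _ _ _)

/-- A normal functional is `B ↦ Tr (B * dens ω)`. -/
theorem hasSum_inner_dens {ω : OpDual E} (hω : ω ∈ normal E) (B : E →L[ℂ] E) :
    HasSum (fun i => ⟪b i, B (dens ω (b i))⟫_ℂ) (ω B) := by
  -- The truncations `basisProj b s * B` tend to `B` only strongly. That suffices for vector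
  -- functionals, by Parseval, and the uniform bound `‖B‖` carries the limit to all normal
  -- functionals.
  have h := tendsto_of_mem_normal (l := atTop)
    (fun s : Finset X => ContinuousLinearMap.apply ℂ ℂ (basisProj b s * B))
    (ContinuousLinearMap.apply ℂ ℂ B) ‖B‖ (fun s => ?_) (fun x y => ?_) hω
  · rw [HasSum, SummationFilter.unconditional_filter]
    simpa only [ContinuousLinearMap.apply_apply, apply_basisProj_mul] using h
  · refine ContinuousLinearMap.opNorm_le_bound _ (norm_nonneg _) fun η => ?_
    rw [mul_comm]
    refine (η.le_opNorm _).trans ?_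
    gcongr
    refine (norm_mul_le _ _).trans ?_
    simpa using mul_le_mul_of_nonneg_right (norm_basisProj_le b s) (norm_nonneg B)
  · simp only [ContinuousLinearMap.apply_apply, vecFun_apply, mul_apply_eq_comp,
      inner_basisProj]
    have h2 := b.hasSum_inner_mul_inner x (B y)
    rwa [HasSum, SummationFilter.unconditional_filter] at h2

theorem hasSum_trace_dens {ω : OpDual E} (hω : ω ∈ normal E) :
    HasSum (fun i => ⟪b i, dens ω (b i)⟫_ℂ) (ω 1) := hasSum_inner_dens b hω 1

include b in
theorem normal_ext_of_basis {ω η : OpDual E} (hω : ω ∈ normal E) (hη : η ∈ normal E)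
    (h : dens ω = dens η) : ω = η := by
  ext B
  have h1 := hasSum_inner_dens b hω B
  rw [h] at h1
  exact h1.unique (hasSum_inner_dens b hη B)

/-- The trace formula recovers `ω` from its density. Normality is essential: `dens` only sees finite
rank operators, so a functional vanishing on the compact operators has density `0`. -/
theorem normal_ext {ω η : OpDual E} (hω : ω ∈ normal E) (hη : η ∈ normal E)
    (h : dens ω = dens η) : ω = η := by
  obtain ⟨w, b, -⟩ := exists_hilbertBasis ℂ E
  exact normal_ext_of_basis b hω hη h

/-- A positive trace class operator is the density of a normal functional. -/
theorem exists_normal_of_isPositive {ρ : E →L[ℂ] E} (hρ : ρ.IsPositive) {s : ℝ}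
    (hs : HasSum (fun i => RCLike.re ⟪b i, ρ (b i)⟫_ℂ) s) :
    ∃ ω ∈ normal E, dens ω = ρ ∧ ‖ω‖ ≤ s := by
  have hρ0 : 0 ≤ ρ := (ContinuousLinearMap.nonneg_iff_isPositive ρ).2 hρ
  -- With `S = √ρ` the functional is `∑ ⟪S (b i), · S (b i)⟫`. The norms of its terms are at most
  -- `‖S (b i)‖² = ⟪b i, ρ (b i)⟫`, which sum to the trace.
  set S : E →L[ℂ] E := CFC.sqrt ρ with hS
  have hSS : S * S = ρ := CFC.sqrt_mul_sqrt_self ρ hρ0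
  have hSa : ∀ x y, ⟪S x, y⟫_ℂ = ⟪x, S y⟫_ℂ := fun x y => by
    have h1 : IsSelfAdjoint S := (CFC.sqrt_nonneg ρ).isSelfAdjoint
    rw [← ContinuousLinearMap.adjoint_inner_right,
      (ContinuousLinearMap.isSelfAdjoint_iff'.1 h1)]
  have hSx : ∀ x y, ⟪S x, S y⟫_ℂ = ⟪x, ρ y⟫_ℂ := fun x y => by
    rw [hSa, ← mul_apply_eq_comp, hSS]
  have hn : ∀ i, ‖S (b i)‖ * ‖S (b i)‖ = RCLike.re ⟪b i, ρ (b i)⟫_ℂ := fun i => by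
    rw [← hSx, inner_self_eq_norm_mul_norm]
  have hb : ∀ i, ‖vecFun (S (b i)) (S (b i))‖ ≤ RCLike.re ⟪b i, ρ (b i)⟫_ℂ := fun i =>
    (norm_vecFun_le _ _).trans (hn i).le
  have hsum : Summable fun i => vecFun (S (b i)) (S (b i)) := hs.summable.of_norm_bounded hb
  refine ⟨_, hasSum_mem_normal hsum.hasSum fun i => vecFun_mem_normal _ _, ?_, ?_⟩
  · refine op_ext fun x y => ?_
    have h1 := hsum.hasSum.mapL (ContinuousLinearMap.apply ℂ ℂ (rankOne ℂ y x))
    rw [inner_dens, ← hSx]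
    refine h1.unique ?_
    refine (b.hasSum_inner_mul_inner (S x) (S y)).congr_fun fun i => ?_
    simp [hSa]
  · exact tsum_of_norm_bounded hs hb

omit [CompleteSpace E] in
theorem re_inner_mono {A B : E →L[ℂ] E} (h : A ≤ B) (x : E) :
    RCLike.re ⟪x, A x⟫_ℂ ≤ RCLike.re ⟪x, B x⟫_ℂ := by
  have h1 := ((ContinuousLinearMap.le_def A B).1 h).re_inner_nonneg_right x
  simpa [inner_sub_right] using h1

/-- Pairing `A = dens ω` with the sign of `A` would give `Tr |A| ≤ ‖ω‖`. The sign is not continuous,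
so `x / (|x| + ε)` replaces it; the loss is `ε` per basis vector, harmless on a finite set of them.
-/
theorem traceNorm_dens_le {ω : OpDual E} (hω : ω ∈ normal E) (hsa : IsSelfAdjoint (dens ω)) :
    traceNorm b (dens ω) ≤ ENNReal.ofReal ‖ω‖ := by
  set A := dens ω with hA
  rw [traceNorm, ENNReal.tsum_eq_iSup_sum]
  refine iSup_le fun s => ?_
  have hpos : ∀ i, 0 ≤ RCLike.re ⟪b i, CFC.abs A (b i)⟫_ℂ := fun i => by
    simpa using re_inner_mono (CFC.abs_nonneg A) (b i)
  rw [← ENNReal.ofReal_sum_of_nonneg fun i _ => hpos i]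
  refine ENNReal.ofReal_le_ofReal ?_
  have key : ∀ ε > 0, ∑ i ∈ s, RCLike.re ⟪b i, CFC.abs A (b i)⟫_ℂ ≤ ‖ω‖ + s.card * ε := by
    intro ε hε
    have hden : ∀ x : ℝ, 0 < |x| + ε := fun x => by positivity
    have hcf : Continuous fun x : ℝ => x / (|x| + ε) :=
      continuous_id.div (by fun_prop) fun x => (hden x).ne'
    set f : E →L[ℂ] E := cfc (fun x : ℝ => x / (|x| + ε)) A with hf
    have hfn : ‖f‖ ≤ 1 := by
      refine norm_cfc_le zero_le_one fun x _ => ?_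
      rw [norm_div, Real.norm_eq_abs, Real.norm_eq_abs, abs_of_pos (hden x)]
      exact (div_le_one (hden x)).2 (by linarith)
    have hfA : f * A = cfc (fun x : ℝ => x / (|x| + ε) * x) A := by
      rw [cfc_mul _ (fun x : ℝ => x) A hcf.continuousOn (by fun_prop), cfc_id' ℝ A]
    have hsq : ∀ x : ℝ, x / (|x| + ε) * x = |x| ^ 2 / (|x| + ε) := fun x => by
      rw [sq_abs]; ring
    have hle : CFC.abs A ≤ f * A + algebraMap ℝ _ ε := by
      have h1 : f * A + algebraMap ℝ _ ε = cfc (fun x : ℝ => x / (|x| + ε) * x + ε) A := by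
        rw [hfA, cfc_add_const _ _ _ (by fun_prop)]
      rw [h1, CFC.abs_eq_cfc_norm A hsa]
      refine cfc_mono (fun x _ => ?_) (by fun_prop) (by fun_prop)
      -- What remains is `(|x| - ε) (|x| + ε) = |x|² - ε² ≤ |x|²`.
      rw [hsq, Real.norm_eq_abs, ← sub_le_iff_le_add, le_div_iff₀ (hden x)]
      nlinarith [sq_nonneg ε]
    have hnn : 0 ≤ f * A := by
      rw [hfA]
      exact cfc_nonneg fun x _ => by rw [hsq]; positivity
    have hsum := (RCLike.hasSum_re ℂ (hasSum_inner_dens b hω f))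
    have h1 : ∑ i ∈ s, RCLike.re ⟪b i, (f * A) (b i)⟫_ℂ ≤ RCLike.re (ω f) :=
      sum_le_hasSum s (fun i _ => by simpa using re_inner_mono hnn (b i)) hsum
    have h2 : RCLike.re (ω f) ≤ ‖ω‖ := (RCLike.re_le_norm _).trans
      ((ω.le_opNorm f).trans (by nlinarith [norm_nonneg ω]))
    have h3 : ∀ i ∈ s, RCLike.re ⟪b i, CFC.abs A (b i)⟫_ℂ ≤
        RCLike.re ⟪b i, (f * A) (b i)⟫_ℂ + ε := fun i _ => by
      have h4 := re_inner_mono hle (b i)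
      have h5 : RCLike.re ⟪b i, (algebraMap ℝ (E →L[ℂ] E) ε) (b i)⟫_ℂ = ε := by
        rw [Algebra.algebraMap_eq_smul_one]
        simp [inner_smul_right_eq_smul, b.orthonormal.1 i]
      rw [_root_.add_apply, inner_add_right, map_add, h5] at h4
      exact h4
    have h4 := Finset.sum_le_sum h3
    rw [Finset.sum_add_distrib, Finset.sum_const, nsmul_eq_mul] at h4
    linarith
  refine le_of_forall_pos_le_add fun δ hδ => ?_
  have h1 := key (δ / (s.card + 1)) (by positivity)
  have h2 : s.card * (δ / (s.card + 1)) ≤ δ := by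
    rw [mul_div_assoc', div_le_iff₀ (by positivity)]
    nlinarith
  linarith

/-- The decomposition `A = A⁺ - A⁻` reduces to positive operators, and `|A| = A⁺ + A⁻` makes the two
norm bounds add up to exactly the trace norm. -/
theorem exists_normal_of_traceNorm_ne_top {A : E →L[ℂ] E} (hA : IsSelfAdjoint A)
    (h : traceNorm b A ≠ ⊤) :
    ∃ ω ∈ normal E, dens ω = A ∧ ‖ω‖ ≤ (traceNorm b A).toReal := by
  have hpos : ∀ i, 0 ≤ RCLike.re ⟪b i, CFC.abs A (b i)⟫_ℂ := fun i => by
    simpa using re_inner_mono (CFC.abs_nonneg A) (b i)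
  have habs : HasSum (fun i => RCLike.re ⟪b i, CFC.abs A (b i)⟫_ℂ) (traceNorm b A).toReal := by
    rw [traceNorm, ENNReal.tsum_toReal_eq fun _ => ENNReal.ofReal_ne_top]
    exact (ENNReal.summable_toReal h).hasSum.congr_fun fun i => (ENNReal.toReal_ofReal (hpos i)).symm
  have hp : ∀ i, RCLike.re ⟪b i, CFC.abs A (b i)⟫_ℂ =
      RCLike.re ⟪b i, A⁺ (b i)⟫_ℂ + RCLike.re ⟪b i, A⁻ (b i)⟫_ℂ := fun i => by
    rw [← CFC.posPart_add_negPart A hA]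
    simp
  have hP : ∀ i, 0 ≤ RCLike.re ⟪b i, A⁺ (b i)⟫_ℂ := fun i => by
    simpa using re_inner_mono (CFC.posPart_nonneg A) (b i)
  have hN : ∀ i, 0 ≤ RCLike.re ⟪b i, A⁻ (b i)⟫_ℂ := fun i => by
    simpa using re_inner_mono (CFC.negPart_nonneg A) (b i)
  have sP : Summable fun i => RCLike.re ⟪b i, A⁺ (b i)⟫_ℂ :=
    habs.summable.of_nonneg_of_le hP fun i => by linarith [hp i, hN i]
  have sN : Summable fun i => RCLike.re ⟪b i, A⁻ (b i)⟫_ℂ :=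
    habs.summable.of_nonneg_of_le hN fun i => by linarith [hp i, hP i]
  obtain ⟨ω, hω, dω, nω⟩ := exists_normal_of_isPositive b
    ((ContinuousLinearMap.nonneg_iff_isPositive _).1 (CFC.posPart_nonneg A)) sP.hasSum
  obtain ⟨η, hη, dη, nη⟩ := exists_normal_of_isPositive b
    ((ContinuousLinearMap.nonneg_iff_isPositive _).1 (CFC.negPart_nonneg A)) sN.hasSum
  refine ⟨ω - η, (normal E).sub_mem hω hη, ?_, ?_⟩
  · rw [map_sub, dω, dη, CFC.posPart_sub_negPart A hA]
  · have h2 : (traceNorm b A).toReal = _ := habs.unique ((sP.hasSum.add sN.hasSum).congr_fun hp)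
    rw [h2]
    exact (norm_sub_le _ _).trans (add_le_add nω nη)

end Trace

section BasisExt

variable {E : Type*} [NormedAddCommGroup E] [InnerProductSpace ℂ E] {X : Type*}
  (b : HilbertBasis X ℂ E)

include b in
theorem op_ext_basis {F : Type*} [NormedAddCommGroup F] [NormedSpace ℂ F]
    {A B : E →L[ℂ] F} (h : ∀ i, A (b i) = B (b i)) : A = B :=
  ContinuousLinearMap.ext_on
    (Submodule.dense_iff_topologicalClosure_eq_top.2 b.dense_span)
    (by rintro _ ⟨i, rfl⟩; exact h i)

include b in
theorem op_ext_inner_basis {A B : E →L[ℂ] E}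
    (h : ∀ i j, ⟪b i, A (b j)⟫_ℂ = ⟪b i, B (b j)⟫_ℂ) : A = B :=
  op_ext_basis b fun j => b.repr.injective <| Subtype.ext <| funext fun i => by
    simpa [b.repr_apply_apply] using h i j

end BasisExt

/-! ### Tensor factors, relabelling and partial traces on `ℓ²`. -/

section L2Lemmas

variable {X Y : Type*}

theorem stdBasis_apply [DecidableEq X] (i j : X) :
    stdBasis X i j = if j = i then 1 else 0 := by
  have : stdBasis X i = lp.single 2 i (1 : ℂ) := ((stdBasis X).repr_symm_single i).symm
  rw [this]
  change (lp.single (E := fun _ : X => ℂ) 2 i (1 : ℂ) : _) j = _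
  simp [Pi.single_apply]

theorem inner_stdBasis (i : X) (x : L2 X) : ⟪stdBasis X i, x⟫_ℂ = x i :=
  ((stdBasis X).repr_apply_apply x i).symm

theorem hasSum_inner_L2 (x z : L2 X) : HasSum (fun i => ⟪x i, z i⟫_ℂ) ⟪x, z⟫_ℂ :=
  lp.hasSum_inner (𝕜 := ℂ) (G := fun _ : X => ℂ) x z

theorem hasSum_inner_slice (x z : L2 (X × Y)) :
    HasSum (fun y => ⟪slice X y x, slice X y z⟫_ℂ) ⟪x, z⟫_ℂ := by
  have h1 : HasSum (fun p : Y × X => ⟪x p.swap, z p.swap⟫_ℂ) ⟪x, z⟫_ℂ :=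
    (Equiv.prodComm Y X).hasSum_iff (f := fun p => ⟪x p, z p⟫_ℂ) |>.2 (hasSum_inner_L2 x z)
  exact h1.prod_fiberwise fun y => hasSum_inner_L2 (slice X y x) (slice X y z)

theorem slice_tensorOne (A : Op X) (x : L2 (X × Y)) (y : Y) :
    slice X y (tensorOne Y A x) = A (slice X y x) := rfl

theorem sum_norm_slice_sq_le (s : Finset Y) (x : L2 (X × Y)) :
    ∑ y ∈ s, ‖slice X y x‖ ^ 2 ≤ ‖x‖ ^ 2 :=
  sum_le_hasSum s (fun _ _ => by positivity) (hasSum_norm_slice x)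

/-- The elementary tensor of two square-summable families. -/
def prodVec (u : L2 X) (w : L2 Y) : L2 (X × Y) :=
  L2.mk (fun p => u p.1 * w p.2) <| by
    refine ((summable_sq u).mul_of_nonneg (summable_sq w) (fun _ => by positivity)
      fun _ => by positivity).congr fun p => ?_
    simp [mul_pow]

@[simp] theorem prodVec_apply (u : L2 X) (w : L2 Y) (p : X × Y) :
    prodVec u w p = u p.1 * w p.2 := rfl

theorem stdBasis_prod (p : X × Y) :
    stdBasis (X × Y) p = prodVec (stdBasis X p.1) (stdBasis Y p.2) := by
  classical
  ext q
  simp only [stdBasis_apply, prodVec_apply, Prod.ext_iff]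
  split_ifs <;> simp_all

theorem tensorOne_prodVec (A : Op X) (u : L2 X) (w : L2 Y) :
    tensorOne Y A (prodVec u w) = prodVec (A u) w := by
  ext p
  have : slice X p.2 (prodVec u w) = w p.2 • u := by ext a; simp [mul_comm]
  simp [this, mul_comm]

/-- The operator `1 ⊗ B`. -/
def oneTensor (X : Type*) (B : Op Y) : Op (X × Y) :=
  transport (Equiv.prodComm X Y) (tensorOne X B)

theorem oneTensor_prodVec (B : Op Y) (u : L2 X) (w : L2 Y) :
    oneTensor X B (prodVec u w) = prodVec u (B w) := by
  have : (reindex (Equiv.prodComm X Y)).symm (prodVec u w) = prodVec w u := by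
    ext p; simp [mul_comm]
  ext p
  change tensorOne X B ((reindex (Equiv.prodComm X Y)).symm (prodVec u w)) p.swap = _
  rw [this, tensorOne_prodVec]
  simp [mul_comm]

theorem tensorOne_oneTensor_comm (A : Op X) (B : Op Y) (x : L2 (X × Y)) :
    tensorOne Y A (oneTensor X B x) = oneTensor X B (tensorOne Y A x) := by
  have : tensorOne Y A ∘L oneTensor X B = oneTensor X B ∘L tensorOne Y A :=
    op_ext_basis (stdBasis (X × Y)) fun p => by
      simp [stdBasis_prod, tensorOne_prodVec, oneTensor_prodVec]
  exact congrArg (· x) this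

/-- Two operators that act on different variables commute. -/
theorem apply_apply_comm (A : Op X) (B : Op Y) (z : L2 (X × Y)) (x : X) (y : Y) (u : L2 X)
    (w : L2 Y) (hu : ∀ x', u x' = B (slice Y x' (reindex (Equiv.prodComm Y X) z)) y)
    (hw : ∀ y', w y' = A (slice X y' z) x) : A u x = B w y := by
  have h := congrArg (fun v : L2 (X × Y) => v (x, y)) (tensorOne_oneTensor_comm A B z)
  have h1 : u = slice X y (oneTensor X B z) := by ext x'; rw [hu]; rfl
  have h2 : w = slice Y x ((reindex (Equiv.prodComm X Y)).symm (tensorOne Y A z)) := by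
    ext y'; rw [hw]; rfl
  rw [h1, h2]
  exact h

theorem adjoint_tensorOne (A : Op X) :
    (tensorOne Y A).adjoint = tensorOne Y A.adjoint := by
  refine op_ext fun x z => ?_
  rw [ContinuousLinearMap.adjoint_inner_right]
  have h1 := hasSum_inner_slice (tensorOne Y A x) z
  have h2 := hasSum_inner_slice x (tensorOne Y A.adjoint z)
  simp only [slice_tensorOne, ContinuousLinearMap.adjoint_inner_right] at h1 h2
  exact h1.unique h2

theorem adjoint_reindex (e : X ≃ Y) :
    (reindex e : L2 Y →L[ℂ] L2 X).adjoint = ((reindex e).symm : L2 X →L[ℂ] L2 Y) :=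
  LinearIsometryEquiv.adjoint_eq_symm _

theorem adjoint_transport (e : X ≃ Y) (A : Op Y) :
    (transport e A).adjoint = transport e A.adjoint := by
  simp only [transport, ContinuousLinearMap.adjoint_comp, adjoint_reindex]
  rw [← adjoint_reindex e, ContinuousLinearMap.adjoint_adjoint, ContinuousLinearMap.comp_assoc]

/-- `A ↦ A ⊗ 1` as a bounded map. -/
def tensorOneL (X Y : Type*) : Op X →L[ℂ] Op (X × Y) :=
  LinearMap.mkContinuous
    { toFun := tensorOne Y
      map_add' := fun A B => by ext x p; simp
      map_smul' := fun c A => by ext x p; simp } 1 fun A => by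
    rw [one_mul]; exact norm_tensorOne_le A

/-- `transport` as a bounded map. -/
def transportL (e : X ≃ Y) : Op Y →L[ℂ] Op X :=
  LinearMap.mkContinuous
    { toFun := transport e
      map_add' := fun A B => by ext x p; simp [transport]
      map_smul' := fun c A => by ext x p; simp [transport] } 1 fun A => by
    rw [one_mul]; exact norm_transport_le e A

theorem inner_transport (e : X ≃ Y) (A : Op Y) (x z : L2 X) :
    ⟪x, transport e A z⟫_ℂ = ⟪(reindex e).symm x, A ((reindex e).symm z)⟫_ℂ := by
  rw [← (reindex e).inner_map_map, LinearIsometryEquiv.apply_symm_apply]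
  rfl

theorem comp_transportL_mem_normal (e : X ≃ Y) {ω : OpDual (L2 X)} (hω : ω ∈ normal (L2 X)) :
    ω ∘L transportL e ∈ normal (L2 Y) := by
  refine comp_mem_normal (fun x z => ?_) hω
  have : vecFun x z ∘L transportL e = vecFun ((reindex e).symm x) ((reindex e).symm z) := by
    ext A; exact inner_transport e A x z
  rw [this]; exact vecFun_mem_normal _ _

/-- A vector state restricted to one factor is a mixture over the slices. The series converges in
norm because `‖x_y‖ ‖z_y‖ ≤ ‖x_y‖² + ‖z_y‖²`; hence restriction preserves normality. -/
theorem hasSum_vecFun_slice (x z : L2 (X × Y)) :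
    HasSum (fun y => vecFun (slice X y x) (slice X y z)) (vecFun x z ∘L tensorOneL X Y) := by
  have hs : Summable fun y => vecFun (slice X y x) (slice X y z) := by
    refine Summable.of_norm_bounded
      ((hasSum_norm_slice x).summable.add (hasSum_norm_slice z).summable) fun y => ?_
    refine (norm_vecFun_le _ _).trans ?_
    nlinarith [sq_nonneg (‖slice X y x‖ - ‖slice X y z‖), sq_nonneg ‖slice X y x‖,
      sq_nonneg ‖slice X y z‖]
  have h : ∑' y, vecFun (slice X y x) (slice X y z) = vecFun x z ∘L tensorOneL X Y := by
    ext A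
    have h1 := hs.hasSum.mapL (ContinuousLinearMap.apply ℂ ℂ A)
    exact h1.unique (hasSum_inner_slice x (tensorOne Y A z))
  rw [← h]; exact hs.hasSum

theorem comp_tensorOneL_mem_normal {ω : OpDual (L2 (X × Y))} (hω : ω ∈ normal (L2 (X × Y))) :
    ω ∘L tensorOneL X Y ∈ normal (L2 X) :=
  comp_mem_normal (fun x z => hasSum_mem_normal (hasSum_vecFun_slice x z)
    fun _ => vecFun_mem_normal _ _) hω

theorem dens_comp_transportL (e : X ≃ Y) (ω : OpDual (L2 X)) :
    dens (ω ∘L transportL e) = transport e.symm (dens ω) := by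
  have hr : ∀ y, (reindex e).symm ((reindex e.symm).symm y) = y := fun y => by ext i; simp
  refine op_ext fun x z => ?_
  rw [inner_transport, inner_dens, inner_dens]
  refine congrArg ω (op_ext fun u v => ?_)
  change ⟪u, transport e _ v⟫_ℂ = _
  rw [inner_transport]
  simp only [InnerProductSpace.rankOne_apply, inner_smul_right]
  rw [← (reindex e).symm.inner_map_map ((reindex e.symm).symm x),
    ← (reindex e).symm.inner_map_map u, hr, hr]

/-- For vector functionals this is the slice decomposition. The finite partial sums are contractions
in `ω`, so the convergence extends to all normal functionals. -/
theorem hasSum_partialTrace {ω : OpDual (L2 (X × Y))} (hω : ω ∈ normal (L2 (X × Y))) :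
    HasSum (fun y => slice X y ∘L dens ω ∘L (slice X y).adjoint)
      (dens (ω ∘L tensorOneL X Y)) := by
  let P : OpDual (L2 (X × Y)) →L[ℂ] OpDual (L2 X) :=
    (ContinuousLinearMap.compL ℂ _ _ _).flip (tensorOneL X Y)
  let R : Y → OpDual (L2 (X × Y)) →L[ℂ] Op X := fun y =>
    ((ContinuousLinearMap.compL ℂ _ _ _ (slice X y)).comp
      ((ContinuousLinearMap.compL ℂ _ _ _).flip (slice X y).adjoint)).comp dens
  have hR : ∀ y η, R y η = slice X y ∘L dens η ∘L (slice X y).adjoint := fun _ _ => rfl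
  have h := tendsto_of_mem_normal (l := atTop) (fun s : Finset Y => ∑ y ∈ s, R y)
    (dens ∘L P) 1 (fun s => ?_) (fun x z => ?_) hω
  · rw [HasSum, SummationFilter.unconditional_filter]
    exact h.congr fun s => by simp [hR]
  · refine ContinuousLinearMap.opNorm_le_bound _ zero_le_one fun η => ?_
    rw [one_mul]
    refine opNorm_le_of_inner (norm_nonneg _) fun x z => ?_
    -- The operator on the right is `|z⟩⟨x|` tensored with the projection onto the basis vectors in
    -- `s`, hence has norm at most `‖x‖ ‖z‖`.
    have h1 : ⟪x, (∑ y ∈ s, R y) η z⟫_ℂ =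
        η (∑ y ∈ s, rankOne ℂ ((slice X y).adjoint z) ((slice X y).adjoint x)) := by
      simp only [sum_apply, hR, inner_sum, map_sum, ContinuousLinearMap.comp_apply]
      refine Finset.sum_congr rfl fun y _ => ?_
      rw [← ContinuousLinearMap.adjoint_inner_left, inner_dens]
    rw [h1]
    refine (η.le_opNorm _).trans ?_
    gcongr
    refine opNorm_le_of_inner (by positivity) fun u v => ?_
    simp only [sum_apply, InnerProductSpace.rankOne_apply, inner_sum, inner_smul_right,
      ContinuousLinearMap.adjoint_inner_left, ContinuousLinearMap.adjoint_inner_right]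
    refine (norm_sum_le _ _).trans ?_
    have h2 : ∀ y ∈ s, ‖⟪x, slice X y v⟫_ℂ * ⟪slice X y u, z⟫_ℂ‖ ≤
        (‖x‖ * ‖z‖) * (‖slice X y u‖ * ‖slice X y v‖) := fun y _ => by
      rw [norm_mul]
      calc _ ≤ (‖x‖ * ‖slice X y v‖) * (‖slice X y u‖ * ‖z‖) := by
            gcongr <;> exact norm_inner_le_norm _ _
        _ = _ := by ring
    refine (Finset.sum_le_sum h2).trans ?_
    rw [← Finset.mul_sum]
    gcongr
    exact sum_mul_le_of_sum_sq_le (norm_nonneg _) (norm_nonneg _) (sum_norm_slice_sq_le s u)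
      (sum_norm_slice_sq_le s v)
  · have h1 := (hasSum_vecFun_slice x z).mapL (dens (E := L2 X))
    rw [HasSum, SummationFilter.unconditional_filter] at h1
    refine h1.congr fun s => ?_
    rw [sum_apply]
    refine Finset.sum_congr rfl fun y _ => ?_
    rw [hR, dens_vecFun, dens_vecFun]
    refine op_ext fun u v => ?_
    simp [ContinuousLinearMap.adjoint_inner_right]

theorem partialTrace_dens {ω : OpDual (L2 (X × Y))} (hω : ω ∈ normal (L2 (X × Y))) :
    partialTrace (dens ω) = dens (ω ∘L tensorOneL X Y) := (hasSum_partialTrace hω).tsum_eq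

end L2Lemmas

/-! ### Overwriting the entries of a family along an embedding. -/

section Extend

variable {ι V W Z U : Type*}

theorem extend_embedding_comp (f : V ↪ W) (β : V → ι) (α : W → ι) :
    (fun v => Function.extend f β α (f v)) = β :=
  funext fun v => f.injective.extend_apply β α v

theorem extend_extend (f : V ↪ W) (γ β : V → ι) (α : W → ι) :
    Function.extend f γ (Function.extend f β α) = Function.extend f γ α := by
  funext w
  by_cases h : ∃ v, f v = w
  · obtain ⟨v, rfl⟩ := h
    simp [f.injective.extend_apply]
  · simp [Function.extend_apply' _ _ _ h]

theorem extend_extend_trans (f : V ↪ W) (g : W ↪ Z) (γ : V → ι) (α : Z → ι) :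
    Function.extend g (Function.extend f γ fun w => α (g w)) α =
      Function.extend (f.trans g) γ α := by
  funext z
  by_cases h : ∃ w, g w = z
  · obtain ⟨w, rfl⟩ := h
    rw [g.injective.extend_apply]
    by_cases h' : ∃ v, f v = w
    · obtain ⟨v, rfl⟩ := h'
      rw [f.injective.extend_apply]
      exact ((f.trans g).injective.extend_apply γ α v).symm
    · rw [Function.extend_apply' _ _ _ h', Function.extend_apply']
      rintro ⟨v, hv⟩
      exact h' ⟨v, g.injective hv⟩
  · rw [Function.extend_apply' _ _ _ h, Function.extend_apply']
    rintro ⟨v, hv⟩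
    exact h ⟨f v, hv⟩

theorem extend_disjoint_comp {f : V ↪ W} {g : U ↪ W} (hfg : ∀ v u, f v ≠ g u) (β : V → ι)
    (α : W → ι) : (fun u => Function.extend f β α (g u)) = fun u => α (g u) :=
  funext fun u => Function.extend_apply' _ _ _ fun ⟨v, hv⟩ => hfg v u hv

theorem extend_comm {f : V ↪ W} {g : U ↪ W} (hfg : ∀ v u, f v ≠ g u) (β : V → ι) (γ : U → ι)
    (α : W → ι) : Function.extend g γ (Function.extend f β α) =
      Function.extend f β (Function.extend g γ α) := by
  funext w
  by_cases h : ∃ v, f v = w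
  · obtain ⟨v, rfl⟩ := h
    rw [f.injective.extend_apply, Function.extend_apply', f.injective.extend_apply]
    rintro ⟨u, hu⟩
    exact hfg v u hu.symm
  · rw [Function.extend_apply' _ _ _ h]
    by_cases h' : ∃ u, g u = w
    · obtain ⟨u, rfl⟩ := h'
      rw [g.injective.extend_apply, g.injective.extend_apply]
    · rw [Function.extend_apply' _ _ _ h', Function.extend_apply' _ _ _ h',
        Function.extend_apply' _ _ _ h]

end Extend

/-! ### Operators acting on selected factors. -/

section Embed

variable {ι V W Z U : Type*}

open Classical in
/-- The splitting of a family into its restriction along an embedding and the other entries. -/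
def embSplit (ι : Type*) (f : V ↪ W) :
    (W → ι) ≃ (V → ι) × ({w : W // w ∉ Set.range f} → ι) where
  toFun α := (fun v => α (f v), fun w => α w)
  invFun p w := if h : w ∈ Set.range f then p.1 h.choose else p.2 ⟨w, h⟩
  left_inv α := by
    funext w
    by_cases h : w ∈ Set.range f
    · simp only [dif_pos h]
      rw [h.choose_spec]
    · simp only [dif_neg h]
  right_inv p := by
    refine Prod.ext (funext fun v => ?_) (funext fun w => ?_)
    · have h : f v ∈ Set.range f := ⟨v, rfl⟩
      simp only [dif_pos h]
      exact congrArg p.1 (f.injective h.choose_spec)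
    · simp only [dif_neg w.2]

theorem embSplit_symm (f : V ↪ W) (β : V → ι) (α : W → ι) :
    (embSplit ι f).symm (β, (embSplit ι f α).2) = Function.extend f β α := by
  funext w
  by_cases h : w ∈ Set.range f
  · have h1 : (embSplit ι f).symm (β, (embSplit ι f α).2) w = β h.choose := dif_pos h
    rw [h1]
    conv_rhs => rw [← h.choose_spec]
    exact (f.injective.extend_apply _ _ _).symm
  · have h1 : (embSplit ι f).symm (β, (embSplit ι f α).2) w = α w := dif_neg h
    rw [h1, Function.extend_apply' _ _ _ h]

/-- The operator on `ℓ²(ι ^ W)` that acts as `A` on the factors in the range of `f`. -/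
def embed (f : V ↪ W) : Op (V → ι) →L[ℂ] Op (W → ι) :=
  transportL (embSplit ι f) ∘L tensorOneL _ _

/-- The slice of a vector along `f` with the remaining entries taken from `α`. -/
def slot (f : V ↪ W) (α : W → ι) (x : L2 (W → ι)) : L2 (V → ι) :=
  slice _ (embSplit ι f α).2 ((reindex (embSplit ι f)).symm x)

theorem slot_apply (f : V ↪ W) (α : W → ι) (x : L2 (W → ι)) (β : V → ι) :
    slot f α x β = x (Function.extend f β α) := by
  rw [← embSplit_symm]; rfl

theorem embed_apply (f : V ↪ W) (A : Op (V → ι)) (x : L2 (W → ι)) (α : W → ι) :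
    embed f A x α = A (slot f α x) fun v => α (f v) := rfl

/-- The operator depends only on which entries are overwritten, not on how the other entries are
packaged. This identifies the splittings behind `pairOp` and `marginal` with the uniform `embed`. -/
theorem transport_tensorOne {Y : Type*} (f : V ↪ W) (e : (W → ι) ≃ (V → ι) × Y)
    (h1 : ∀ α v, (e α).1 v = α (f v))
    (h2 : ∀ β α, e.symm (β, (e α).2) = Function.extend f β α) (A : Op (V → ι)) :
    transport e (tensorOne Y A) = embed f A := by
  ext x α
  change A (slice _ (e α).2 ((reindex e).symm x)) (e α).1 = A (slot f α x) _
  have h3 : slice _ (e α).2 ((reindex e).symm x) = slot f α x := by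
    ext β
    rw [slot_apply, ← h2]; rfl
  rw [h3, show (e α).1 = fun v => α (f v) from funext (h1 α)]
  rfl

theorem slot_slot (f : V ↪ W) (g : W ↪ Z) (α : Z → ι) (x : L2 (Z → ι)) :
    slot f (fun w => α (g w)) (slot g α x) = slot (f.trans g) α x := by
  ext γ
  rw [slot_apply, slot_apply, slot_apply, extend_extend_trans]

theorem embed_trans (f : V ↪ W) (g : W ↪ Z) (A : Op (V → ι)) :
    embed (f.trans g) A = embed g (embed f A) := by
  ext x α
  rw [embed_apply, embed_apply, embed_apply, slot_slot]
  rfl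

theorem slot_extend (f : V ↪ W) (β : V → ι) (α : W → ι) (x : L2 (W → ι)) :
    slot f (Function.extend f β α) x = slot f α x := by
  ext γ
  rw [slot_apply, slot_apply, extend_extend]

theorem embed_mul (f : V ↪ W) (A B : Op (V → ι)) : embed f (A * B) = embed f A * embed f B := by
  ext x α
  rw [mul_apply_eq_comp, embed_apply, embed_apply, mul_apply_eq_comp]
  have : slot f α (embed f B x) = B (slot f α x) := by
    ext β
    rw [slot_apply, embed_apply, slot_extend, extend_embedding_comp]
  rw [this]

theorem embed_one (f : V ↪ W) : embed f (1 : Op (V → ι)) = 1 := by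
  ext x α
  rw [embed_apply, one_apply_eq_self, one_apply_eq_self, slot_apply]
  congr 1
  funext w
  by_cases h : ∃ v, f v = w
  · obtain ⟨v, rfl⟩ := h
    rw [f.injective.extend_apply]
  · rw [Function.extend_apply' _ _ _ h]

theorem embed_star (f : V ↪ W) (A : Op (V → ι)) : embed f (star A) = star (embed f A) := by
  rw [ContinuousLinearMap.star_eq_adjoint, ContinuousLinearMap.star_eq_adjoint]
  change transport _ (tensorOne _ A.adjoint) = (transport _ (tensorOne _ A)).adjoint
  rw [adjoint_transport, adjoint_tensorOne]

theorem norm_embed_apply_le (f : V ↪ W) (A : Op (V → ι)) : ‖embed f A‖ ≤ ‖A‖ :=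
  (norm_transport_le _ _).trans (norm_tensorOne_le _)

theorem norm_embed_le (f : V ↪ W) : ‖(embed f : Op (V → ι) →L[ℂ] Op (W → ι))‖ ≤ 1 :=
  ContinuousLinearMap.opNorm_le_bound _ zero_le_one fun A => by
    rw [one_mul]; exact norm_embed_apply_le f A

/-- Operators that act on different factors commute. -/
theorem embed_comm {f : V ↪ W} {g : U ↪ W} (hfg : ∀ v u, f v ≠ g u) (A : Op (V → ι))
    (B : Op (U → ι)) : embed f A * embed g B = embed g B * embed f A := by
  ext x α
  rw [mul_apply_eq_comp, mul_apply_eq_comp, embed_apply f, embed_apply g]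
  -- Freezing all entries outside the two ranges at `α` leaves a vector in two independent
  -- variables, to which `apply_apply_comm` applies.
  let j : (V → ι) × (U → ι) → (W → ι) := fun p =>
    Function.extend g p.2 (Function.extend f p.1 α)
  have hj : Function.Injective j := fun p q hpq => by
    refine Prod.ext ?_ ?_
    · rw [← extend_embedding_comp f p.1 (Function.extend g p.2 α),
        ← extend_embedding_comp f q.1 (Function.extend g q.2 α),
        ← extend_comm hfg, ← extend_comm hfg]
      exact congrArg (fun r v => r (f v)) hpq
    · rw [← extend_embedding_comp g p.2 (Function.extend f p.1 α),
        ← extend_embedding_comp g q.2 (Function.extend f q.1 α)]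
      exact congrArg (fun r v => r (g v)) hpq
  refine apply_apply_comm A B (L2.mk (fun p => x (j p)) ((summable_sq x).comp_injective hj))
    _ _ _ _ (fun β => ?_) fun γ => ?_
  · rw [slot_apply, embed_apply, extend_disjoint_comp hfg]
    congr 1
  · rw [slot_apply, embed_apply, extend_disjoint_comp fun u v => (hfg v u).symm]
    congr 1
    refine congrArg A ?_
    ext β
    rw [slot_apply, ← extend_comm hfg]; rfl

theorem comp_embed_mem_normal (f : V ↪ W) {ω : OpDual (L2 (W → ι))}
    (hω : ω ∈ normal (L2 (W → ι))) : ω ∘L embed f ∈ normal (L2 (V → ι)) :=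
  comp_tensorOneL_mem_normal (comp_transportL_mem_normal (embSplit ι f) hω)

/-- The partial trace is dual to `A ↦ A ⊗ 1`, so marginals of densities are densities of restricted
functionals. -/
theorem marginal_dens (k m : ℕ) {ω : OpDual (L2 (Fin (k + m) → ι))}
    (hω : ω ∈ normal (L2 (Fin (k + m) → ι))) :
    marginal k m (dens ω) = dens (ω ∘L embed (Fin.castAddEmb m)) := by
  have h1 := dens_comp_transportL (Fin.appendEquiv k m).symm ω
  rw [Equiv.symm_symm] at h1
  rw [marginal, ← h1, partialTrace_dens (comp_transportL_mem_normal _ hω)]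
  refine congrArg dens ?_
  ext A
  have h2 : transport (Fin.appendEquiv k m).symm (tensorOne (Fin m → ι) A) =
      embed (Fin.castAddEmb m) A := ?_
  · exact congrArg ω h2
  refine transport_tensorOne (Fin.castAddEmb m) (Fin.appendEquiv k m).symm (fun α v => rfl)
    (fun β α => ?_) A
  funext w
  refine Fin.addCases (fun i => ?_) (fun i => ?_) w
  · exact (Fin.append_left _ _ _).trans ((Fin.castAddEmb m).injective.extend_apply β α i).symm
  · rw [Function.extend_apply']
    · exact Fin.append_right _ _ _
    · rintro ⟨v, hv⟩
      have := congrArg Fin.val hv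
      simp at this
      omega

/-- Two distinct labels as an embedding. -/
def pairEmb {i j : V} (hij : i ≠ j) : Fin 2 ↪ V where
  toFun := ![i, j]
  inj' a c h := by
    fin_cases a <;> fin_cases c <;> simp_all [hij.symm]

theorem pairOp_eq_embed {N : ℕ} {i j : Fin N} (hij : i ≠ j) (A : NOp ι 2) :
    pairOp hij A = embed (pairEmb hij) A := by
  refine transport_tensorOne (pairEmb hij) (pairSplit ι hij) (fun α v => ?_) (fun β α => ?_) A
  · fin_cases v <;> rfl
  · funext l
    have h0 : ∀ v, Function.extend (pairEmb hij) β α (pairEmb hij v) = β v :=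
      (pairEmb hij).injective.extend_apply β α
    by_cases hi : l = i
    · subst hi
      exact (dif_pos rfl).trans (h0 0).symm
    · by_cases hj : l = j
      · subst hj
        exact ((dif_neg hi).trans (dif_pos rfl)).trans (h0 1).symm
      · rw [Function.extend_apply']
        · exact (dif_neg hi).trans (dif_neg hj)
        · rintro ⟨v, hv⟩
          fin_cases v
          · exact hi hv.symm
          · exact hj hv.symm

/-- A permutation is itself an embedding of the labels, so permutation symmetry is handled by the
same calculus as restriction to fewer particles. -/
theorem permOp_conj {N : ℕ} (π : Equiv.Perm (Fin N)) (A : NOp ι N) :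
    permOp ι π * A * star (permOp ι π) = embed π.symm.toEmbedding A := by
  have hs : star (permOp ι π) =
      ((reindex (Equiv.arrowCongr π (Equiv.refl ι))).symm : L2 (Fin N → ι) →L[ℂ] _) := by
    rw [ContinuousLinearMap.star_eq_adjoint, permOp, adjoint_reindex]
  rw [hs]
  ext x α
  rw [embed_apply]
  change A ((reindex (Equiv.arrowCongr π (Equiv.refl ι))).symm x) _ = _
  have : (reindex (Equiv.arrowCongr π (Equiv.refl ι))).symm x = slot π.symm.toEmbedding α x := by
    ext β
    rw [slot_apply, reindex_symm_apply]
    congr 1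
    funext w
    obtain ⟨v, rfl⟩ := π.symm.surjective w
    exact (congrArg β (π.apply_symm_apply v)).trans
      (π.symm.toEmbedding.injective.extend_apply β α v).symm
  rw [this]
  rfl

end Embed

/-! ### Matrix units and the entries of tensor powers. -/

section MatrixUnits

variable {ι : Type*}

/-- The matrix units of `ℓ²(X)`. -/
def matUnit {X : Type*} (α β : X) : Op X := rankOne ℂ (stdBasis X α) (stdBasis X β)

theorem matUnit_apply {X : Type*} [DecidableEq X] (α β : X) (x : L2 X) (ζ : X) :
    matUnit α β x ζ = if ζ = α then x β else 0 := by
  rw [matUnit, InnerProductSpace.rankOne_apply, inner_stdBasis, smul_apply, stdBasis_apply]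
  split_ifs <;> simp

theorem dens_apply_stdBasis {X : Type*} (ω : OpDual (L2 X)) (α β : X) :
    ⟪stdBasis X α, dens ω (stdBasis X β)⟫_ℂ = ω (matUnit β α) := inner_dens _ _ _

theorem embed_matUnit_mul {k l : ℕ} (α β : Fin k → ι) (γ δ : Fin l → ι) :
    embed (Fin.castAddEmb l) (matUnit α β) * embed (Fin.natAddEmb k) (matUnit γ δ) =
      matUnit (Fin.append α γ) (Fin.append β δ) := by
  classical
  have hne : ∀ (v : Fin k) (u : Fin l), Fin.castAddEmb l v ≠ Fin.natAddEmb k u := fun v u h => by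
    have := congrArg Fin.val h
    simp at this
    omega
  ext x ζ
  rw [mul_apply_eq_comp, embed_apply, matUnit_apply, matUnit_apply, slot_apply, embed_apply,
    matUnit_apply, slot_apply, extend_disjoint_comp hne]
  have h1 : ζ = Fin.append α γ ↔ (fun v => ζ (Fin.castAddEmb l v)) = α ∧
      (fun u => ζ (Fin.natAddEmb k u)) = γ := by
    constructor
    · rintro rfl
      exact ⟨funext fun v => Fin.append_left _ _ v, funext fun u => Fin.append_right _ _ u⟩
    · rintro ⟨rfl, rfl⟩
      exact Fin.append_castAdd_natAdd.symm
  have h2 : Function.extend (Fin.natAddEmb k) δ (Function.extend (Fin.castAddEmb l) β ζ) =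
      Fin.append β δ := by
    funext w
    refine Fin.addCases (fun i => ?_) (fun i => ?_) w
    · rw [Fin.append_left, extend_comm hne]
      exact (Fin.castAddEmb l).injective.extend_apply _ _ i
    · rw [Fin.append_right]
      exact (Fin.natAddEmb k).injective.extend_apply _ _ i
  rw [h2]
  simp only [h1]
  split_ifs <;> simp_all

variable {H : Type*} [NormedAddCommGroup H] [InnerProductSpace ℂ H] (b : HilbertBasis ι ℂ H)

theorem coords_symm_stdBasis (i : ι) : (coords b).symm (stdBasis ι i) = b i := by
  classical
  have : stdBasis ι i = lp.single 2 i (1 : ℂ) := ((stdBasis ι).repr_symm_single i).symm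
  rw [this]
  exact b.repr_symm_single i

theorem reindex_symm_stdBasis {X Y : Type*} (e : X ≃ Y) (i : X) :
    (reindex e).symm (stdBasis X i) = stdBasis Y (e i) := by
  classical
  ext j
  rw [reindex_symm_apply, stdBasis_apply, stdBasis_apply]
  simp only [Equiv.symm_apply_eq]

theorem inner_tensorPow (ρ : H →L[ℂ] H) (k : ℕ) (α β : Fin k → ι) :
    ⟪stdBasis _ α, tensorPow b ρ k (stdBasis _ β)⟫_ℂ = ∏ i, ⟪b (α i), ρ (b (β i))⟫_ℂ := by
  induction k with
  | zero =>
    have : α = β := Subsingleton.elim _ _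
    subst this
    simp [tensorPow, (stdBasis (Fin 0 → ι)).orthonormal.1 α]
  | succ k ih =>
    rw [tensorPow, inner_transport, reindex_symm_stdBasis, reindex_symm_stdBasis,
      Fin.prod_univ_succ, inner_stdBasis, stdBasis_prod]
    change (tensorOne _ _ (oneTensor ι (tensorPow b ρ k) _)).val _ = _
    rw [oneTensor_prodVec, tensorOne_prodVec, prodVec_apply]
    congr 1
    · simp only [ContinuousLinearMap.comp_apply]
      change coords b (ρ ((coords b).symm (stdBasis ι _))) _ = _
      rw [coords_symm_stdBasis, coords_apply]
      rfl
    · rw [← inner_stdBasis]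
      exact ih _ _

end MatrixUnits

/-! ### Exponentials of bounded operators, and the cone of positive operators. -/

section Exponential

variable {F : Type*} [NormedAddCommGroup F] [NormedSpace ℂ F] [CompleteSpace F]

theorem hasSum_exp_apply (L : F →L[ℂ] F) (x : F) :
    HasSum (fun n : ℕ => ((n.factorial : ℂ)⁻¹) • (L ^ n) x) (NormedSpace.exp L x) :=
  (NormedSpace.exp_series_hasSum_exp' (𝕂 := ℂ) L).mapL (ContinuousLinearMap.apply ℂ F x)

theorem exp_smul_add (L : F →L[ℂ] F) (s t : ℂ) :
    NormedSpace.exp ((s + t) • L) = NormedSpace.exp (s • L) * NormedSpace.exp (t • L) := by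
  let _ : NormedAlgebra ℚ (F →L[ℂ] F) := NormedAlgebra.restrictScalars ℚ ℂ _
  rw [add_smul]
  exact NormedSpace.exp_add_of_commute (((Commute.refl L).smul_left s).smul_right t)

/-- Splitting off the scalar `exp (-c)` leaves, for `c ≥ 0`, a power series in `Q` with nonnegative
coefficients; positivity of the semigroup is read off from it. -/
theorem exp_smul_sub_one (Q : F →L[ℂ] F) (c : ℂ) :
    NormedSpace.exp (c • (Q - 1)) = Complex.exp (-c) • NormedSpace.exp (c • Q) := by
  let _ : NormedAlgebra ℚ (F →L[ℂ] F) := NormedAlgebra.restrictScalars ℚ ℂ _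
  have h1 : c • (Q - 1) = c • Q + algebraMap ℂ (F →L[ℂ] F) (-c) := by
    rw [Algebra.algebraMap_eq_smul_one, smul_sub, neg_smul, sub_eq_add_neg]
  rw [h1, NormedSpace.exp_add_of_commute (Algebra.commutes' (-c) _).symm,
    ← NormedSpace.algebraMap_exp_comm, ← Complex.exp_eq_exp_ℂ, Algebra.algebraMap_eq_smul_one,
    mul_smul_comm, mul_one]

end Exponential

section Positive

variable {E : Type*} [NormedAddCommGroup E] [InnerProductSpace ℂ E]

theorem isClosed_isPositive : IsClosed {A : E →L[ℂ] E | A.IsPositive} := by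
  have : {A : E →L[ℂ] E | A.IsPositive} = ⋂ x : E, {A : E →L[ℂ] E |
      ((RCLike.re ⟪A x, x⟫_ℂ : ℝ) : ℂ) = ⟪A x, x⟫_ℂ ∧ 0 ≤ RCLike.re ⟪A x, x⟫_ℂ} := by
    ext A
    simp only [Set.mem_iInter]
    exact ContinuousLinearMap.isPositive_iff_complex A
  rw [this]
  refine isClosed_iInter fun x => ?_
  have hc : Continuous fun A : E →L[ℂ] E => ⟪A x, x⟫_ℂ := by fun_prop
  have hr : Continuous fun A : E →L[ℂ] E => RCLike.re ⟪A x, x⟫_ℂ := RCLike.continuous_re.comp hc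
  exact (isClosed_eq (Complex.continuous_ofReal.comp hr) hc).inter (isClosed_le continuous_const hr)

theorem isPositive_smul {A : E →L[ℂ] E} (hA : A.IsPositive) {r : ℝ} (hr : 0 ≤ r) :
    ((r : ℂ) • A).IsPositive :=
  hA.smul_of_nonneg (by exact_mod_cast hr)

theorem convex_isPositive : Convex ℝ {A : E →L[ℂ] E | A.IsPositive} := by
  intro A hA B hB r s hr hs _
  have h1 := (isPositive_smul hA hr).add (isPositive_smul hB hs)
  rw [Complex.coe_smul, Complex.coe_smul] at h1
  exact h1

end Positive

/-! ### Averaged binary collisions. -/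

namespace CollisionSpec

variable {H : Type*} [NormedAddCommGroup H] [InnerProductSpace ℂ H] {ι : Type*}
  {b : HilbertBasis ι ℂ H} {h : H →ₗ.[ℂ] H}
  {C : Type*} [MetricSpace C] [CompactSpace C] [MeasurableSpace C] [BorelSpace C]
  (S : CollisionSpec b h C) {N : ℕ}

theorem UPair_eq {i j : Fin N} (hij : i ≠ j) (σ : C) :
    S.UPair hij σ = embed (pairEmb hij) (S.U σ) := pairOp_eq_embed hij _

theorem UPair_mul_star {i j : Fin N} (hij : i ≠ j) (σ : C) :
    S.UPair hij σ * star (S.UPair hij σ) = 1 := by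
  rw [UPair_eq, ← embed_star, ← embed_mul, Unitary.mul_star_self_of_mem (S.U σ).2, embed_one]

theorem star_UPair_mul {i j : Fin N} (hij : i ≠ j) (σ : C) :
    star (S.UPair hij σ) * S.UPair hij σ = 1 := by
  rw [UPair_eq, ← embed_star, ← embed_mul, Unitary.star_mul_self_of_mem (S.U σ).2, embed_one]

theorem norm_conj_UPair_le {i j : Fin N} (hij : i ≠ j) (σ : C) (A : NOp ι N) :
    ‖S.UPair hij σ * A * star (S.UPair hij σ)‖ ≤ ‖A‖ := by
  have hU : ‖S.UPair hij σ‖ ≤ 1 := by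
    rw [UPair_eq]
    refine (norm_embed_apply_le _ _).trans ?_
    refine ContinuousLinearMap.opNorm_le_bound _ zero_le_one fun x => ?_
    rw [one_mul]
    exact (Unitary.norm_map (S.U σ) x).le
  calc _ ≤ ‖S.UPair hij σ‖ * ‖A‖ * ‖star (S.UPair hij σ)‖ := norm_mul₃_le
    _ ≤ 1 * ‖A‖ * 1 := by gcongr; rwa [norm_star]
    _ = ‖A‖ := by ring

theorem norm_QPair_apply_le {i j : Fin N} (hij : i ≠ j) (A : NOp ι N) :
    ‖S.QPair hij A‖ ≤ ‖A‖ := by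
  have := S.isProbabilityMeasure
  rw [(S.QPair_apply hij A).2]
  simpa using norm_integral_le_of_norm_le_const (μ := S.ν)
    (Eventually.of_forall fun σ => S.norm_conj_UPair_le hij σ A)

theorem QPair_apply_of_commute {i j : Fin N} (hij : i ≠ j) {A : NOp ι N}
    (hA : ∀ σ, S.UPair hij σ * A = A * S.UPair hij σ) : S.QPair hij A = A := by
  have := S.isProbabilityMeasure
  rw [(S.QPair_apply hij A).2]
  have : ∀ σ, S.UPair hij σ * A * star (S.UPair hij σ) = A := fun σ => by
    rw [hA, mul_assoc, UPair_mul_star, mul_one]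
  simp [this]

/-- `B` commutes with the unitaries, hence with their adjoints, and can be pulled out of the
average. Applied to observables of particles that do not take part in the collision, this is the
source of the Leibniz rule. -/
theorem QPair_mul_of_commute {i j : Fin N} (hij : i ≠ j) {A B : NOp ι N}
    (hB : ∀ σ, S.UPair hij σ * B = B * S.UPair hij σ) :
    S.QPair hij (A * B) = S.QPair hij A * B := by
  rw [(S.QPair_apply hij _).2, (S.QPair_apply hij _).2]
  have hB' : ∀ σ, B * star (S.UPair hij σ) = star (S.UPair hij σ) * B := fun σ => by
    calc B * star (S.UPair hij σ) = star (S.UPair hij σ) * (S.UPair hij σ * B)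
          * star (S.UPair hij σ) := by
          rw [← mul_assoc (star _), star_UPair_mul, one_mul]
      _ = star (S.UPair hij σ) * B * (S.UPair hij σ * star (S.UPair hij σ)) := by
          rw [hB]; simp only [mul_assoc]
      _ = _ := by rw [UPair_mul_star, mul_one]
  have h1 : ∀ σ, S.UPair hij σ * (A * B) * star (S.UPair hij σ) =
      (ContinuousLinearMap.mul ℂ (NOp ι N)).flip B
        (S.UPair hij σ * A * star (S.UPair hij σ)) := fun σ => by
    simp only [ContinuousLinearMap.flip_apply, ContinuousLinearMap.mul_apply', mul_assoc, hB']
  simp only [h1]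
  exact ContinuousLinearMap.integral_comp_comm _ (S.QPair_apply hij A).1

theorem QPair_embed {M : ℕ} (f : Fin M ↪ Fin N) {i j : Fin M} (hij : i ≠ j)
    (hf : f i ≠ f j) (A : NOp ι M) : S.QPair hf (embed f A) = embed f (S.QPair hij A) := by
  rw [(S.QPair_apply hij _).2, (S.QPair_apply hf _).2,
    ← ContinuousLinearMap.integral_comp_comm _ (S.QPair_apply hij A).1]
  have h1 : ∀ σ, S.UPair hf σ = embed f (S.UPair hij σ) := fun σ => by
    rw [UPair_eq, UPair_eq, ← embed_trans]
    congr 2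
    ext v
    fin_cases v <;> rfl
  simp only [h1, embed_mul, embed_star]

/-- Exchanging the two colliding particles amounts to a `ν`-preserving change of the collision
parameter. This permits sums over ordered pairs. -/
theorem QPair_symm {i j : Fin N} (hij : i ≠ j) (hji : j ≠ i) : S.QPair hji = S.QPair hij := by
  obtain ⟨T, hT, hU⟩ := S.swap_invariant
  have h1 : ∀ σ, S.UPair hji σ = S.UPair hij (T σ) := fun σ => by
    rw [UPair_eq, UPair_eq, ← hU, permOp_conj, ← embed_trans]
    congr 2
    ext v
    fin_cases v <;> simp [pairEmb] <;> rfl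
  ext1 A
  have h2 := (S.QPair_apply hij A).1.aestronglyMeasurable
  rw [← hT.map_eq] at h2
  rw [(S.QPair_apply hij _).2, (S.QPair_apply hji _).2]
  simp only [h1]
  rw [← integral_map hT.measurable.aemeasurable h2, hT.map_eq]

/-- Time reversal is a `ν`-preserving substitution that interchanges the unitaries and their
adjoints. The consequence is that `QPair` is its own dual under the trace pairing. -/
theorem QPair_apply_star {i j : Fin N} (hij : i ≠ j) (A : NOp ι N) :
    S.QPair hij A = ∫ σ, star (S.UPair hij σ) * A * S.UPair hij σ ∂S.ν := by
  obtain ⟨T, hT, hU⟩ := S.time_reversal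
  have h1 : ∀ σ, star (S.UPair hij σ) = S.UPair hij (T σ) := fun σ => by
    rw [UPair_eq, UPair_eq, ← hU, ← embed_star]
    rfl
  have h3 : ∀ σ, S.UPair hij σ = star (S.UPair hij (T σ)) := fun σ => by
    rw [← h1, star_star]
  have h2 := (S.QPair_apply hij A).1.aestronglyMeasurable
  rw [← hT.map_eq] at h2
  have h4 : ∀ σ, star (S.UPair hij σ) * A * S.UPair hij σ =
      S.UPair hij (T σ) * A * star (S.UPair hij (T σ)) := fun σ => by rw [h1, ← h3]
  rw [(S.QPair_apply hij _).2]
  simp only [h4]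
  rw [← integral_map hT.measurable.aemeasurable h2, hT.map_eq]

/-- Duality of the averaged collision. -/
theorem dens_comp_QPair {i j : Fin N} (hij : i ≠ j) (ω : OpDual (L2 (Fin N → ι))) :
    dens (ω ∘L S.QPair hij) = S.QPair hij (dens ω) := by
  refine op_ext fun x y => ?_
  have hint : Integrable (fun σ => star (S.UPair hij σ) * dens ω * S.UPair hij σ) S.ν := by
    have := S.isProbabilityMeasure
    have hU : Continuous (S.UPair hij) :=
      (continuous_pairOp hij).comp (continuous_subtype_val.comp S.continuous_U)
    exact (((continuous_star.comp hU).mul continuous_const).mul hU).integrable_of_hasCompactSupport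
      (HasCompactSupport.of_compactSpace _)
  rw [inner_dens, QPair_apply_star]
  have h1 : ω (S.QPair hij (rankOne ℂ y x)) = ∫ σ, ω (S.UPair hij σ * rankOne ℂ y x *
      star (S.UPair hij σ)) ∂S.ν := by
    rw [(S.QPair_apply hij _).2, ContinuousLinearMap.integral_comp_comm _ (S.QPair_apply hij _).1]
  have h2 : ⟪x, (∫ σ, star (S.UPair hij σ) * dens ω * S.UPair hij σ ∂S.ν) y⟫_ℂ =
      ∫ σ, ⟪x, (star (S.UPair hij σ) * dens ω * S.UPair hij σ) y⟫_ℂ ∂S.ν :=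
    (ContinuousLinearMap.integral_comp_comm (vecFun x y) hint).symm
  refine h1.trans (Eq.trans ?_ h2.symm)
  refine integral_congr_ae (Eventually.of_forall fun σ => ?_)
  simp only [mul_apply_eq_comp, ContinuousLinearMap.star_eq_adjoint,
    ContinuousLinearMap.adjoint_inner_right, inner_dens]
  refine congrArg ω (op_ext fun u v => ?_)
  simp [ContinuousLinearMap.adjoint_inner_right]

/-- Each single collision maps the vector functional of `(x, y)` to that of `(U* x, U* y)`, and a
closed subspace contains averages of its elements. -/
theorem comp_QPair_mem_normal {i j : Fin N} (hij : i ≠ j) {ω : OpDual (L2 (Fin N → ι))}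
    (hω : ω ∈ normal (L2 (Fin N → ι))) : ω ∘L S.QPair hij ∈ normal (L2 (Fin N → ι)) := by
  have := S.isProbabilityMeasure
  refine comp_mem_normal (fun x y => ?_) hω
  have hU : Continuous (S.UPair hij) :=
    (continuous_pairOp hij).comp (continuous_subtype_val.comp S.continuous_U)
  have hc : Continuous fun σ => ContinuousLinearMap.mulLeftRight ℂ (NOp ι N)
      (S.UPair hij σ) (star (S.UPair hij σ)) :=
    (((ContinuousLinearMap.mulLeftRight ℂ (NOp ι N)).continuous.comp hU).clm_apply
      (continuous_star.comp hU))
  have hi : Integrable (fun σ => ContinuousLinearMap.mulLeftRight ℂ (NOp ι N)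
      (S.UPair hij σ) (star (S.UPair hij σ))) S.ν :=
    hc.integrable_of_hasCompactSupport (HasCompactSupport.of_compactSpace _)
  let P := ContinuousLinearMap.compL ℂ (NOp ι N) (NOp ι N) ℂ (vecFun x y)
  have h1 : vecFun x y ∘L S.QPair hij = ∫ σ, P (ContinuousLinearMap.mulLeftRight ℂ (NOp ι N)
      (S.UPair hij σ) (star (S.UPair hij σ))) ∂S.ν :=
    (ContinuousLinearMap.integral_comp_comm P hi).symm
  rw [h1]
  refine Convex.integral_mem (s := (normal (L2 (Fin N → ι)) : Set (OpDual (L2 (Fin N → ι)))))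
    ((normal (L2 (Fin N → ι))).restrictScalars ℝ).convex isClosed_normal
    (Eventually.of_forall fun σ => ?_) (P.integrable_comp hi)
  have h2 : P (ContinuousLinearMap.mulLeftRight ℂ (NOp ι N)
      (S.UPair hij σ) (star (S.UPair hij σ))) =
      vecFun (star (S.UPair hij σ) x) (star (S.UPair hij σ) y) := by
    ext B
    change ⟪x, (S.UPair hij σ * B * star (S.UPair hij σ)) y⟫_ℂ = _
    simp [ContinuousLinearMap.star_eq_adjoint, ContinuousLinearMap.adjoint_inner_left]
  change P _ ∈ normal _
  rw [h2]
  exact vecFun_mem_normal _ _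

theorem isPositive_QPair {i j : Fin N} (hij : i ≠ j) {A : NOp ι N} (hA : A.IsPositive) :
    (S.QPair hij A).IsPositive := by
  have := S.isProbabilityMeasure
  rw [(S.QPair_apply hij _).2]
  refine Convex.integral_mem (s := {A : NOp ι N | A.IsPositive}) convex_isPositive
    isClosed_isPositive (Eventually.of_forall fun σ => ?_) (S.QPair_apply hij A).1
  exact hA.conj_adjoint (S.UPair hij σ)

end CollisionSpec

theorem sum_pairs_eq {M : Type*} [AddCommMonoid M] {N : ℕ} (F : Fin N → Fin N → M)
    (hsymm : ∀ i j, F i j = F j i) (hdiag : ∀ i, F i i = 0) :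
    ∑ i, ∑ j, F i j = 2 • ∑ p : {p : Fin N × Fin N // p.1 < p.2}, F p.1.1 p.1.2 := by
  rw [← Finset.sum_product', Finset.univ_product_univ]
  have h1 : ∀ p : Fin N × Fin N, F p.1 p.2 =
      (if p.1 < p.2 then F p.1 p.2 else 0) + (if p.2 < p.1 then F p.1 p.2 else 0) := fun p => by
    rcases lt_trichotomy p.1 p.2 with hp | hp | hp
    · simp [hp, hp.not_gt]
    · simp [hp, hdiag]
    · simp [hp, hp.not_gt]
  have h2 : ∑ p : Fin N × Fin N, (if p.2 < p.1 then F p.1 p.2 else 0) =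
      ∑ p : Fin N × Fin N, (if p.1 < p.2 then F p.1 p.2 else 0) :=
    Fintype.sum_equiv (Equiv.prodComm (Fin N) (Fin N)) _ _ fun p => by
      simp only [Equiv.prodComm_apply, Prod.fst_swap, Prod.snd_swap]
      rw [hsymm]
      rfl
  rw [Finset.sum_congr rfl fun p _ => h1 p, Finset.sum_add_distrib, h2, two_nsmul,
    ← Finset.sum_filter, Finset.sum_subtype (p := fun p : Fin N × Fin N => p.1 < p.2)
      (F := inferInstance) _ (by simp)]

/-- Ordered pairs are sorted by how many of their indices lie in the range of `f`: pairs with none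
vanish, and pairs with exactly one occur twice by symmetry. -/
theorem sum_sum_split {M : Type*} [AddCommMonoid M] {N k : ℕ} (F : Fin N → Fin N → M)
    (hsymm : ∀ i j, F i j = F j i) (f : Fin k ↪ Fin N)
    (h0 : ∀ i j, i ∉ Set.range f → j ∉ Set.range f → F i j = 0) :
    ∑ i, ∑ j, F i j = ∑ a, ∑ c, F (f a) (f c) +
      2 • ∑ j ∈ (Finset.univ.map f)ᶜ, ∑ a, F (f a) j := by
  have hs : ∀ G : Fin N → M, ∑ i, G i = ∑ a, G (f a) + ∑ j ∈ (Finset.univ.map f)ᶜ, G j :=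
    fun G => by
      rw [← Finset.sum_map Finset.univ f G]
      exact (Finset.sum_add_sum_compl _ _).symm
  have hn : ∀ j ∈ (Finset.univ.map f)ᶜ, j ∉ Set.range f := fun j hj => by
    simpa using hj
  have h1 : ∑ i, ∑ j, F i j = ∑ a, ∑ c, F (f a) (f c) +
      ∑ a, ∑ j ∈ (Finset.univ.map f)ᶜ, F (f a) j +
      ∑ j ∈ (Finset.univ.map f)ᶜ, ∑ a, F (f a) j := by
    rw [hs, Finset.sum_congr rfl fun a _ => hs (F (f a)), Finset.sum_add_distrib]
    congr 1
    refine Finset.sum_congr rfl fun j hj => ?_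
    rw [hs, Finset.sum_eq_zero fun i hi => h0 j i (hn j hj) (hn i hi), add_zero]
    exact Finset.sum_congr rfl fun a _ => hsymm _ _
  rw [h1, Finset.sum_comm (s := Finset.univ) (t := (Finset.univ.map f)ᶜ), two_nsmul, add_assoc]

/-! ### The Kac generator and its semigroup. -/

namespace CollisionSpec

variable {H : Type*} [NormedAddCommGroup H] [InnerProductSpace ℂ H] {ι : Type*}
  {b : HilbertBasis ι ℂ H} {h : H →ₗ.[ℂ] H}
  {C : Type*} [MetricSpace C] [CompactSpace C] [MeasurableSpace C] [BorelSpace C]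
  (S : CollisionSpec b h C) {N : ℕ}

/-- The generator `Q_{i,j} - 1` of the collisions of the particles `i` and `j`. -/
def pairGen (i j : Fin N) : NOp ι N →L[ℂ] NOp ι N :=
  -- The value `0` on the diagonal lets double sums run over all pairs of indices.
  if hij : i ≠ j then S.QPair hij - 1 else 0

theorem pairGen_of_ne {i j : Fin N} (hij : i ≠ j) : S.pairGen i j = S.QPair hij - 1 := dif_pos hij

theorem pairGen_self (i : Fin N) : S.pairGen i i = 0 := dif_neg (by simp)

theorem pairGen_symm (i j : Fin N) : S.pairGen i j = S.pairGen j i := by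
  by_cases hij : i = j
  · rw [hij]
  · rw [pairGen_of_ne S hij, pairGen_of_ne S (Ne.symm hij), QPair_symm]

theorem norm_pairGen_apply_le (i j : Fin N) (A : NOp ι N) : ‖S.pairGen i j A‖ ≤ 2 * ‖A‖ := by
  by_cases hij : i = j
  · subst hij
    simp [pairGen_self]
  · rw [pairGen_of_ne S hij]
    refine (norm_sub_le _ _).trans ?_
    rw [two_mul]
    exact add_le_add (S.norm_QPair_apply_le hij A) le_rfl

theorem pairGen_embed {M : ℕ} (f : Fin M ↪ Fin N) (i j : Fin M) (A : NOp ι M) :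
    S.pairGen (f i) (f j) (embed f A) = embed f (S.pairGen i j A) := by
  by_cases hij : i = j
  · subst hij
    simp [pairGen_self]
  · have hf : f i ≠ f j := fun he => hij (f.injective he)
    rw [pairGen_of_ne S hij, pairGen_of_ne S hf]
    simp [S.QPair_embed f hij hf]

theorem UPair_comm_embed {M : ℕ} (g : Fin M ↪ Fin N) {i j : Fin N} (hij : i ≠ j)
    (hi : i ∉ Set.range g) (hj : j ∉ Set.range g) (B : NOp ι M) (σ : C) :
    S.UPair hij σ * embed g B = embed g B * S.UPair hij σ := by
  rw [UPair_eq]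
  refine embed_comm (fun v u he => ?_) _ _
  fin_cases v
  · exact hi ⟨u, he.symm⟩
  · exact hj ⟨u, he.symm⟩

theorem pairGen_mul_embed {M : ℕ} (g : Fin M ↪ Fin N) {i j : Fin N} (hi : i ∉ Set.range g)
    (hj : j ∉ Set.range g) (A : NOp ι N) (B : NOp ι M) :
    S.pairGen i j (A * embed g B) = S.pairGen i j A * embed g B := by
  by_cases hij : i = j
  · subst hij
    simp [pairGen_self]
  · rw [pairGen_of_ne S hij]
    simp [S.QPair_mul_of_commute hij (S.UPair_comm_embed g hij hi hj B), sub_mul]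

theorem pairGen_one (i j : Fin N) : S.pairGen i j 1 = 0 := by
  by_cases hij : i = j
  · subst hij
    simp [pairGen_self]
  · rw [pairGen_of_ne S hij]
    simp [S.QPair_apply_of_commute hij (A := 1) (by simp)]

theorem pairGen_embed_eq_zero {M : ℕ} (g : Fin M ↪ Fin N) {i j : Fin N} (hi : i ∉ Set.range g)
    (hj : j ∉ Set.range g) (B : NOp ι M) : S.pairGen i j (embed g B) = 0 := by
  have h1 := S.pairGen_mul_embed g hi hj 1 B
  rwa [pairGen_one, zero_mul, one_mul] at h1

/-- The prefactor `N / (N choose 2)` equals `2 / (N - 1)`, and the `2` is absorbed by counting every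
pair in both orders. -/
theorem generator_eq (hN : 2 ≤ N) :
    S.generator N = ((N : ℂ) - 1)⁻¹ • ∑ i, ∑ j, S.pairGen i j := by
  have hN1 : ((N : ℂ) - 1) ≠ 0 := by
    rw [sub_ne_zero]
    exact_mod_cast (by omega : N ≠ 1)
  have hN0 : (N : ℂ) ≠ 0 := by exact_mod_cast (by omega : N ≠ 0)
  -- The number of pairs `i < j` comes from `sum_pairs_eq` applied to the indicator of `i ≠ j`.
  have hcard : (2 : ℂ) * Fintype.card {p : Fin N × Fin N // p.1 < p.2} = N * (N - 1) := by
    have h1 := sum_pairs_eq (M := ℂ) (N := N) (fun i j => if i = j then 0 else 1)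
      (fun i j => by simp only [eq_comm]) (fun i => by simp)
    have h2 : ∀ p : {p : Fin N × Fin N // p.1 < p.2},
        (if p.1.1 = p.1.2 then (0 : ℂ) else 1) = 1 := fun p => if_neg p.2.ne
    have h3 : ∀ i : Fin N, ∑ j, (if i = j then (0 : ℂ) else 1) = N - 1 := fun i => by
      have h4 : ∀ j, (if i = j then (0 : ℂ) else 1) = 1 - if i = j then 1 else 0 := fun j => by
        split_ifs <;> simp
      simp [h4, Finset.sum_sub_distrib]
    simp only [h2, h3] at h1
    simpa [mul_sub] using h1.symm
  have hK : ∀ p : {p : Fin N × Fin N // p.1 < p.2},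
      S.pairGen p.1.1 p.1.2 = S.QPair p.2.ne - 1 := fun p => S.pairGen_of_ne p.2.ne
  rw [generator, QN, sum_pairs_eq _ S.pairGen_symm S.pairGen_self,
    Finset.sum_congr rfl fun p _ => hK p, Finset.sum_sub_distrib, Finset.sum_const,
    Finset.card_univ, Nat.cast_choose_two, ← Nat.cast_smul_eq_nsmul ℂ 2,
    ← Nat.cast_smul_eq_nsmul ℂ (Fintype.card _), smul_sub, smul_sub, smul_sub, smul_smul,
    smul_smul, smul_smul, smul_smul]
  congr 2
  · push_cast; field_simp
  · push_cast
    rw [mul_assoc, hcard]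
    field_simp

theorem embed_perm_generator (hN : 2 ≤ N) (π : Equiv.Perm (Fin N)) (A : NOp ι N) :
    S.generator N (embed π.toEmbedding A) = embed π.toEmbedding (S.generator N A) := by
  have h1 : ∀ i j, S.pairGen (π i) (π j) (embed π.toEmbedding A) =
      embed π.toEmbedding (S.pairGen i j A) := fun i j =>
    S.pairGen_embed π.toEmbedding i j A
  rw [generator_eq S hN]
  simp only [_root_.smul_apply, sum_apply, map_smul, map_sum, ← h1]
  congr 1
  rw [← Equiv.sum_comp π]
  exact Finset.sum_congr rfl fun i _ => (Equiv.sum_comp π _).symm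

theorem generator_one (hN : 2 ≤ N) : S.generator N 1 = 0 := by
  rw [generator_eq S hN]
  simp [pairGen_one]

theorem hasSum_semigroup_apply (t : ℝ) (A : NOp ι N) :
    HasSum (fun n : ℕ => ((t : ℂ) ^ n / (n.factorial : ℂ)) • (S.generator N ^ n) A)
      (S.semigroup N t A) := by
  refine (hasSum_exp_apply _ A).congr_fun fun n => ?_
  rw [smul_pow, _root_.smul_apply, smul_smul, div_eq_inv_mul]

theorem hasSum_comp_semigroup (t : ℝ) (ω : OpDual (L2 (Fin N → ι))) :
    HasSum (fun n : ℕ => ((t : ℂ) ^ n / (n.factorial : ℂ)) • (ω ∘L (S.generator N ^ n)))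
      (ω ∘L S.semigroup N t) := by
  have h1 := (NormedSpace.exp_series_hasSum_exp' (𝕂 := ℂ) ((t : ℂ) • S.generator N)).mapL
    (ContinuousLinearMap.compL ℂ (NOp ι N) (NOp ι N) ℂ ω)
  refine h1.congr_fun fun n => ?_
  rw [smul_pow, smul_smul, map_smul, div_eq_inv_mul]
  rfl

theorem semigroup_one (hN : 2 ≤ N) (t : ℝ) : S.semigroup N t 1 = 1 := by
  refine (S.hasSum_semigroup_apply t 1).unique ?_
  have h1 : ∀ n : ℕ, n ≠ 0 → ((t : ℂ) ^ n / (n.factorial : ℂ)) • (S.generator N ^ n) 1 = 0 :=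
    fun n hn => by
      obtain ⟨m, rfl⟩ := Nat.exists_eq_succ_of_ne_zero hn
      rw [Nat.succ_eq_add_one, pow_succ (S.generator N), mul_apply_eq_comp, generator_one S hN, map_zero, smul_zero]
  simpa using hasSum_single 0 h1

theorem semigroup_add (s t : ℝ) (A : NOp ι N) :
    S.semigroup N (s + t) A = S.semigroup N s (S.semigroup N t A) := by
  rw [semigroup, Complex.ofReal_add, exp_smul_add]
  rfl

theorem semigroup_zero (A : NOp ι N) : S.semigroup N 0 A = A := by
  rw [semigroup, Complex.ofReal_zero, zero_smul, NormedSpace.exp_zero]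
  rfl

theorem embed_perm_semigroup (hN : 2 ≤ N) (π : Equiv.Perm (Fin N)) (t : ℝ) (A : NOp ι N) :
    S.semigroup N t (embed π.toEmbedding A) = embed π.toEmbedding (S.semigroup N t A) := by
  have h1 : Commute (embed π.toEmbedding : NOp ι N →L[ℂ] NOp ι N) ((t : ℂ) • S.generator N) := by
    refine Commute.smul_right ?_ _
    ext1 A
    exact (S.embed_perm_generator hN π A).symm
  exact (congrArg (fun T : NOp ι N →L[ℂ] NOp ι N => T A) h1.exp_right.eq).symm

theorem dens_comp_generator (ω : OpDual (L2 (Fin N → ι))) :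
    dens (ω ∘L S.generator N) = S.generator N (dens ω) := by
  have h1 : ω ∘L S.generator N = (N : ℂ) • ((N.choose 2 : ℂ)⁻¹ •
      (∑ p : {p : Fin N × Fin N // p.1 < p.2}, ω ∘L S.QPair p.2.ne) - ω) := by
    ext A
    simp [generator, QN]
  rw [h1, map_smul, map_sub, map_smul, map_sum]
  simp only [dens_comp_QPair]
  simp [generator, QN]

theorem dens_comp_generator_pow (ω : OpDual (L2 (Fin N → ι))) (n : ℕ) :
    dens (ω ∘L (S.generator N ^ n)) = (S.generator N ^ n) (dens ω) := by
  induction n generalizing ω with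
  | zero => rfl
  | succ n ih =>
    rw [pow_succ', mul_apply_eq_comp, ← ih, ← dens_comp_generator, ← pow_succ', pow_succ]
    rfl

/-- Duality of the semigroup. -/
theorem dens_comp_semigroup (ω : OpDual (L2 (Fin N → ι))) (t : ℝ) :
    dens (ω ∘L S.semigroup N t) = S.semigroup N t (dens ω) := by
  refine ((S.hasSum_comp_semigroup t ω).mapL (dens (E := L2 (Fin N → ι)))).unique
    ((S.hasSum_semigroup_apply t (dens ω)).congr_fun fun n => ?_)
  rw [map_smul, dens_comp_generator_pow]

theorem comp_generator_mem_normal {ω : OpDual (L2 (Fin N → ι))}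
    (hω : ω ∈ normal (L2 (Fin N → ι))) : ω ∘L S.generator N ∈ normal (L2 (Fin N → ι)) := by
  have h1 : ω ∘L S.generator N = (N : ℂ) • ((N.choose 2 : ℂ)⁻¹ •
      (∑ p : {p : Fin N × Fin N // p.1 < p.2}, ω ∘L S.QPair p.2.ne) - ω) := by
    ext A
    simp [generator, QN]
  rw [h1]
  exact Submodule.smul_mem _ _ (Submodule.sub_mem _ (Submodule.smul_mem _ _
    (Submodule.sum_mem _ fun p _ => S.comp_QPair_mem_normal p.2.ne hω)) hω)

theorem comp_generator_pow_mem_normal {ω : OpDual (L2 (Fin N → ι))}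
    (hω : ω ∈ normal (L2 (Fin N → ι))) (n : ℕ) :
    ω ∘L (S.generator N ^ n) ∈ normal (L2 (Fin N → ι)) := by
  induction n with
  | zero => exact hω
  | succ n ih => rw [pow_succ]; exact S.comp_generator_mem_normal ih

theorem comp_semigroup_mem_normal {ω : OpDual (L2 (Fin N → ι))}
    (hω : ω ∈ normal (L2 (Fin N → ι))) (t : ℝ) :
    ω ∘L S.semigroup N t ∈ normal (L2 (Fin N → ι)) :=
  hasSum_mem_normal (S.hasSum_comp_semigroup t ω) fun n =>
    Submodule.smul_mem _ _ (S.comp_generator_pow_mem_normal hω n)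

theorem isPositive_QN {A : NOp ι N} (hA : A.IsPositive) : (S.QN N A).IsPositive := by
  have h1 : S.QN N A = (((N.choose 2 : ℝ)⁻¹ : ℝ) : ℂ) •
      ∑ p : {p : Fin N × Fin N // p.1 < p.2}, S.QPair p.2.ne A := by
    simp [QN]
  rw [h1]
  refine isPositive_smul ?_ (by positivity)
  exact ContinuousLinearMap.isPositive_sum _ fun p _ => S.isPositive_QPair p.2.ne hA

/-- The semigroup equals `e^{-tN} exp (tN Q_N)`. As `Q_N` preserves positivity, all terms of the
series are positive, and the positive cone is closed. -/
theorem isPositive_semigroup {A : NOp ι N} (hA : A.IsPositive) {t : ℝ} (ht : 0 ≤ t) :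
    (S.semigroup N t A).IsPositive := by
  have h1 : S.semigroup N t A = ((Real.exp (-(t * N)) : ℝ) : ℂ) •
      NormedSpace.exp (((t * N : ℝ) : ℂ) • S.QN N) A := by
    rw [semigroup, generator, smul_smul, exp_smul_sub_one]
    simp
  have h2 : ∀ n : ℕ, ((S.QN N ^ n) A).IsPositive := fun n => by
    induction n with
    | zero => exact hA
    | succ n ih => rw [pow_succ', mul_apply_eq_comp]; exact S.isPositive_QN ih
  rw [h1]
  refine isPositive_smul ?_ (Real.exp_pos _).le
  refine isClosed_isPositive.mem_of_tendsto (hasSum_exp_apply _ A) (Eventually.of_forall fun s => ?_)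
  refine ContinuousLinearMap.isPositive_sum _ fun n _ => ?_
  have h3 : ((n.factorial : ℂ)⁻¹) • ((((t * N : ℝ) : ℂ) • S.QN N) ^ n) A =
      (((n.factorial : ℝ)⁻¹ * (t * N) ^ n : ℝ) : ℂ) • (S.QN N ^ n) A := by
    rw [smul_pow, _root_.smul_apply, smul_smul]
    push_cast
    rfl
  rw [h3]
  exact isPositive_smul (h2 n) (by positivity)

end CollisionSpec

/-! ### Marginals of symmetric functionals. -/

section Reduced

variable {ι : Type*}

/-- The `k`-particle marginal of a functional on the `N`-particle operators. -/
def reduced (k : ℕ) {N : ℕ} (ω : OpDual (L2 (Fin N → ι))) : OpDual (L2 (Fin k → ι)) :=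
  -- The value `0` for `k > N` is harmless: only `N → ∞` with fixed `k` matters, and norm bounds
  -- hold trivially there.
  if h : k ≤ N then ω ∘L embed (Fin.castLEEmb h) else 0

theorem reduced_of_le {k N : ℕ} (h : k ≤ N) (ω : OpDual (L2 (Fin N → ι))) :
    reduced k ω = ω ∘L embed (Fin.castLEEmb h) := dif_pos h

theorem norm_comp_embed_le {V W : Type*} (f : V ↪ W) (ω : OpDual (L2 (W → ι))) :
    ‖ω ∘L embed f‖ ≤ ‖ω‖ := by
  refine (ContinuousLinearMap.opNorm_comp_le _ _).trans ?_
  exact mul_le_of_le_one_right (norm_nonneg _) (norm_embed_le f)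

theorem norm_reduced_le (k : ℕ) {N : ℕ} (ω : OpDual (L2 (Fin N → ι))) :
    ‖reduced k ω‖ ≤ ‖ω‖ := by
  by_cases h : k ≤ N
  · rw [reduced_of_le h]; exact norm_comp_embed_le _ _
  · rw [reduced, dif_neg h, norm_zero]; exact norm_nonneg _

theorem reduced_mem_normal (k : ℕ) {N : ℕ} {ω : OpDual (L2 (Fin N → ι))}
    (hω : ω ∈ normal (L2 (Fin N → ι))) : reduced k ω ∈ normal (L2 (Fin k → ι)) := by
  by_cases h : k ≤ N
  · rw [reduced_of_le h]; exact comp_embed_mem_normal _ hω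
  · rw [reduced, dif_neg h]; exact Submodule.zero_mem _

/-- Permutation invariant functionals. -/
def IsSymmFun {N : ℕ} (ω : OpDual (L2 (Fin N → ι))) : Prop :=
  ∀ π : Equiv.Perm (Fin N), ω ∘L embed π.toEmbedding = ω

/-- A bijection between the two ranges extends to a permutation of the finite set. Hence a symmetric
functional cannot tell which `k` particles it is restricted to. -/
theorem exists_perm_trans_eq {k N : ℕ} (f g : Fin k ↪ Fin N) :
    ∃ π : Equiv.Perm (Fin N), g.trans π.toEmbedding = f := by
  classical
  let e : {x // x ∈ Set.range g} ≃ {x // x ∈ Set.range f} :=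
    (Equiv.ofInjective g g.injective).symm.trans (Equiv.ofInjective f f.injective)
  refine ⟨e.extendSubtype, ?_⟩
  ext1 v
  change e.extendSubtype (g v) = f v
  rw [e.extendSubtype_apply_of_mem _ ⟨v, rfl⟩]
  change ((Equiv.ofInjective f f.injective)
    ((Equiv.ofInjective g g.injective).symm (Equiv.ofInjective g g.injective v)) : Fin N) = f v
  rw [Equiv.symm_apply_apply]
  rfl

theorem IsSymmFun.comp_embed_eq {k N : ℕ} {ω : OpDual (L2 (Fin N → ι))} (hω : IsSymmFun ω)
    (f g : Fin k ↪ Fin N) : ω ∘L embed f = ω ∘L embed g := by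
  obtain ⟨π, rfl⟩ := exists_perm_trans_eq f g
  ext A
  change ω (embed _ A) = ω (embed g A)
  rw [embed_trans]
  exact congrArg (fun η : OpDual (L2 (Fin N → ι)) => η (embed g A)) (hω π)

theorem IsSymmFun.comp_embed {k N : ℕ} {ω : OpDual (L2 (Fin N → ι))} (hω : IsSymmFun ω)
    (f : Fin k ↪ Fin N) : ω ∘L embed f = reduced k ω := by
  have hk : k ≤ N := by simpa using Fintype.card_le_of_embedding f
  rw [reduced_of_le hk]
  exact hω.comp_embed_eq _ _

theorem IsSymmFun.reduced_comp_embed {k n N : ℕ} {ω : OpDual (L2 (Fin N → ι))}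
    (hω : IsSymmFun ω) (hn : n ≤ N) (f : Fin k ↪ Fin n) :
    reduced n ω ∘L embed f = reduced k ω := by
  rw [reduced_of_le hn, ← hω.comp_embed (f.trans (Fin.castLEEmb hn))]
  ext A
  exact congrArg ω (embed_trans _ _ _).symm

end Reduced

theorem ascFactorial_le_succ (k j : ℕ) : k.ascFactorial j ≤ (k + 1).ascFactorial j := by
  induction j with
  | zero => simp
  | succ j ih =>
    rw [Nat.ascFactorial_succ, Nat.ascFactorial_succ]
    exact Nat.mul_le_mul (by omega) ih

theorem tendsto_inv_sub_one : Tendsto (fun N : ℕ => ((N : ℂ) - 1)⁻¹) atTop (𝓝 0) := by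
  refine tendsto_inv₀_cobounded.comp ?_
  rw [← tendsto_norm_atTop_iff_cobounded]
  refine tendsto_atTop_mono (fun N => ?_)
    (tendsto_atTop_add_const_right atTop (-1 : ℝ) tendsto_natCast_atTop_atTop)
  have := norm_sub_norm_le (N : ℂ) 1
  simp at this
  linarith

/-- The limiting weight of the mixed collisions; for large `N` the quotient is `2 + (2 - 2 k) / (N -
1)`. -/
theorem tendsto_two_mul_sub_div (k : ℕ) :
    Tendsto (fun N : ℕ => ((N : ℂ) - 1)⁻¹ * (2 * ((N - k : ℕ) : ℂ))) atTop (𝓝 2) := by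
  have h2 : Tendsto (fun N : ℕ => 2 + ((N : ℂ) - 1)⁻¹ * (2 - 2 * k)) atTop
      (𝓝 (2 + 0 * (2 - 2 * k))) :=
    tendsto_const_nhds.add (tendsto_inv_sub_one.mul tendsto_const_nhds)
  rw [zero_mul, add_zero] at h2
  refine h2.congr' ?_
  filter_upwards [eventually_ge_atTop (max 2 k)] with N hN
  have hN1 : ((N : ℂ) - 1) ≠ 0 := by
    rw [sub_ne_zero]
    exact_mod_cast (by omega : N ≠ 1)
  rw [Nat.cast_sub (by omega)]
  field_simp
  ring

/-! ### The BBGKY hierarchy, uniform bounds and the limiting hierarchy. -/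

namespace CollisionSpec

variable {H : Type*} [NormedAddCommGroup H] [InnerProductSpace ℂ H] {ι : Type*}
  {b : HilbertBasis ι ℂ H} {h : H →ₗ.[ℂ] H}
  {C : Type*} [MetricSpace C] [CompactSpace C] [MeasurableSpace C] [BorelSpace C]
  (S : CollisionSpec b h C) {N : ℕ}

theorem isSymmFun_comp_generator_pow (hN : 2 ≤ N) {ω : OpDual (L2 (Fin N → ι))}
    (hω : IsSymmFun ω) (n : ℕ) : IsSymmFun (ω ∘L (S.generator N ^ n)) := by
  induction n with
  | zero => exact hω
  | succ n ih =>
    intro π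
    ext A
    rw [pow_succ]
    change ω ((S.generator N ^ n) (S.generator N (embed π.toEmbedding A))) = _
    rw [embed_perm_generator S hN]
    exact congrArg (fun η : OpDual (L2 (Fin N → ι)) => η (S.generator N A)) (ih π)

/-- The collisions among `k` particles. -/
def innerGen (k : ℕ) : NOp ι k →L[ℂ] NOp ι k := ∑ a, ∑ c, S.pairGen a c

/-- The collisions of `k` particles with one further particle. -/
def outerGen (k : ℕ) : NOp ι k →L[ℂ] NOp ι (k + 1) :=
  ∑ a : Fin k, S.pairGen a.castSucc (Fin.last k) ∘L embed Fin.castSuccEmb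

theorem outerGen_apply (k : ℕ) (A : NOp ι k) :
    S.outerGen k A =
      ∑ a : Fin k, S.pairGen a.castSucc (Fin.last k) (embed Fin.castSuccEmb A) := by
  simp [outerGen]

theorem norm_innerGen_le (k : ℕ) : ‖S.innerGen k‖ ≤ 2 * (k : ℝ) ^ 2 := by
  refine ContinuousLinearMap.opNorm_le_bound _ (by positivity) fun A => ?_
  have h1 : S.innerGen k A = ∑ a, ∑ c, S.pairGen a c A := by simp [innerGen]
  rw [h1]
  refine (norm_sum_le_of_le _ fun a _ => norm_sum_le_of_le _ fun c _ =>
    S.norm_pairGen_apply_le a c A).trans (le_of_eq ?_)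
  simp
  ring

theorem norm_outerGen_le (k : ℕ) : ‖S.outerGen k‖ ≤ 2 * (k : ℝ) := by
  refine ContinuousLinearMap.opNorm_le_bound _ (by positivity) fun A => ?_
  rw [outerGen_apply]
  have h1 : ∀ a ∈ (Finset.univ : Finset (Fin k)),
      ‖S.pairGen a.castSucc (Fin.last k) (embed Fin.castSuccEmb A)‖ ≤ 2 * ‖A‖ := fun a _ =>
    (S.norm_pairGen_apply_le _ _ _).trans (by gcongr; exact norm_embed_apply_le _ A)
  refine (norm_sum_le_of_le _ h1).trans (le_of_eq ?_)
  simp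
  ring

/-- The extension of an embedding by a value outside of its range. -/
def _root_.QKac.snocEmb {k N : ℕ} (f : Fin k ↪ Fin N) (j : Fin N) (hj : j ∉ Set.range f) :
    Fin (k + 1) ↪ Fin N where
  toFun := Fin.snoc f j
  inj' := Fin.snoc_injective_iff.2 ⟨f.injective, hj⟩

/-- The BBGKY hierarchy. -/
theorem reduced_comp_generator (hN : 2 ≤ N) {k : ℕ} (hk : k ≤ N)
    {ω : OpDual (L2 (Fin N → ι))} (hω : IsSymmFun ω) :
    reduced k (ω ∘L S.generator N) = ((N : ℂ) - 1)⁻¹ •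
      (reduced k ω ∘L S.innerGen k +
        (2 * ((N - k : ℕ) : ℂ)) • (reduced (k + 1) ω ∘L S.outerGen k)) := by
  ext A
  set f : Fin k ↪ Fin N := Fin.castLEEmb hk with hf
  -- By symmetry all `N - k` particles outside the first `k` contribute equally, each acting as the
  -- last particle of a system of `k + 1`.
  have hout : ∀ j ∈ (Finset.univ.map f)ᶜ,
      ω (∑ a, S.pairGen (f a) j (embed f A)) = reduced (k + 1) ω (S.outerGen k A) := by
    intro j hj
    have hj' : j ∉ Set.range f := by simpa using hj
    have h1 : f = Fin.castSuccEmb.trans (snocEmb f j hj') := by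
      ext1 a
      exact (Fin.snoc_castSucc (α := fun _ => Fin N) j f a).symm
    have h2 : ∀ a, S.pairGen (f a) j (embed f A) = embed (snocEmb f j hj')
        (S.pairGen a.castSucc (Fin.last k) (embed Fin.castSuccEmb A)) := fun a => by
      rw [← pairGen_embed, ← embed_trans, ← h1]
      have h3 : snocEmb f j hj' a.castSucc = f a := Fin.snoc_castSucc (α := fun _ => Fin N) j f a
      have h4 : snocEmb f j hj' (Fin.last k) = j := Fin.snoc_last (α := fun _ => Fin N) j f
      rw [h3, h4]
    rw [Finset.sum_congr rfl fun a _ => h2 a, ← map_sum, ← outerGen_apply,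
      ← hω.comp_embed (snocEmb f j hj')]
    rfl
  have hin : ∑ a, ∑ c, S.pairGen (f a) (f c) (embed f A) = embed f (S.innerGen k A) := by
    simp [innerGen, pairGen_embed]
  have hcard : ((Finset.univ.map f)ᶜ).card = N - k := by
    rw [Finset.card_compl, Finset.card_map]; simp
  have hsplit := sum_sum_split (fun i j => S.pairGen i j (embed f A))
    (fun i j => by rw [pairGen_symm]) f
    fun i j hi hj => S.pairGen_embed_eq_zero f hi hj A
  have h1 : S.generator N (embed f A) =
      ((N : ℂ) - 1)⁻¹ • ∑ i, ∑ j, S.pairGen i j (embed f A) := by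
    rw [generator_eq S hN]; simp
  rw [reduced_of_le hk]
  change ω (S.generator N (embed f A)) = _
  rw [h1, hsplit, hin, map_smul, map_add, map_nsmul, map_sum, Finset.sum_congr rfl hout,
    Finset.sum_const, hcard, reduced_of_le hk]
  simp [mul_assoc, mul_add]
  exact Or.inl rfl

/-- The operator norm of the generator only yields powers of `N`; the hierarchy gives a bound
uniform in `N`. One step from level `k` to `k + 1` costs at most `(2 k² + 4 k (N - k)) / (N - 1) ≤ 8
k` for `N ≥ 2`, and `j` steps multiply to `8 ^ j k (k + 1) ⋯ (k + j - 1)`. -/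
theorem norm_reduced_comp_generator_pow_le (hN : 2 ≤ N) {ω : OpDual (L2 (Fin N → ι))}
    (hω : IsSymmFun ω) (h1 : ‖ω‖ ≤ 1) (j k : ℕ) :
    ‖reduced k (ω ∘L (S.generator N ^ j))‖ ≤ 8 ^ j * (k.ascFactorial j : ℝ) := by
  induction j generalizing k with
  | zero =>
    rw [pow_zero, pow_zero, Nat.ascFactorial_zero, Nat.cast_one, one_mul]
    exact (norm_reduced_le k ω).trans h1
  | succ j ih =>
    by_cases hk : k ≤ N
    · have hpow : ω ∘L (S.generator N ^ (j + 1)) =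
          (ω ∘L (S.generator N ^ j)) ∘L S.generator N := by rw [pow_succ]; rfl
      have hN1 : (0 : ℝ) < N - 1 := by
        have : (2 : ℝ) ≤ N := by exact_mod_cast hN
        linarith
      have hasc : (k : ℝ) * ((k + 1).ascFactorial j : ℝ) = (k.ascFactorial (j + 1) : ℝ) := by
        have := Nat.succ_ascFactorial k j
        rw [Nat.ascFactorial_succ, ← this]
        push_cast; rfl
      have hmono : (k.ascFactorial j : ℝ) ≤ ((k + 1).ascFactorial j : ℝ) := by
        exact_mod_cast ascFactorial_le_succ k j
      set a : ℝ := 8 ^ j * ((k + 1).ascFactorial j : ℝ) with ha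
      have ha0 : 0 ≤ a := by positivity
      have e1 := ih (k + 1)
      have e2 : ‖reduced k (ω ∘L (S.generator N ^ j))‖ ≤ a :=
        (ih k).trans (by rw [ha]; gcongr)
      rw [hpow, S.reduced_comp_generator hN hk (S.isSymmFun_comp_generator_pow hN hω j), norm_smul]
      have e3 : ‖((N : ℂ) - 1)⁻¹‖ = ((N : ℝ) - 1)⁻¹ := by
        rw [norm_inv, ← Complex.ofReal_natCast, ← Complex.ofReal_one, ← Complex.ofReal_sub,
          Complex.norm_real, Real.norm_eq_abs, abs_of_pos hN1]
      have e4 : ‖(2 * ((N - k : ℕ) : ℂ))‖ = 2 * ((N : ℝ) - k) := by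
        rw [norm_mul, Complex.norm_natCast, Nat.cast_sub hk]; simp
      have hk' : (k : ℝ) ≤ N := by exact_mod_cast hk
      have hk0 : (0 : ℝ) ≤ k := by positivity
      rw [e3]
      calc _ ≤ ((N : ℝ) - 1)⁻¹ * (a * (2 * (k : ℝ) ^ 2) + 2 * ((N : ℝ) - k) * (a * (2 * k))) := by
            gcongr
            refine (norm_add_le _ _).trans (add_le_add ?_ ?_)
            · refine (ContinuousLinearMap.opNorm_comp_le _ _).trans ?_
              gcongr
              exact S.norm_innerGen_le k
            · rw [norm_smul, e4]
              have : 0 ≤ (N : ℝ) - k := by linarith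
              gcongr
              refine (ContinuousLinearMap.opNorm_comp_le _ _).trans ?_
              gcongr
              exact S.norm_outerGen_le k
        _ ≤ ((N : ℝ) - 1)⁻¹ * (((N : ℝ) - 1) * (8 * (k * a))) := by
            gcongr
            have h2 : (2 : ℝ) ≤ N := by exact_mod_cast hN
            have h3 : 0 ≤ k * a := by positivity
            have h4 : a * (2 * (k : ℝ) ^ 2) + 2 * ((N : ℝ) - k) * (a * (2 * k)) =
              (k * a) * (4 * N - 2 * k) := by ring
            rw [h4]
            nlinarith
        _ = 8 ^ (j + 1) * (k.ascFactorial (j + 1) : ℝ) := by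
            rw [← hasc, ha]
            field_simp
            ring
    · rw [reduced, dif_neg hk, norm_zero]
      positivity

/-- The terms of the power series of the solution of the limiting hierarchy. -/
def limitTerm (τ : (k : ℕ) → OpDual (L2 (Fin k → ι))) : ℕ → (k : ℕ) → OpDual (L2 (Fin k → ι))
  | 0, k => τ k
  | j + 1, k => (2 : ℂ) • (limitTerm τ j (k + 1) ∘L S.outerGen k)

/-- In each step of the hierarchy the collisions among the `k` particles carry the factor `(N -
1)⁻¹` and disappear, while the mixed ones keep the limiting factor `2`. -/
theorem tendsto_reduced_comp_generator_pow {φ : (N : ℕ) → OpDual (L2 (Fin N → ι))}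
    {τ : (k : ℕ) → OpDual (L2 (Fin k → ι))} (hφ : ∀ N, 2 ≤ N → IsSymmFun (φ N))
    (hτ : ∀ k, 1 ≤ k → Tendsto (fun N => reduced k (φ N)) atTop (𝓝 (τ k))) (j k : ℕ)
    (hk : 1 ≤ k) :
    Tendsto (fun N => reduced k (φ N ∘L (S.generator N ^ j))) atTop (𝓝 (S.limitTerm τ j k)) := by
  induction j generalizing k with
  | zero => exact hτ k hk
  | succ j ih =>
    have c1 : Continuous fun ω : OpDual (L2 (Fin k → ι)) => ω ∘L S.innerGen k := by fun_prop
    have c2 : Continuous fun ω : OpDual (L2 (Fin (k + 1) → ι)) => ω ∘L S.outerGen k := by fun_prop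
    have t1 := tendsto_inv_sub_one.smul ((c1.tendsto _).comp (ih k hk))
    have t2 := (tendsto_two_mul_sub_div k).smul ((c2.tendsto _).comp (ih (k + 1) (by omega)))
    have t3 := t1.add t2
    rw [zero_smul, zero_add] at t3
    refine t3.congr' ?_
    filter_upwards [eventually_ge_atTop (max 2 k)] with N hN
    have hpow : φ N ∘L (S.generator N ^ (j + 1)) =
        (φ N ∘L (S.generator N ^ j)) ∘L S.generator N := by rw [pow_succ]; rfl
    rw [hpow, S.reduced_comp_generator (by omega) (by omega)
      (S.isSymmFun_comp_generator_pow (by omega) (hφ N (by omega)) j), smul_add, smul_smul]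
    rfl

end CollisionSpec

/-! ### Factorisation along the limiting hierarchy. -/

/-- A family of functionals that factorises on operators acting on different particles. -/
def IsProductFamily {ι : Type*} (τ : (k : ℕ) → OpDual (L2 (Fin k → ι))) : Prop :=
  -- The conditions `1 ≤ k` and `1 ≤ l` keep out the functional at level `0`, which chaoticity does
  -- not control.
  ∀ (k l n : ℕ) (f : Fin k ↪ Fin n) (g : Fin l ↪ Fin n), 1 ≤ k → 1 ≤ l → (∀ v u, f v ≠ g u) →
    ∀ A B, τ n (embed f A * embed g B) = τ k A * τ l B

/-- An embedding with one more particle. -/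
def succEmb {k n : ℕ} (f : Fin k ↪ Fin n) : Fin (k + 1) ↪ Fin (n + 1) :=
  snocEmb (f.trans Fin.castSuccEmb) (Fin.last n) (by
    rintro ⟨v, hv⟩
    exact (Fin.castSucc_lt_last (f v)).ne hv)

theorem succEmb_castSucc {k n : ℕ} (f : Fin k ↪ Fin n) (a : Fin k) :
    succEmb f a.castSucc = (f a).castSucc :=
  Fin.snoc_castSucc (α := fun _ => Fin (n + 1)) (Fin.last n) (f.trans Fin.castSuccEmb) a

theorem succEmb_last {k n : ℕ} (f : Fin k ↪ Fin n) : succEmb f (Fin.last k) = Fin.last n :=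
  Fin.snoc_last (α := fun _ => Fin (n + 1)) (Fin.last n) (f.trans Fin.castSuccEmb)

theorem castSuccEmb_trans_succEmb {k n : ℕ} (f : Fin k ↪ Fin n) :
    Fin.castSuccEmb.trans (succEmb f) = f.trans Fin.castSuccEmb := by
  ext1 a
  exact succEmb_castSucc f a

theorem succEmb_ne {k l n : ℕ} {f : Fin k ↪ Fin n} {g : Fin l ↪ Fin n} (hfg : ∀ v u, f v ≠ g u)
    (v : Fin (k + 1)) (u : Fin l) : succEmb f v ≠ g.trans Fin.castSuccEmb u := by
  refine Fin.lastCases ?_ (fun a => ?_) v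
  · rw [succEmb_last]
    exact (Fin.castSucc_lt_last (g u)).ne'
  · rw [succEmb_castSucc]
    exact fun he => hfg a u (Fin.castSucc_injective n he)

namespace CollisionSpec

variable {H : Type*} [NormedAddCommGroup H] [InnerProductSpace ℂ H] {ι : Type*}
  {b : HilbertBasis ι ℂ H} {h : H →ₗ.[ℂ] H}
  {C : Type*} [MetricSpace C] [CompactSpace C] [MeasurableSpace C] [BorelSpace C]
  (S : CollisionSpec b h C) {N : ℕ}

/-- Collisions of the new particle with particles carrying `A` do not touch `B`; this is one of the
two terms of the Leibniz rule. -/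
theorem sum_range_pairGen {k l n : ℕ} {f : Fin k ↪ Fin n} {g : Fin l ↪ Fin n}
    (hfg : ∀ v u, f v ≠ g u) (A : NOp ι k) (B : NOp ι l) :
    ∑ a, S.pairGen (f a).castSucc (Fin.last n) (embed Fin.castSuccEmb (embed f A * embed g B)) =
      embed (succEmb f) (S.outerGen k A) * embed (g.trans Fin.castSuccEmb) B := by
  rw [outerGen_apply, map_sum, Finset.sum_mul]
  refine Finset.sum_congr rfl fun a _ => ?_
  have hne := fun v u => succEmb_ne hfg v u
  have h1 : (f a).castSucc ∉ Set.range (g.trans Fin.castSuccEmb) := fun ⟨u, hu⟩ =>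
    hne a.castSucc u ((succEmb_castSucc f a).trans hu.symm)
  have h2 : Fin.last n ∉ Set.range (g.trans Fin.castSuccEmb) := fun ⟨u, hu⟩ =>
    hne (Fin.last k) u ((succEmb_last f).trans hu.symm)
  rw [embed_mul, ← embed_trans, ← embed_trans, pairGen_mul_embed S _ h1 h2, ← pairGen_embed,
    ← embed_trans, castSuccEmb_trans_succEmb, succEmb_castSucc, succEmb_last]

/-- The Leibniz rule for the creation of a further particle. -/
theorem outerGen_mul {k l n : ℕ} {f : Fin k ↪ Fin n} {g : Fin l ↪ Fin n}
    (hfg : ∀ v u, f v ≠ g u) (A : NOp ι k) (B : NOp ι l) :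
    S.outerGen n (embed f A * embed g B) =
      embed (succEmb f) (S.outerGen k A) * embed (g.trans Fin.castSuccEmb) B +
        embed (f.trans Fin.castSuccEmb) A * embed (succEmb g) (S.outerGen l B) := by
  have hgf : ∀ u v, g u ≠ f v := fun u v => (hfg v u).symm
  have h2 := S.sum_range_pairGen hgf B A
  rw [embed_comm hgf] at h2
  rw [← S.sum_range_pairGen hfg A B, embed_comm fun v u => (succEmb_ne hgf u v).symm, ← h2,
    outerGen_apply, ← Finset.sum_map Finset.univ f fun i : Fin n =>
      S.pairGen i.castSucc (Fin.last n) (embed Fin.castSuccEmb (embed f A * embed g B)),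
    ← Finset.sum_map Finset.univ g fun i : Fin n =>
      S.pairGen i.castSucc (Fin.last n) (embed Fin.castSuccEmb (embed f A * embed g B)),
    ← Finset.sum_union]
  -- Particles carrying neither `A` nor `B` contribute nothing, since their collision with the new
  -- particle leaves the observable unchanged.
  · refine (Finset.sum_subset (Finset.subset_univ _) fun i _ hi => ?_).symm
    simp only [Finset.mem_union, Finset.mem_map, Finset.mem_univ, true_and, not_or,
      not_exists] at hi
    have hr : ∀ {m : ℕ} (q : Fin m ↪ Fin n), (∀ x, ¬ q x = i) →
        i.castSucc ∉ Set.range (q.trans Fin.castSuccEmb) ∧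
          Fin.last n ∉ Set.range (q.trans Fin.castSuccEmb) := fun q hq =>
      ⟨fun ⟨u, hu⟩ => hq u (Fin.castSucc_injective n hu),
        fun ⟨u, hu⟩ => (Fin.castSucc_lt_last (q u)).ne hu⟩
    rw [embed_mul, ← embed_trans, ← embed_trans,
      pairGen_mul_embed S _ (hr g hi.2).1 (hr g hi.2).2,
      pairGen_embed_eq_zero S _ (hr f hi.1).1 (hr f hi.1).2, zero_mul]
  · rw [Finset.disjoint_left]
    intro i hi hi'
    obtain ⟨v, -, rfl⟩ := Finset.mem_map.1 hi
    obtain ⟨u, -, hu⟩ := Finset.mem_map.1 hi'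
    exact hgf u v hu

/-- Iterated Leibniz rule: each of the `j` new particles attaches to the cluster of `A` or to that
of `B`, which gives the binomial coefficients. The statement needs arbitrary disjoint `f` and `g`,
because new labels are appended last and interleave. -/
theorem limitTerm_mul {τ : (k : ℕ) → OpDual (L2 (Fin k → ι))} (hτ : IsProductFamily τ)
    (j k l n : ℕ) (f : Fin k ↪ Fin n) (g : Fin l ↪ Fin n) (hk : 1 ≤ k) (hl : 1 ≤ l)
    (hfg : ∀ v u, f v ≠ g u) (A : NOp ι k) (B : NOp ι l) :
    S.limitTerm τ j n (embed f A * embed g B) = ∑ p ∈ Finset.HasAntidiagonal.antidiagonal j,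
      (j.choose p.1 : ℂ) * (S.limitTerm τ p.1 k A * S.limitTerm τ p.2 l B) := by
  induction j generalizing k l n with
  | zero => simpa [limitTerm] using hτ k l n f g hk hl hfg A B
  | succ j ih =>
    have h1 := ih (k + 1) l (n + 1) (succEmb f) (g.trans Fin.castSuccEmb) (by omega) hl
      (succEmb_ne hfg) (S.outerGen k A) B
    have h2 := ih k (l + 1) (n + 1) (f.trans Fin.castSuccEmb) (succEmb g) hk (by omega)
      (fun v u => (succEmb_ne (fun u v => (hfg v u).symm) u v).symm) A (S.outerGen l B)
    have e1 : ∀ i q (D : NOp ι q), S.limitTerm τ (i + 1) q D =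
        2 * S.limitTerm τ i (q + 1) (S.outerGen q D) := fun i q D => rfl
    rw [Finset.sum_antidiagonal_choose_succ_mul
      (fun i i' => S.limitTerm τ i k A * S.limitTerm τ i' l B), e1, outerGen_mul S hfg, map_add, h1,
      h2, mul_add, Finset.mul_sum, Finset.mul_sum, add_comm]
    congr 1
    · refine Finset.sum_congr rfl fun p _ => ?_
      rw [e1]; ring
    · refine Finset.sum_congr rfl fun p hp => ?_
      rw [e1, ← Finset.HasAntidiagonal.mem_antidiagonal.1 hp, Nat.choose_symm_add]; ring

theorem norm_limitTerm_le {φ : (N : ℕ) → OpDual (L2 (Fin N → ι))}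
    {τ : (k : ℕ) → OpDual (L2 (Fin k → ι))} (hφ : ∀ N, 2 ≤ N → IsSymmFun (φ N))
    (hφ1 : ∀ N, 2 ≤ N → ‖φ N‖ ≤ 1)
    (hτ : ∀ k, 1 ≤ k → Tendsto (fun N => reduced k (φ N)) atTop (𝓝 (τ k))) (j k : ℕ)
    (hk : 1 ≤ k) : ‖S.limitTerm τ j k‖ ≤ 8 ^ j * (k.ascFactorial j : ℝ) := by
  refine le_of_tendsto (S.tendsto_reduced_comp_generator_pow hφ hτ j k hk).norm ?_
  filter_upwards [eventually_ge_atTop 2] with N hN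
  exact S.norm_reduced_comp_generator_pow_le hN (hφ N hN) (hφ1 N hN) j k

/-- The quotient is the binomial coefficient `(k + j - 1 choose j)`, at most a power of two. -/
theorem _root_.QKac.ascFactorial_div_factorial_le (k j : ℕ) (hk : 1 ≤ k) :
    (k.ascFactorial j : ℝ) / (j.factorial : ℝ) ≤ 2 ^ k * 2 ^ j := by
  rw [div_le_iff₀ (by positivity), Nat.ascFactorial_eq_factorial_mul_choose']
  rw [Nat.cast_mul, mul_comm (2 ^ k * 2 ^ j : ℝ)]
  gcongr
  rw [← pow_add]
  exact_mod_cast (Nat.choose_le_two_pow _ _).trans (Nat.pow_le_pow_right (by norm_num) (by omega))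

/-- The rate `16` is the `8` per hierarchy step times the `2` from the binomial coefficient; this
fixes the short time range `16 t < 1`. -/
theorem _root_.QKac.norm_term_le {F : Type*} [NormedAddCommGroup F] [NormedSpace ℂ F] (x : F)
    {t : ℝ} (ht : 0 ≤ t) (j k : ℕ) (hk : 1 ≤ k)
    (hx : ‖x‖ ≤ 8 ^ j * (k.ascFactorial j : ℝ)) :
    ‖((t : ℂ) ^ j / (j.factorial : ℂ)) • x‖ ≤ 2 ^ k * (16 * t) ^ j := by
  rw [norm_smul, norm_div, norm_pow, Complex.norm_real, Real.norm_eq_abs, abs_of_nonneg ht,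
    Complex.norm_natCast]
  calc t ^ j / j.factorial * ‖x‖ ≤ t ^ j / j.factorial * (8 ^ j * (k.ascFactorial j : ℝ)) := by
        gcongr
    _ = (8 * t) ^ j * ((k.ascFactorial j : ℝ) / (j.factorial : ℝ)) := by
        rw [mul_pow]; ring
    _ ≤ (8 * t) ^ j * (2 ^ k * 2 ^ j) := by
        gcongr; exact ascFactorial_div_factorial_le k j hk
    _ = 2 ^ k * (16 * t) ^ j := by
        rw [show 16 * t = 8 * t * 2 by ring, mul_pow _ 2]; ring

/-- The solution of the limiting hierarchy. -/
def limitFun (τ : (k : ℕ) → OpDual (L2 (Fin k → ι))) (t : ℝ) (k : ℕ) : OpDual (L2 (Fin k → ι)) :=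
  ∑' j : ℕ, ((t : ℂ) ^ j / (j.factorial : ℂ)) • S.limitTerm τ j k

/-- Dominated convergence for the exponential series: every term converges, with a geometric
majorant independent of `N`. -/
theorem tendsto_reduced_comp_semigroup {φ : (N : ℕ) → OpDual (L2 (Fin N → ι))}
    {τ : (k : ℕ) → OpDual (L2 (Fin k → ι))} (hφ : ∀ N, 2 ≤ N → IsSymmFun (φ N))
    (hφ1 : ∀ N, 2 ≤ N → ‖φ N‖ ≤ 1)
    (hτ : ∀ k, 1 ≤ k → Tendsto (fun N => reduced k (φ N)) atTop (𝓝 (τ k)))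
    {t : ℝ} (ht : 0 ≤ t) (ht' : 16 * t < 1) (k : ℕ) (hk : 1 ≤ k) :
    Tendsto (fun N => reduced k (φ N ∘L S.semigroup N t)) atTop (𝓝 (S.limitFun τ t k)) := by
  have hsum : Summable fun j : ℕ => (2 : ℝ) ^ k * (16 * t) ^ j :=
    (summable_geometric_of_lt_one (by positivity) ht').mul_left _
  have hbound : ∀ᶠ N in atTop, ∀ j : ℕ, ‖((t : ℂ) ^ j / (j.factorial : ℂ)) •
      reduced k (φ N ∘L (S.generator N ^ j))‖ ≤ 2 ^ k * (16 * t) ^ j := by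
    filter_upwards [eventually_ge_atTop 2] with N hN j
    exact norm_term_le _ ht j k hk
      (S.norm_reduced_comp_generator_pow_le hN (hφ N hN) (hφ1 N hN) j k)
  have hlim : ∀ j : ℕ, Tendsto (fun N => ((t : ℂ) ^ j / (j.factorial : ℂ)) •
      reduced k (φ N ∘L (S.generator N ^ j))) atTop
      (𝓝 (((t : ℂ) ^ j / (j.factorial : ℂ)) • S.limitTerm τ j k)) := fun j =>
    (S.tendsto_reduced_comp_generator_pow hφ hτ j k hk).const_smul _
  have h1 : Tendsto (fun N => ∑' j : ℕ, ((t : ℂ) ^ j / (j.factorial : ℂ)) •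
      reduced k (φ N ∘L (S.generator N ^ j))) atTop (𝓝 (S.limitFun τ t k)) :=
    tendsto_tsum_of_dominated_convergence hsum hlim hbound
  refine h1.congr' ?_
  filter_upwards [eventually_ge_atTop k] with N hN
  let P : OpDual (L2 (Fin N → ι)) →L[ℂ] OpDual (L2 (Fin k → ι)) :=
    (ContinuousLinearMap.compL ℂ (NOp ι k) (NOp ι N) ℂ).flip (embed (Fin.castLEEmb hN))
  have hP : ∀ ω, reduced k ω = P ω := reduced_of_le hN
  rw [hP, ← ((S.hasSum_comp_semigroup t (φ N)).mapL P).tsum_eq]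
  refine tsum_congr fun j => ?_
  rw [hP, map_smul]

/-- Divided by `j!`, the binomial convolution of the terms is the Cauchy product of two absolutely
convergent series. -/
theorem isProductFamily_limitFun {φ : (N : ℕ) → OpDual (L2 (Fin N → ι))}
    {τ : (k : ℕ) → OpDual (L2 (Fin k → ι))} (hφ : ∀ N, 2 ≤ N → IsSymmFun (φ N))
    (hφ1 : ∀ N, 2 ≤ N → ‖φ N‖ ≤ 1)
    (hτ : ∀ k, 1 ≤ k → Tendsto (fun N => reduced k (φ N)) atTop (𝓝 (τ k)))
    (hprod : IsProductFamily τ) {t : ℝ} (ht : 0 ≤ t) (ht' : 16 * t < 1) :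
    IsProductFamily (S.limitFun τ t) := by
  intro k l n f g hk hl hfg A B
  have hn : 1 ≤ n := hk.trans (by simpa using Fintype.card_le_of_embedding f)
  have hs : ∀ q, 1 ≤ q → Summable fun j : ℕ =>
      ((t : ℂ) ^ j / (j.factorial : ℂ)) • S.limitTerm τ j q := fun q hq =>
    Summable.of_norm_bounded ((summable_geometric_of_lt_one (by positivity) ht').mul_left (2 ^ q))
      fun j => norm_term_le _ ht j q hq (S.norm_limitTerm_le hφ hφ1 hτ j q hq)
  have hv : ∀ q (D : NOp ι q), 1 ≤ q → HasSum (fun j : ℕ =>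
      ((t : ℂ) ^ j / (j.factorial : ℂ)) * S.limitTerm τ j q D) (S.limitFun τ t q D) :=
    fun q D hq => (hs q hq).hasSum.mapL (ContinuousLinearMap.apply ℂ ℂ D)
  rw [← (hv n _ hn).tsum_eq, ← (hv k A hk).tsum_eq, ← (hv l B hl).tsum_eq,
    tsum_mul_tsum_eq_tsum_sum_antidiagonal_of_summable_norm (hv k A hk).summable.norm
      (hv l B hl).summable.norm]
  refine tsum_congr fun j => ?_
  rw [S.limitTerm_mul hprod j k l n f g hk hl hfg, Finset.mul_sum]
  refine Finset.sum_congr rfl fun p hp => ?_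
  obtain ⟨i, i'⟩ := p
  obtain rfl := Finset.HasAntidiagonal.mem_antidiagonal.1 hp
  have h1 : ((i + i').factorial : ℂ) = ((i + i').choose i : ℂ) * i.factorial * i'.factorial := by
    rw [Nat.choose_symm_add]
    exact_mod_cast (Nat.add_choose_mul_factorial_mul_factorial i i').symm
  have h2 : ((i + i').choose i : ℂ) ≠ 0 := by
    exact_mod_cast (Nat.choose_pos (Nat.le_add_right i i')).ne'
  have h3 : (i.factorial : ℂ) ≠ 0 := by exact_mod_cast i.factorial_ne_zero
  have h4 : (i'.factorial : ℂ) ≠ 0 := by exact_mod_cast i'.factorial_ne_zero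
  simp only [h1]
  field_simp
  ring

end CollisionSpec

/-! ### Symmetric density matrices as symmetric normal functionals. -/

section NormalLemmas

theorem dens_ext_basis {X : Type*} {A B : Op X}
    (h : ∀ α β, ⟪stdBasis X α, A (stdBasis X β)⟫_ℂ = ⟪stdBasis X α, B (stdBasis X β)⟫_ℂ) :
    A = B := op_ext_inner_basis (stdBasis X) h

theorem normal_ext_matUnit {X : Type*} {ω η : OpDual (L2 X)} (hω : ω ∈ normal (L2 X))
    (hη : η ∈ normal (L2 X)) (h : ∀ α β, ω (matUnit α β) = η (matUnit α β)) : ω = η :=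
  normal_ext hω hη <| dens_ext_basis fun α β => by
    rw [dens_apply_stdBasis, dens_apply_stdBasis, h]

theorem isSelfAdjoint_of_basis {X : Type*} {A : Op X}
    (h : ∀ α β, starRingEnd ℂ ⟪stdBasis X β, A (stdBasis X α)⟫_ℂ =
      ⟪stdBasis X α, A (stdBasis X β)⟫_ℂ) : IsSelfAdjoint A := by
  rw [ContinuousLinearMap.isSelfAdjoint_iff']
  refine dens_ext_basis fun α β => ?_
  rw [ContinuousLinearMap.adjoint_inner_right, ← h, inner_conj_symm]

variable {E : Type*} [NormedAddCommGroup E] [InnerProductSpace ℂ E] [CompleteSpace E]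

theorem comp_mulLeftRight_mem_normal (D D' : E →L[ℂ] E) {ω : OpDual E} (hω : ω ∈ normal E) :
    ω ∘L ContinuousLinearMap.mulLeftRight ℂ (E →L[ℂ] E) D D' ∈ normal E := by
  refine comp_mem_normal (fun x y => ?_) hω
  have : vecFun x y ∘L ContinuousLinearMap.mulLeftRight ℂ (E →L[ℂ] E) D D' =
      vecFun (D.adjoint x) (D' y) := by
    ext B
    change ⟪x, (D * B * D') y⟫_ℂ = _
    simp [ContinuousLinearMap.adjoint_inner_left]
  rw [this]
  exact vecFun_mem_normal _ _

variable {ι : Type*}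

theorem dens_comp_embed_perm {N : ℕ} (π : Equiv.Perm (Fin N)) (ω : OpDual (L2 (Fin N → ι))) :
    dens (ω ∘L embed π.symm.toEmbedding) = star (permOp ι π) * dens ω * permOp ι π := by
  refine op_ext fun x y => ?_
  rw [inner_dens, mul_apply_eq_comp, mul_apply_eq_comp, ContinuousLinearMap.star_eq_adjoint,
    ContinuousLinearMap.adjoint_inner_right, inner_dens]
  change ω (embed π.symm.toEmbedding (rankOne ℂ y x)) = _
  rw [← permOp_conj]
  refine congrArg ω (op_ext fun u v => ?_)
  simp [ContinuousLinearMap.star_eq_adjoint, ContinuousLinearMap.adjoint_inner_right]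

theorem permOp_mul_star {N : ℕ} (π : Equiv.Perm (Fin N)) : star (permOp ι π) * permOp ι π = 1 := by
  rw [ContinuousLinearMap.star_eq_adjoint, permOp, adjoint_reindex]
  ext x
  simp

theorem isPositive_dens_comp_tensorOneL {X Y : Type*} {ω : OpDual (L2 (X × Y))}
    (hω : ω ∈ normal (L2 (X × Y))) (hp : (dens ω).IsPositive) :
    (dens (ω ∘L tensorOneL X Y)).IsPositive := by
  refine isClosed_isPositive.mem_of_tendsto (hasSum_partialTrace hω)
    (Eventually.of_forall fun s => ?_)
  exact ContinuousLinearMap.isPositive_sum _ fun y _ => hp.conj_adjoint (slice X y)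

theorem isPositive_dens_comp_transportL {X Y : Type*} (e : X ≃ Y) {ω : OpDual (L2 X)}
    (hp : (dens ω).IsPositive) : (dens (ω ∘L transportL e)).IsPositive := by
  rw [dens_comp_transportL, transport, ← adjoint_reindex]
  exact hp.conj_adjoint _

theorem isPositive_dens_comp_embed {V W : Type*} (f : V ↪ W) {ω : OpDual (L2 (W → ι))}
    (hω : ω ∈ normal (L2 (W → ι))) (hp : (dens ω).IsPositive) :
    (dens (ω ∘L embed f)).IsPositive := by
  have h1 : ω ∘L embed f = (ω ∘L transportL (embSplit ι f)) ∘L tensorOneL _ _ :=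
    (ContinuousLinearMap.comp_assoc _ _ _).symm
  rw [h1]
  exact isPositive_dens_comp_tensorOneL (comp_transportL_mem_normal (embSplit ι f) hω)
    (isPositive_dens_comp_transportL (embSplit ι f) hp)

theorem isPositive_dens_reduced (k : ℕ) {N : ℕ} {ω : OpDual (L2 (Fin N → ι))}
    (hω : ω ∈ normal (L2 (Fin N → ι))) (hp : (dens ω).IsPositive) :
    (dens (reduced k ω)).IsPositive := by
  by_cases h : k ≤ N
  · rw [reduced_of_le h]
    exact isPositive_dens_comp_embed _ hω hp
  · rw [reduced, dif_neg h, map_zero]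
    exact ContinuousLinearMap.isPositive_zero

theorem marginal_dens_eq (k m : ℕ) {ω : OpDual (L2 (Fin (k + m) → ι))}
    (hω : ω ∈ normal (L2 (Fin (k + m) → ι))) :
    marginal k m (dens ω) = dens (reduced k ω) := by
  rw [marginal_dens k m hω, reduced_of_le (Nat.le_add_right k m)]
  rfl

/-- Normal functionals are determined by their densities, so the symmetry of `A` passes to `φ`; the
trace of `A` is the value of `φ` at `1`. -/
theorem exists_functional {N : ℕ} {A : NOp ι N} (hA : IsSymmDensityMatrix A) :
    ∃ φ ∈ normal (L2 (Fin N → ι)), dens φ = A ∧ ‖φ‖ ≤ 1 ∧ IsSymmFun φ ∧ φ 1 = 1 := by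
  obtain ⟨⟨hpos, htr⟩, hsymm⟩ := hA
  obtain ⟨φ, hφ, hd, hn⟩ := exists_normal_of_isPositive (stdBasis _) hpos
    (RCLike.hasSum_re ℂ htr)
  refine ⟨φ, hφ, hd, by simpa using hn, fun π => ?_, ?_⟩
  · refine normal_ext (comp_embed_mem_normal _ hφ) hφ ?_
    have h1 := dens_comp_embed_perm π.symm φ
    rw [Equiv.symm_symm] at h1
    rw [h1, hd]
    conv_lhs => rw [← hsymm π.symm]
    calc _ = (star (permOp ι π.symm) * permOp ι π.symm) * A *
          (star (permOp ι π.symm) * permOp ι π.symm) := by simp only [mul_assoc]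
      _ = A := by rw [permOp_mul_star, one_mul, mul_one]
  · have h2 := hasSum_trace_dens (stdBasis _) hφ
    rw [hd] at h2
    exact h2.unique htr

end NormalLemmas

/-! ### Chaotic sequences and product families. -/

section Initial

variable {H : Type*} [NormedAddCommGroup H] [InnerProductSpace ℂ H] [CompleteSpace H]
  {ι : Type*} {b : HilbertBasis ι ℂ H}

theorem isSelfAdjoint_tensorPow {ρ : H →L[ℂ] H} (hρ : IsSelfAdjoint ρ) (k : ℕ) :
    IsSelfAdjoint (tensorPow b ρ k) := by
  refine isSelfAdjoint_of_basis fun α β => ?_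
  rw [inner_tensorPow, inner_tensorPow, map_prod]
  refine Finset.prod_congr rfl fun i _ => ?_
  rw [inner_conj_symm, ← ContinuousLinearMap.adjoint_inner_right,
    ContinuousLinearMap.isSelfAdjoint_iff'.1 hρ]

/-- Trace norm convergence of the marginals of normal functionals to a selfadjoint operator. -/
theorem exists_normal_tendsto {k : ℕ} {φ : (N : ℕ) → OpDual (L2 (Fin N → ι))}
    (hφ : ∀ N, 2 ≤ N → φ N ∈ normal (L2 (Fin N → ι)))
    (hp : ∀ N, 2 ≤ N → (dens (φ N)).IsPositive) {R : NOp ι k} (hR : IsSelfAdjoint R)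
    (ht : Tendsto (fun m => traceNorm (stdBasis _) (marginal k m (dens (φ (k + m))) - R))
      atTop (𝓝 0)) :
    ∃ τ ∈ normal (L2 (Fin k → ι)), dens τ = R ∧
      Tendsto (fun N => reduced k (φ N)) atTop (𝓝 τ) := by
  have hfin : ∀ᶠ m in atTop, 2 ≤ k + m ∧
      traceNorm (stdBasis _) (marginal k m (dens (φ (k + m))) - R) ≠ ⊤ := by
    filter_upwards [eventually_ge_atTop 2, ht.eventually (gt_mem_nhds ENNReal.zero_lt_top)]
      with m hm hm'
    exact ⟨by omega, hm'.ne⟩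
  have hex : ∀ m, 2 ≤ k + m →
      traceNorm (stdBasis _) (marginal k m (dens (φ (k + m))) - R) ≠ ⊤ →
      ∃ ω ∈ normal (L2 (Fin k → ι)), dens ω = dens (reduced k (φ (k + m))) - R ∧
        ‖ω‖ ≤ (traceNorm (stdBasis _) (marginal k m (dens (φ (k + m))) - R)).toReal := by
    intro m hm h1
    rw [marginal_dens_eq k m (hφ _ hm)] at h1 ⊢
    exact exists_normal_of_traceNorm_ne_top _
      ((isPositive_dens_reduced k (hφ _ hm) (hp _ hm)).isSelfAdjoint.sub hR) h1
  -- That `R` is of trace class is not assumed. It follows from one index at which the trace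
  -- distance to a marginal is finite, and this index supplies `τ`.
  obtain ⟨m₀, hm₀, hm₀'⟩ := hfin.exists
  obtain ⟨ω₀, hω₀, hd₀, -⟩ := hex m₀ hm₀ hm₀'
  refine ⟨reduced k (φ (k + m₀)) - ω₀,
    Submodule.sub_mem _ (reduced_mem_normal k (hφ _ hm₀)) hω₀, by simp [hd₀], ?_⟩
  set τ := reduced k (φ (k + m₀)) - ω₀ with hτ
  have hτn : τ ∈ normal (L2 (Fin k → ι)) :=
    Submodule.sub_mem _ (reduced_mem_normal k (hφ _ hm₀)) hω₀
  have hτd : dens τ = R := by simp [hτ, hd₀]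
  have h1 : Tendsto (fun m => reduced k (φ (k + m))) atTop (𝓝 τ) := by
    rw [tendsto_iff_norm_sub_tendsto_zero]
    have h2 : Tendsto (fun m =>
        (traceNorm (stdBasis _) (marginal k m (dens (φ (k + m))) - R)).toReal) atTop (𝓝 0) := by
      have h3 := (ENNReal.tendsto_toReal ENNReal.zero_ne_top).comp ht
      rw [ENNReal.toReal_zero] at h3
      exact h3
    refine squeeze_zero' (Eventually.of_forall fun m => norm_nonneg _) ?_ h2
    filter_upwards [hfin] with m hm
    obtain ⟨ω, hω, hd, hn⟩ := hex m hm.1 hm.2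
    have h3 : reduced k (φ (k + m)) - τ = ω := by
      refine normal_ext (Submodule.sub_mem _ (reduced_mem_normal k (hφ _ hm.1)) hτn) hω ?_
      rw [map_sub, hτd, hd]
    rw [h3]
    exact hn
  refine (tendsto_add_atTop_iff_nat k).1 (h1.congr fun m => ?_)
  rw [Nat.add_comm]

omit [CompleteSpace H] in
/-- The limits of the marginals of a chaotic sequence factorise. -/
theorem isProductFamily_of_tensorPow {ρ : H →L[ℂ] H} {φ : (N : ℕ) → OpDual (L2 (Fin N → ι))}
    {τ : (k : ℕ) → OpDual (L2 (Fin k → ι))} (hφ : ∀ N, 2 ≤ N → IsSymmFun (φ N))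
    (hτ : ∀ k, 1 ≤ k → Tendsto (fun N => reduced k (φ N)) atTop (𝓝 (τ k)))
    (hτn : ∀ k, 1 ≤ k → τ k ∈ normal (L2 (Fin k → ι)))
    (hτd : ∀ k, 1 ≤ k → dens (τ k) = tensorPow b ρ k) : IsProductFamily τ := by
  intro k l n f g hk hl hfg A B
  -- The limits inherit from the symmetric `φ N` the consistency of marginals.
  have hcons : ∀ {q p : ℕ} (e : Fin q ↪ Fin p), 1 ≤ q → τ p ∘L embed e = τ q := by
    intro q p e hq
    have hqp : q ≤ p := by simpa using Fintype.card_le_of_embedding e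
    have c1 : Continuous fun ω : OpDual (L2 (Fin p → ι)) => ω ∘L embed e := by fun_prop
    refine tendsto_nhds_unique (((c1.tendsto _).comp (hτ p (hq.trans hqp))).congr' ?_) (hτ q hq)
    filter_upwards [eventually_ge_atTop (max 2 p)] with N hN
    exact (hφ N (by omega)).reduced_comp_embed (by omega) e
  -- Gluing `f` and `g` into one embedding of `k + l` labels reduces to adjacent blocks of
  -- particles.
  let e : Fin (k + l) ↪ Fin n := ⟨Fin.append f g, Fin.append_injective_iff.2
    ⟨f.injective, g.injective, fun v u => hfg v u⟩⟩
  have hf : f = (Fin.castAddEmb l).trans e := by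
    ext1 v; exact (Fin.append_left (f : Fin k → Fin n) g v).symm
  have hg : g = (Fin.natAddEmb k).trans e := by
    ext1 v; exact (Fin.append_right (f : Fin k → Fin n) g v).symm
  rw [hf, hg, embed_trans, embed_trans, ← embed_mul]
  have h0 : τ n (embed e (embed (Fin.castAddEmb l) A * embed (Fin.natAddEmb k) B)) =
      τ (k + l) (embed (Fin.castAddEmb l) A * embed (Fin.natAddEmb k) B) :=
    congrArg (fun ω : OpDual (L2 (Fin (k + l) → ι)) =>
      ω (embed (Fin.castAddEmb l) A * embed (Fin.natAddEmb k) B)) (hcons e (by omega))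
  rw [h0]
  have hu : ∀ (q : ℕ) (hq : 1 ≤ q) (α β : Fin q → ι),
      τ q (matUnit α β) = ∏ i, ⟪b (β i), ρ (b (α i))⟫_ℂ := fun q hq α β => by
    rw [← dens_apply_stdBasis, hτd q hq, inner_tensorPow]
  have hmu : ∀ (α β : Fin k → ι) (γ δ : Fin l → ι),
      τ (k + l) (embed (Fin.castAddEmb l) (matUnit α β) *
        embed (Fin.natAddEmb k) (matUnit γ δ)) = τ k (matUnit α β) * τ l (matUnit γ δ) := by
    intro α β γ δ
    rw [embed_matUnit_mul, hu _ (by omega), hu _ hk, hu _ hl, Fin.prod_univ_add]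
    simp
  have hn := hτn (k + l) (by omega)
  -- The identity on matrix units extends by normality in one factor at a time, first to all `A` and
  -- then to all `B`.
  have h1 : ∀ (A : NOp ι k) (γ δ : Fin l → ι),
      τ (k + l) (embed (Fin.castAddEmb l) A * embed (Fin.natAddEmb k) (matUnit γ δ)) =
        τ l (matUnit γ δ) * τ k A := fun A γ δ => by
    have h2 := normal_ext_matUnit (comp_embed_mem_normal (Fin.castAddEmb l)
      (comp_mulLeftRight_mem_normal 1 (embed (Fin.natAddEmb k) (matUnit γ δ)) hn))
      (Submodule.smul_mem _ (τ l (matUnit γ δ)) (hτn k hk)) fun α β => by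
        have := hmu α β γ δ
        simpa [mul_comm] using this
    simpa using congrArg (fun ω : OpDual (L2 (Fin k → ι)) => ω A) h2
  have h2 := normal_ext_matUnit (comp_embed_mem_normal (Fin.natAddEmb k)
      (comp_mulLeftRight_mem_normal (embed (Fin.castAddEmb l) A) 1 hn))
      (Submodule.smul_mem _ (τ k A) (hτn l hl)) fun γ δ => by
        have := h1 A γ δ
        simpa [mul_comm] using this
  simpa using congrArg (fun ω : OpDual (L2 (Fin l → ι)) => ω B) h2

omit [CompleteSpace H] in
/-- The `k`-particle density of a product family is a tensor power. -/
theorem dens_eq_tensorPow {τ : (k : ℕ) → OpDual (L2 (Fin k → ι))} (hτ : IsProductFamily τ)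
    {ρ : H →L[ℂ] H}
    (hρ : ∀ α β : Fin 1 → ι, ⟪b (β 0), ρ (b (α 0))⟫_ℂ = τ 1 (matUnit α β))
    (k : ℕ) (hk : 1 ≤ k) : dens (τ k) = tensorPow b ρ k := by
  have key : ∀ k, 1 ≤ k → ∀ α β : Fin k → ι,
      τ k (matUnit α β) = ∏ i, ⟪b (β i), ρ (b (α i))⟫_ℂ := by
    intro k hk
    induction k, hk using Nat.le_induction with
    | base =>
      intro α β
      rw [← hρ, Fin.prod_univ_one]
    | succ k hk ih =>
      intro α β
      have h1 := embed_matUnit_mul (l := 1) (fun i => α (Fin.castAdd 1 i))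
        (fun i => β (Fin.castAdd 1 i)) (fun i => α (Fin.natAdd k i)) (fun i => β (Fin.natAdd k i))
      rw [Fin.append_castAdd_natAdd, Fin.append_castAdd_natAdd] at h1
      rw [← h1, hτ k 1 (k + 1) (Fin.castAddEmb 1) (Fin.natAddEmb k) hk le_rfl
        (fun v u he => by
          have := congrArg Fin.val he
          simp at this
          omega), ih, ← hρ, Fin.prod_univ_add]
      simp
  refine dens_ext_basis fun α β => ?_
  rw [dens_apply_stdBasis, key k hk, inner_tensorPow]

end Initial

/-! ### Propagation of chaos, first for short and then for all times. -/

namespace CollisionSpec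

variable {H : Type*} [NormedAddCommGroup H] [InnerProductSpace ℂ H] [CompleteSpace H] {ι : Type*}
  {b : HilbertBasis ι ℂ H} {h : H →ₗ.[ℂ] H}
  {C : Type*} [MetricSpace C] [CompactSpace C] [MeasurableSpace C] [BorelSpace C]
  (S : CollisionSpec b h C)

-- By duality the trace is the value at `1` of the evolved functional, and the semigroup fixes `1`.
-- Symmetry holds because the generator commutes with relabelling.
omit [CompleteSpace H] in
theorem isSymmDensityMatrix_semigroup {N : ℕ} (hN : 2 ≤ N) {A : NOp ι N}
    (hA : IsSymmDensityMatrix A) {t : ℝ} (ht : 0 ≤ t) :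
    IsSymmDensityMatrix (S.semigroup N t A) := by
  obtain ⟨φ, hφ, hd, -, -, h1⟩ := exists_functional hA
  refine ⟨⟨S.isPositive_semigroup hA.1.1 ht, ?_⟩, fun π => ?_⟩
  · have h2 := hasSum_trace_dens (stdBasis _) (S.comp_semigroup_mem_normal hφ t)
    rw [dens_comp_semigroup, hd] at h2
    have h3 : (φ ∘L S.semigroup N t) 1 = 1 := by
      rw [ContinuousLinearMap.comp_apply, semigroup_one S hN, h1]
    rwa [h3] at h2
  · rw [permOp_conj, ← embed_perm_semigroup S hN, ← permOp_conj, hA.2 π]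

/-- The one-particle operator with a given matrix. -/
theorem _root_.QKac.exists_op_of_dens (b : HilbertBasis ι ℂ H)
    {ω : OpDual (L2 (Fin 1 → ι))}
    (hω : ω ∈ normal (L2 (Fin 1 → ι))) (hp : (dens ω).IsPositive) (h1 : ω 1 = 1) :
    ∃ ρ : H →L[ℂ] H, IsDensityMatrix b ρ ∧
      ∀ α β : Fin 1 → ι, ⟪b (β 0), ρ (b (α 0))⟫_ℂ = ω (matUnit α β) := by
  let e : ι ≃ (Fin 1 → ι) := (Equiv.funUnique (Fin 1) ι).symm
  have he : ∀ α : Fin 1 → ι, e (α 0) = α := fun α => (Equiv.funUnique (Fin 1) ι).symm_apply_apply α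
  -- `W` is the unitary from one-particle families to `H` that matches the basis vectors; the
  -- density is conjugated by it.
  let W : L2 (Fin 1 → ι) →L[ℂ] H := ((coords b).symm : L2 ι →L[ℂ] H) ∘L
    (reindex e : L2 (Fin 1 → ι) →L[ℂ] L2 ι)
  have hW : ∀ α, W (stdBasis _ α) = b (α 0) := fun α => by
    change (coords b).symm (reindex e (stdBasis _ α)) = _
    have h2 : reindex e (stdBasis (Fin 1 → ι) α) = stdBasis ι (α 0) := by
      rw [← he α, ← reindex_symm_stdBasis e, LinearIsometryEquiv.apply_symm_apply, he]
    rw [h2, coords_symm_stdBasis]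
  have hW' : ∀ α, W.adjoint (b (α 0)) = stdBasis _ α := fun α => by
    refine ext_inner_right ℂ fun x => ?_
    rw [ContinuousLinearMap.adjoint_inner_left, ← hW]
    change ⟪(coords b).symm (reindex e _), (coords b).symm (reindex e _)⟫_ℂ = _
    rw [LinearIsometryEquiv.inner_map_map, LinearIsometryEquiv.inner_map_map]
  have hm : ∀ α β : Fin 1 → ι,
      ⟪b (β 0), (W ∘L dens ω ∘L W.adjoint) (b (α 0))⟫_ℂ = ω (matUnit α β) := fun α β => by
    change ⟪b (β 0), W (dens ω (W.adjoint (b (α 0))))⟫_ℂ = _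
    rw [← ContinuousLinearMap.adjoint_inner_left W, hW', hW', dens_apply_stdBasis]
  refine ⟨W ∘L dens ω ∘L W.adjoint, ⟨hp.conj_adjoint W, ?_⟩, hm⟩
  have h2 := hasSum_trace_dens (stdBasis (Fin 1 → ι)) hω
  rw [h1, ← e.hasSum_iff] at h2
  refine h2.congr_fun fun i => ?_
  rw [Function.comp_apply, dens_apply_stdBasis]
  exact hm (e i) (e i)

/-- Propagation of chaos for short times. -/
theorem exists_isChaotic_of_small {ρ : H →L[ℂ] H} {ϱ : (N : ℕ) → NOp ι N}
    (hc : IsChaotic b ρ ϱ) {t : ℝ} (ht : 0 ≤ t) (ht' : 16 * t < 1) :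
    ∃ ρt : H →L[ℂ] H, IsChaotic b ρt (fun N => S.semigroup N t (ϱ N)) := by
  have hex : ∀ N, ∃ φ : OpDual (L2 (Fin N → ι)), 2 ≤ N →
      φ ∈ normal (L2 (Fin N → ι)) ∧ dens φ = ϱ N ∧ ‖φ‖ ≤ 1 ∧ IsSymmFun φ ∧ φ 1 = 1 := fun N => by
    by_cases hN : 2 ≤ N
    · obtain ⟨φ, hφ⟩ := exists_functional (hc.symm_density N hN)
      exact ⟨φ, fun _ => hφ⟩
    · exact ⟨0, fun h => absurd h hN⟩
  choose φ hφ using hex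
  have hφn := fun N hN => (hφ N hN).1
  have hφd := fun N hN => (hφ N hN).2.1
  have hφ1 := fun N hN => (hφ N hN).2.2.1
  have hφs := fun N hN => (hφ N hN).2.2.2.1
  have hpos : ∀ N, 2 ≤ N → (ϱ N).IsPositive := fun N hN => (hc.symm_density N hN).1.1
  have hτex : ∀ k, ∃ τ : OpDual (L2 (Fin k → ι)), 1 ≤ k →
      τ ∈ normal (L2 (Fin k → ι)) ∧ dens τ = tensorPow b ρ k ∧
        Tendsto (fun N => reduced k (φ N)) atTop (𝓝 τ) := fun k => by
    by_cases hk : 1 ≤ k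
    · obtain ⟨τ, h1, h2, h3⟩ := exists_normal_tendsto (k := k) hφn
        (fun N hN => by rw [hφd N hN]; exact hpos N hN)
        (isSelfAdjoint_tensorPow (b := b) hc.density.1.isSelfAdjoint k) (by
          refine (hc.tendsto k hk).congr' ?_
          filter_upwards [eventually_ge_atTop 2] with m hm
          rw [hφd _ (by omega)])
      exact ⟨τ, fun _ => ⟨h1, h2, h3⟩⟩
    · exact ⟨0, fun h => absurd h hk⟩
  choose τ hτ using hτex
  have hτt := fun k hk => (hτ k hk).2.2
  have hprod : IsProductFamily τ := isProductFamily_of_tensorPow hφs hτt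
    (fun k hk => (hτ k hk).1) (fun k hk => (hτ k hk).2.1)
  have hlim := fun k hk => S.tendsto_reduced_comp_semigroup hφs hφ1 hτt ht ht' k hk
  have hprodt := S.isProductFamily_limitFun hφs hφ1 hτt hprod ht ht'
  have hnt : ∀ N, 2 ≤ N → φ N ∘L S.semigroup N t ∈ normal (L2 (Fin N → ι)) := fun N hN =>
    S.comp_semigroup_mem_normal (hφn N hN) t
  have hdt : ∀ N, 2 ≤ N → dens (φ N ∘L S.semigroup N t) = S.semigroup N t (ϱ N) := fun N hN => by
    rw [dens_comp_semigroup, hφd N hN]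
  have hpt : ∀ N, 2 ≤ N → (dens (φ N ∘L S.semigroup N t)).IsPositive := fun N hN => by
    rw [hdt N hN]; exact S.isPositive_semigroup (hpos N hN) ht
  -- Normality, positivity and the value `1` at the identity all survive the norm limit, so the
  -- one-particle limit has a density matrix `ρt`.
  have hn : ∀ k, 1 ≤ k → S.limitFun τ t k ∈ normal (L2 (Fin k → ι)) := fun k hk =>
    isClosed_normal.mem_of_tendsto (hlim k hk) (by
      filter_upwards [eventually_ge_atTop 2] with N hN
      exact reduced_mem_normal k (hnt N hN))
  have hp1 : (dens (S.limitFun τ t 1)).IsPositive :=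
    isClosed_isPositive.mem_of_tendsto ((dens.continuous.tendsto _).comp (hlim 1 le_rfl)) (by
      filter_upwards [eventually_ge_atTop 2] with N hN
      exact isPositive_dens_reduced 1 (hnt N hN) (hpt N hN))
  have h1 : S.limitFun τ t 1 1 = 1 := by
    have h2 := (((ContinuousLinearMap.apply ℂ ℂ (1 : NOp ι 1)).continuous.tendsto _).comp
      (hlim 1 le_rfl))
    refine tendsto_nhds_unique h2 ?_
    refine tendsto_const_nhds.congr' ?_
    filter_upwards [eventually_ge_atTop 2] with N hN
    change 1 = reduced 1 (φ N ∘L S.semigroup N t) 1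
    rw [reduced_of_le (by omega), ContinuousLinearMap.comp_apply, embed_one,
      ContinuousLinearMap.comp_apply, semigroup_one S hN, (hφ N hN).2.2.2.2]
  obtain ⟨ρt, hρt, hm⟩ := exists_op_of_dens b (hn 1 le_rfl) hp1 h1
  refine ⟨ρt, hρt, fun N hN => S.isSymmDensityMatrix_semigroup hN (hc.symm_density N hN) ht,
    fun k hk => ?_⟩
  -- Factorisation forces the higher limits to be tensor powers of `ρt`; norm convergence of
  -- functionals then bounds the trace distances.
  have hd := dens_eq_tensorPow hprodt hm k hk
  have h2 : Tendsto (fun m => ENNReal.ofReal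
      ‖reduced k (φ (k + m) ∘L S.semigroup (k + m) t) - S.limitFun τ t k‖) atTop (𝓝 0) := by
    have h3 := tendsto_iff_norm_sub_tendsto_zero.1 (hlim k hk)
    have h4 := (ENNReal.tendsto_ofReal h3).comp (tendsto_add_atTop_nat k)
    rw [ENNReal.ofReal_zero] at h4
    refine h4.congr fun m => ?_
    rw [Function.comp_apply, Nat.add_comm]
  refine tendsto_of_tendsto_of_tendsto_of_le_of_le' tendsto_const_nhds h2
    (Eventually.of_forall fun m => zero_le) ?_
  filter_upwards [eventually_ge_atTop 2] with m hm2
  have hN : 2 ≤ k + m := by omega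
  rw [← hdt _ hN, marginal_dens_eq k m (hnt _ hN), ← hd, ← map_sub]
  refine traceNorm_dens_le _ (Submodule.sub_mem _ (reduced_mem_normal k (hnt _ hN)) (hn k hk)) ?_
  rw [map_sub, hd]
  exact (isPositive_dens_reduced k (hnt _ hN) (hpt _ hN)).isSelfAdjoint.sub
    (isSelfAdjoint_tensorPow hρt.1.isSelfAdjoint k)

/-- Propagation of chaos. -/
theorem exists_isChaotic {ρ : H →L[ℂ] H} {ϱ : (N : ℕ) → NOp ι N}
    (hc : IsChaotic b ρ ϱ) {t : ℝ} (ht : 0 ≤ t) :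
    ∃ ρt : H →L[ℂ] H, IsChaotic b ρt (fun N => S.semigroup N t (ϱ N)) := by
  -- The threshold `1 / 16` depends neither on the state nor on the specification, so `n` equal
  -- steps of length `t / n` can be chained, each starting from the chaotic sequence left by the one
  -- before.
  obtain ⟨n, hn⟩ := exists_nat_gt (16 * t)
  have hn0 : (0 : ℝ) < n := lt_of_le_of_lt (by positivity) hn
  have hs : 16 * (t / n) < 1 := by
    rw [← mul_div_assoc, div_lt_one hn0]; exact hn
  have key : ∀ m : ℕ, ∃ ρt : H →L[ℂ] H,
      IsChaotic b ρt (fun N => S.semigroup N (m * (t / n)) (ϱ N)) := by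
    intro m
    induction m with
    | zero => exact ⟨ρ, by simpa [semigroup_zero] using hc⟩
    | succ m ih =>
      obtain ⟨ρm, hm⟩ := ih
      obtain ⟨ρt, hρt⟩ := S.exists_isChaotic_of_small hm (by positivity) hs
      refine ⟨ρt, ?_⟩
      have h1 : ((m + 1 : ℕ) : ℝ) * (t / n) = t / n + m * (t / n) := by push_cast; ring
      simpa only [h1, semigroup_add] using hρt
  have h2 : (n : ℝ) * (t / n) = t := by field_simp
  simpa only [h2] using key n

end CollisionSpec

end QKac

end

theorem theorem3p1
    {H : Type*} [NormedAddCommGroup H] [InnerProductSpace ℂ H] [CompleteSpace H]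
    [TopologicalSpace.SeparableSpace H]
    {ι : Type*} (b : HilbertBasis ι ℂ H)
    (h : H →ₗ.[ℂ] H) (h_sa : IsSelfAdjoint h) (h_compact : HasCompactResolvent h)
    {C : Type*} [MetricSpace C] [CompactSpace C] [MeasurableSpace C] [BorelSpace C]
    (S : CollisionSpec b h C) (h_ergodic : S.IsErgodic)
    (ρ : H →L[ℂ] H) (ϱ : (N : ℕ) → NOp ι N) (h_chaotic : IsChaotic b ρ ϱ)
    (t : ℝ) (ht : 0 ≤ t) :
    ∃ ρt : H →L[ℂ] H, IsDensityMatrix b ρt ∧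
      Tendsto (fun m => traceNorm (stdBasis _)
        (marginal 1 m (S.semigroup (1 + m) t (ϱ (1 + m))) - tensorPow b ρt 1)) atTop (𝓝 0) ∧
      IsChaotic b ρt (fun N => S.semigroup N t (ϱ N)) := by
  obtain ⟨ρt, hρt⟩ := S.exists_isChaotic h_chaotic ht
  exact ⟨ρt, hρt.density, hρt.tendsto 1 le_rfl, hρt⟩
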